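/- Let $G=(Q,\Delta)$ be a compact quantum group: $Q$ is a nonzero unital $C^*$-algebra and $\Delta:Q\to Q\otimes Q$ (minimal tensor product) is a coassociative unital $^*$-homomorphism such that the linear spans of $(1\otimes Q)\Delta(Q)$ and $(Q\otimes 1)\Delta(Q)$ are dense in $Q\otimes Q$. A representation of $G$ means a finite-dimensional unitary representation. A dimension function on the representation ring $R(G)$ is a function $d$ assigning to every representation $u$ a real number $d(u)$ such that $d(u)=d(u')$ if $u$ and $u'$ are equivalent, $d(u\oplus u')=d(u)+d(u')$, $d(u\otimes u')=d(u)d(u')$, $d(\overline u)=d(u)$ and $d(u)>0$ if $u\neq0$. For a function $d$ of equivalence classes of representations, a representation $u$ and $n\ge 1$ set $$b(u,n)=\sum_v d(v)^2,$$ where $v$ runs over the inequivalent irreducible subrepresentations of the tensor powers $u^{\otimes k}$, $0\le k\le n$. One says that $d$ has polynomial growth if for every $u$ there is $\gamma>0$ with $b(u,n)=O(n^\gamma)$, and subexponential growth if $\lim_{n\to\infty} b(u,n)^{1/n}=1$ for every $u$. For an irreducible $u$ with conjugate $\overline u$, given by an invertible antilinear operator $j$ from the space of $u$ to the space of $\overline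 u$ with $\overline u_{\phi,\psi}=(u_{j^{-1}\phi,\,j^*\psi})^*$, let $F_u=j^*j$, where $j$ is normalised by $\operatorname{Tr}(F_u)=\operatorname{Tr}(F_u^{-1})$; the quantum dimension is $\dim_q(u)=\operatorname{Tr}(F_u)$, extended additively to all representations. $G$ is of Kac type if $F_u=I$ for all irreducible $u$. Let $\dim(u)$ be the dimension of the space of $u$. 1. Let $d$ be a dimension function on $R(G)$ of subexponential growth. Then every dimension function $d'$ on $R(G)$ satisfies $d'(u)\ge d(u)$ for all representations $u$. In particular, $R(G)$ admits at most one dimension function of subexponential growth. 2. $\dim_q$ has polynomial growth if and only if $\dim$ has polynomial growth and $G$ is of Kac type. 3. $\dim_q$ has subexponential growth if and only if $\dim$ has subexponential growth and $G$ is of Kac type. -/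

import Mathlib

open scoped TensorProduct

universe u v

noncomputable section

/-! ### The minimal (spatial) tensor product of C⋆-algebras -/

/-- The Hilbert space tensor product: completion of the algebraic tensor product with
`⟪x ⊗ y, x' ⊗ y'⟫ = ⟪x, x'⟫ ⟪y, y'⟫`. -/
def HilbertTensor (H K : Type*) [NormedAddCommGroup H] [InnerProductSpace ℂ H]
    [NormedAddCommGroup K] [InnerProductSpace ℂ K] : Type _ :=
  UniformSpace.Completion (H ⊗[ℂ] K)

section MinTensor

variable {H K : Type*} [NormedAddCommGroup H] [InnerProductSpace ℂ H]
  [NormedAddCommGroup K] [InnerProductSpace ℂ K]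

instance : NormedAddCommGroup (HilbertTensor H K) :=
  inferInstanceAs (NormedAddCommGroup (UniformSpace.Completion (H ⊗[ℂ] K)))

instance : InnerProductSpace ℂ (HilbertTensor H K) :=
  inferInstanceAs (InnerProductSpace ℂ (UniformSpace.Completion (H ⊗[ℂ] K)))

instance : CompleteSpace (HilbertTensor H K) :=
  inferInstanceAs (CompleteSpace (UniformSpace.Completion (H ⊗[ℂ] K)))

/-- The inclusion of the algebraic tensor product. -/
def HilbertTensor.coe (x : H ⊗[ℂ] K) : HilbertTensor H K :=
  (x : UniformSpace.Completion (H ⊗[ℂ] K))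

/-- The bounded operator `S ⊗ T` on the Hilbert space tensor product, with
`(S ⊗ T) (x ⊗ y) = S x ⊗ T y`. -/
def opTensor (S : H →L[ℂ] H) (T : K →L[ℂ] K) :
    HilbertTensor H K →L[ℂ] HilbertTensor H K :=
  (TensorProduct.mapL S T).completion

theorem opTensor_coe (S : H →L[ℂ] H) (T : K →L[ℂ] K) (x : H ⊗[ℂ] K) :
    opTensor S T (HilbertTensor.coe x) = HilbertTensor.coe (TensorProduct.mapL S T x) :=
  ContinuousLinearMap.completion_apply_coe _ _

theorem opTensor_ext {X Y : HilbertTensor H K →L[ℂ] HilbertTensor H K}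
    (h : ∀ x : H ⊗[ℂ] K, X (HilbertTensor.coe x) = Y (HilbertTensor.coe x)) : X = Y := by
  ext z
  exact UniformSpace.Completion.induction_on z (isClosed_eq X.continuous Y.continuous) h

theorem opTensor_mul (S S' : H →L[ℂ] H) (T T' : K →L[ℂ] K) :
    opTensor (S * S') (T * T') = opTensor S T * opTensor S' T' := by
  refine opTensor_ext fun x => ?_
  rw [mul_apply_eq_comp, opTensor_coe, opTensor_coe, opTensor_coe,
    TensorProduct.mapL_mul, mul_apply_eq_comp]

theorem opTensor_one : opTensor (1 : H →L[ℂ] H) (1 : K →L[ℂ] K) = 1 := by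
  refine opTensor_ext fun x => ?_
  rw [opTensor_coe, one_apply_eq_self]
  exact congrArg _ (congrArg (fun f => f x) TensorProduct.mapL_id_id)

theorem opTensor_zero_right (S : H →L[ℂ] H) : opTensor S (0 : K →L[ℂ] K) = 0 := by
  refine opTensor_ext fun x => ?_
  rw [opTensor_coe, TensorProduct.mapL_zero_right]
  exact UniformSpace.Completion.coe_zero

theorem opTensor_zero_left (T : K →L[ℂ] K) : opTensor (0 : H →L[ℂ] H) T = 0 := by
  refine opTensor_ext fun x => ?_
  rw [opTensor_coe, TensorProduct.mapL_zero_left]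
  exact UniformSpace.Completion.coe_zero

variable {A B : Type*} [CStarAlgebra A] [CStarAlgebra B] [CompleteSpace H] [CompleteSpace K]

/-- The closed ⋆-algebra of operators on the tensor product Hilbert space that is generated by the
operators `π a ⊗ ρ b`. -/
def minTensorSubalgebra (π : A →⋆ₐ[ℂ] (H →L[ℂ] H)) (ρ : B →⋆ₐ[ℂ] (K →L[ℂ] K)) :
    StarSubalgebra ℂ (HilbertTensor H K →L[ℂ] HilbertTensor H K) :=
  (StarAlgebra.adjoin ℂ {x | ∃ a b, x = opTensor (π a) (ρ b)}).topologicalClosure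

instance (π : A →⋆ₐ[ℂ] (H →L[ℂ] H)) (ρ : B →⋆ₐ[ℂ] (K →L[ℂ] K)) :
    IsClosed (minTensorSubalgebra π ρ : Set (HilbertTensor H K →L[ℂ] HilbertTensor H K)) :=
  StarSubalgebra.isClosed_topologicalClosure _

/-- The minimal tensor product `A ⊗ B` of two unital C⋆-algebras, formed with the help of
faithful representations `π` and `ρ` of `A` and `B` on Hilbert spaces: the C⋆-algebra generated by
the operators `π a ⊗ ρ b` on the tensor product Hilbert space. Up to isomorphism it does not depend
on the choice of the faithful representations. -/
def MinTensor (π : A →⋆ₐ[ℂ] (H →L[ℂ] H)) (ρ : B →⋆ₐ[ℂ] (K →L[ℂ] K)) : Type _ :=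
  minTensorSubalgebra π ρ

instance (π : A →⋆ₐ[ℂ] (H →L[ℂ] H)) (ρ : B →⋆ₐ[ℂ] (K →L[ℂ] K)) : CStarAlgebra (MinTensor π ρ) :=
  inferInstanceAs (CStarAlgebra (minTensorSubalgebra π ρ))

variable (π : A →⋆ₐ[ℂ] (H →L[ℂ] H)) (ρ : B →⋆ₐ[ℂ] (K →L[ℂ] K))

/-- The inclusion of `A ⊗ B` in the bounded operators, a faithful representation. -/
def MinTensor.rep : MinTensor π ρ →⋆ₐ[ℂ] (HilbertTensor H K →L[ℂ] HilbertTensor H K) :=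
  (minTensorSubalgebra π ρ).subtype

theorem MinTensor.rep_injective : Function.Injective (MinTensor.rep π ρ) :=
  Subtype.val_injective

/-- The elementary tensor `a ⊗ b` in the minimal tensor product. -/
def minTmul (a : A) (b : B) : MinTensor π ρ :=
  (⟨opTensor (π a) (ρ b), StarSubalgebra.le_topologicalClosure _
    (StarAlgebra.subset_adjoin ℂ _ ⟨a, b, rfl⟩)⟩ : minTensorSubalgebra π ρ)

theorem MinTensor.rep_minTmul (a : A) (b : B) :
    MinTensor.rep π ρ (minTmul π ρ a b) = opTensor (π a) (ρ b) := rfl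

theorem minTmul_mul (a a' : A) (b b' : B) :
    minTmul π ρ (a * a') (b * b') = minTmul π ρ a b * minTmul π ρ a' b' :=
  MinTensor.rep_injective π ρ (by simp [MinTensor.rep_minTmul, opTensor_mul])

theorem minTmul_one : minTmul π ρ 1 1 = 1 :=
  MinTensor.rep_injective π ρ (by simp [MinTensor.rep_minTmul, opTensor_one])

theorem minTmul_zero_right (a : A) : minTmul π ρ a 0 = 0 :=
  MinTensor.rep_injective π ρ (by simp [MinTensor.rep_minTmul, opTensor_zero_right])

theorem minTmul_zero_left (b : B) : minTmul π ρ 0 b = 0 :=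
  MinTensor.rep_injective π ρ (by simp [MinTensor.rep_minTmul, opTensor_zero_left])

end MinTensor

/-! ### Compact quantum groups -/

/-- A compact quantum group `G = (Q, Δ)`: a (nonzero) unital C⋆-algebra `Q` with a coassociative
unital ⋆-homomorphism `Δ : Q → Q ⊗ Q` (minimal tensor product) such that the linear spans of
`(1 ⊗ Q) Δ(Q)` and `(Q ⊗ 1) Δ(Q)` are dense in `Q ⊗ Q`.

The faithful representation `π` of `Q` on the Hilbert space `H` only serves to form the minimal
tensor products `Q ⊗ Q`, `(Q ⊗ Q) ⊗ Q` and `Q ⊗ (Q ⊗ Q)`. -/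
structure CompactQuantumGroup (Q : Type u) [CStarAlgebra Q] [Nontrivial Q] (H : Type v)
    [NormedAddCommGroup H] [InnerProductSpace ℂ H] [CompleteSpace H] where
  /-- a faithful representation of `Q` -/
  π : Q →⋆ₐ[ℂ] (H →L[ℂ] H)
  π_injective : Function.Injective π
  /-- the coproduct -/
  Δ : Q →⋆ₐ[ℂ] MinTensor π π
  /-- `(Δ ⊗ id) Δ = (id ⊗ Δ) Δ`, up to the canonical identification `assoc` of `(Q ⊗ Q) ⊗ Q` with
  `Q ⊗ (Q ⊗ Q)`. The ⋆-homomorphisms `ΔI = Δ ⊗ id`, `IΔ = id ⊗ Δ` and `assoc` exist for every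
  ⋆-homomorphism `Δ : Q → Q ⊗ Q`, and they are determined by their values on elementary tensors. -/
  coassoc :
    ∃ (ΔI : MinTensor π π →⋆ₐ[ℂ] MinTensor (MinTensor.rep π π) π)
      (IΔ : MinTensor π π →⋆ₐ[ℂ] MinTensor π (MinTensor.rep π π))
      (assoc : MinTensor (MinTensor.rep π π) π ≃⋆ₐ[ℂ] MinTensor π (MinTensor.rep π π)),
      (∀ a b, ΔI (minTmul π π a b) = minTmul (MinTensor.rep π π) π (Δ a) b) ∧
      (∀ a b, IΔ (minTmul π π a b) = minTmul π (MinTensor.rep π π) a (Δ b)) ∧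
      (∀ a b c, assoc (minTmul (MinTensor.rep π π) π (minTmul π π a b) c) =
        minTmul π (MinTensor.rep π π) a (minTmul π π b c)) ∧
      ∀ a, assoc (ΔI (Δ a)) = IΔ (Δ a)
  dense_right : Dense (Submodule.span ℂ {x | ∃ a b, x = minTmul π π 1 a * Δ b} :
    Set (MinTensor π π))
  dense_left : Dense (Submodule.span ℂ {x | ∃ a b, x = minTmul π π a 1 * Δ b} :
    Set (MinTensor π π))

namespace CompactQuantumGroup

variable {Q : Type u} [CStarAlgebra Q] [Nontrivial Q] {H : Type v}
  [NormedAddCommGroup H] [InnerProductSpace ℂ H] [CompleteSpace H]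

/-- A (finite-dimensional, unitary) representation of `G` on the Hilbert space with orthonormal
basis indexed by the finite set `ι`, given by its unitary matrix `(u i j)` of coefficients
`u i j = u_{e_i, e_j}` in `Q`, with `Δ (u i j) = ∑ k, u i k ⊗ u k j`. -/
structure Rep (G : CompactQuantumGroup Q H) where
  /-- index set of an orthonormal basis -/
  ι : Type
  [fintype : Fintype ι]
  [decEq : DecidableEq ι]
  /-- matrix coefficients -/
  mat : Matrix ι ι Q
  unitary : mat ∈ unitary (Matrix ι ι Q)
  comul : ∀ i j, G.Δ (mat i j) = ∑ k, minTmul G.π G.π (mat i k) (mat k j)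

attribute [instance] Rep.fintype Rep.decEq

variable {G : CompactQuantumGroup Q H}

namespace Rep

/-- The vector dimension. -/
def dim (u : Rep G) : ℕ := Fintype.card u.ι

/-- The trivial representation on `ℂ`. -/
def trivial (G : CompactQuantumGroup Q H) : Rep G where
  ι := Unit
  mat := 1
  unitary := one_mem _
  comul := by
    intro i j
    simp [minTmul_one]

/-- The direct sum of two representations. -/
def sum (u w : Rep G) : Rep G where
  ι := u.ι ⊕ w.ι
  mat := Matrix.fromBlocks u.mat 0 0 w.mat
  unitary := by
    have hu := Unitary.mem_iff.1 u.unitary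
    have hw := Unitary.mem_iff.1 w.unitary
    rw [Matrix.star_eq_conjTranspose] at hu hw
    rw [Unitary.mem_iff, Matrix.star_eq_conjTranspose, Matrix.fromBlocks_conjTranspose,
      Matrix.fromBlocks_multiply, Matrix.fromBlocks_multiply]
    simp [hu.1, hu.2, hw.1, hw.2]
  comul := by
    rintro (i | i) (j | j) <;>
      simp [Fintype.sum_sum_type, u.comul, w.comul, minTmul_zero_left, minTmul_zero_right]

/-- The tensor product of two representations,
`(u ⊗ w)_{(i,i'),(j,j')} = u_{i,j} w_{i',j'}`. -/
def tensor (u w : Rep G) : Rep G where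
  ι := u.ι × w.ι
  mat := Matrix.of fun i j => u.mat i.1 j.1 * w.mat i.2 j.2
  unitary := by
    have hu := Unitary.mem_iff.1 u.unitary
    have hw := Unitary.mem_iff.1 w.unitary
    have hu1 := fun i j => congrFun (congrFun hu.1 i) j
    have hu2 := fun i j => congrFun (congrFun hu.2 i) j
    have hw1 := fun i j => congrFun (congrFun hw.1 i) j
    have hw2 := fun i j => congrFun (congrFun hw.2 i) j
    simp only [Matrix.mul_apply, Matrix.star_apply, Matrix.one_apply] at hu1 hu2 hw1 hw2
    rw [Unitary.mem_iff]
    constructor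
    · ext ⟨i, i'⟩ ⟨j, j'⟩
      simp only [Matrix.mul_apply, Matrix.star_apply, Matrix.of_apply, star_mul,
        Fintype.sum_prod_type, Matrix.one_apply, Prod.mk.injEq]
      rw [Finset.sum_comm]
      have h : ∀ k' : w.ι, ∑ k : u.ι, star (w.mat k' i') * star (u.mat k i) *
          (u.mat k j * w.mat k' j') =
          star (w.mat k' i') * (if i = j then 1 else 0) * w.mat k' j' := by
        intro k'
        rw [← hu1, Finset.mul_sum, Finset.sum_mul]
        simp only [mul_assoc]
      simp only [h]
      by_cases hij : i = j
      · simpa [hij] using hw1 i' j'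
      · simp [hij]
    · ext ⟨i, i'⟩ ⟨j, j'⟩
      simp only [Matrix.mul_apply, Matrix.star_apply, Matrix.of_apply, star_mul,
        Fintype.sum_prod_type, Matrix.one_apply, Prod.mk.injEq]
      have h : ∀ k : u.ι, ∑ k' : w.ι, u.mat i k * w.mat i' k' *
          (star (w.mat j' k') * star (u.mat j k)) =
          u.mat i k * (if i' = j' then 1 else 0) * star (u.mat j k) := by
        intro k
        rw [← hw2, Finset.mul_sum, Finset.sum_mul]
        simp only [mul_assoc]
      simp only [h]
      by_cases hij : i' = j'
      · simpa [hij] using hu2 i j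
      · simp [hij]
  comul := by
    intro i j
    simp only [Matrix.of_apply, map_mul, u.comul, w.comul, Fintype.sum_prod_type, minTmul_mul,
      Finset.sum_mul_sum]

/-- The tensor power `u^{⊗ n}`. -/
def tpow (u : Rep G) : ℕ → Rep G
  | 0 => trivial G
  | n + 1 => (tpow u n).tensor u

/-- The space of intertwiners `(u, w)`: linear operators `T` from the space of `u` to that of `w`
with `(T ⊗ 1) u = w (T ⊗ 1)`. -/
def Hom (u w : Rep G) : Submodule ℂ (Matrix w.ι u.ι ℂ) where
  carrier := {T | T.map (algebraMap ℂ Q) * u.mat = w.mat * T.map (algebraMap ℂ Q)}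
  add_mem' := by
    intro S T hS hT
    simp only [Set.mem_ofPred_eq] at *
    rw [Matrix.map_add _ (map_add _), Matrix.add_mul, Matrix.mul_add, hS, hT]
  zero_mem' := by simp
  smul_mem' := by
    intro c T hT
    simp only [Set.mem_ofPred_eq] at *
    have h : (c • T).map (algebraMap ℂ Q) = c • T.map (algebraMap ℂ Q) := by
      ext i j
      simp [Algebra.smul_def]
    rw [h, Matrix.smul_mul, Matrix.mul_smul, hT]

/-- Equivalence of representations: there is an invertible intertwiner. -/
def Equivalent (u w : Rep G) : Prop :=
  ∃ T ∈ Hom u w, ∃ S : Matrix u.ι w.ι ℂ, S * T = 1 ∧ T * S = 1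

/-- `w` is (equivalent to) a subrepresentation of `u`: there is an isometric intertwiner. -/
def IsSubrep (w u : Rep G) : Prop :=
  ∃ T ∈ Hom w u, T.conjTranspose * T = 1

/-- A representation is irreducible if it is nonzero and has no proper nonzero
subrepresentation. -/
def IsIrreducible (u : Rep G) : Prop :=
  u.dim ≠ 0 ∧ ∀ w : Rep G, IsSubrep w u → w.dim = 0 ∨ w.dim = u.dim

theorem Equivalent.refl (u : Rep G) : Equivalent u u :=
  ⟨1, by simp [Hom], 1, by simp, by simp⟩

theorem Equivalent.symm {u w : Rep G} (h : Equivalent u w) : Equivalent w u := by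
  obtain ⟨T, hT, S, hST, hTS⟩ := h
  refine ⟨S, ?_, T, hTS, hST⟩
  have h1 := congrArg (fun M => M.map (algebraMap ℂ Q)) hST
  have h2 := congrArg (fun M => M.map (algebraMap ℂ Q)) hTS
  simp only [Matrix.map_mul, Matrix.map_one _ (map_zero (algebraMap ℂ Q))
    (map_one (algebraMap ℂ Q))] at h1 h2
  change S.map _ * w.mat = u.mat * S.map _
  change T.map _ * u.mat = w.mat * T.map _ at hT
  rw [← Matrix.mul_one (S.map (algebraMap ℂ Q) * w.mat), ← h2, ← Matrix.mul_assoc,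
    Matrix.mul_assoc _ w.mat, ← hT, ← Matrix.mul_assoc, h1, Matrix.one_mul]

theorem Equivalent.trans {u w x : Rep G} (h : Equivalent u w) (h' : Equivalent w x) :
    Equivalent u x := by
  obtain ⟨T, hT, S, hST, hTS⟩ := h
  obtain ⟨T', hT', S', hST', hTS'⟩ := h'
  refine ⟨T' * T, ?_, S * S', ?_, ?_⟩
  · change T.map _ * u.mat = w.mat * T.map _ at hT
    change T'.map _ * w.mat = x.mat * T'.map _ at hT'
    change (T' * T).map _ * u.mat = x.mat * (T' * T).map _
    rw [Matrix.map_mul, Matrix.mul_assoc, hT, ← Matrix.mul_assoc, hT', Matrix.mul_assoc]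
  · rw [Matrix.mul_assoc, ← Matrix.mul_assoc S', hST', Matrix.one_mul, hST]
  · rw [Matrix.mul_assoc, ← Matrix.mul_assoc T, hTS, Matrix.one_mul, hTS']

/-- An invertible antilinear operator `j` from the space of `u` to the space of `w`, exhibiting `w`
as a conjugate of `u`: `w_{φ,ψ} = (u_{j⁻¹ φ, j⋆ ψ})⋆`.

`J` is the matrix of `j`, that is `j e_i = ∑ k, J k i • f_k`; then `j⁻¹ f_k = ∑ i, conj (J⁻¹ i k) • e_i`
and `j⋆ f_l = ∑ i, J l i • e_i`. As `u_{ξ,η}` is antilinear in `ξ` and linear in `η`, the coefficient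
`u_{j⁻¹ f_k, j⋆ f_l}` is `∑ a b, (J⁻¹ a k * J l b) • u a b`. -/
structure Conjugation (u w : Rep G) where
  /-- the matrix of `j` -/
  J : Matrix w.ι u.ι ℂ
  /-- the inverse matrix -/
  Jinv : Matrix u.ι w.ι ℂ
  inv_mul : Jinv * J = 1
  mul_inv : J * Jinv = 1
  conj_eq : ∀ k l, w.mat k l = star (∑ a, ∑ b, (Jinv a k * J l b) • u.mat a b)

/-- `w` is a conjugate of `u`. -/
def IsConjugate (u w : Rep G) : Prop := Nonempty (Conjugation u w)

/-- The matrix of the positive operator `j⋆ j` on the space of `u`. -/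
def Conjugation.F {u w : Rep G} (c : Conjugation u w) : Matrix u.ι u.ι ℂ :=
  c.J.transpose * c.J.map star

open Classical in
/-- For irreducible `u`, the operator `F_u = j⋆ j`, for `j` a conjugation of `u` normalised by
`Tr (j⋆ j) = Tr ((j⋆ j)⁻¹)`. It does not depend on the choice of `j`. -/
def F (u : Rep G) : Matrix u.ι u.ι ℂ :=
  if h : ∃ (w : Rep G) (c : Conjugation u w), c.F.trace = (c.F⁻¹).trace then
    h.choose_spec.choose.F
  else 0

end Rep

/-- `G` is of Kac type if `F_u = 1` for every irreducible representation `u`. -/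
def IsKac (G : CompactQuantumGroup Q H) : Prop :=
  ∀ u : Rep G, u.IsIrreducible → u.F = 1

/-- Equivalence of irreducible representations. -/
def irrSetoid (G : CompactQuantumGroup Q H) : Setoid {u : Rep G // u.IsIrreducible} where
  r u w := Rep.Equivalent u.1 w.1
  iseqv := ⟨fun u => .refl u.1, fun h => h.symm, fun h h' => h.trans h'⟩

/-- The set of equivalence classes of irreducible representations of `G`. -/
def Irr (G : CompactQuantumGroup Q H) : Type _ := Quotient (irrSetoid G)

/-- A fixed representative of a class of irreducible representations. -/
def Irr.rep (x : Irr G) : Rep G := (Quotient.out (s := irrSetoid G) x).1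

/-- The vector dimension function. -/
def vdim (G : CompactQuantumGroup Q H) (u : Rep G) : ℝ := u.dim

/-- The quantum dimension function: `Tr F_x` for an irreducible `x`, extended additively to all
representations (the multiplicity of `x` in `u` is the dimension of the space of intertwiners
from `x` to `u`; the sum has finitely many nonzero terms). -/
def qdim (G : CompactQuantumGroup Q H) (u : Rep G) : ℝ :=
  ∑ᶠ x : Irr G, (Module.finrank ℂ (Rep.Hom x.rep u) : ℝ) * x.rep.F.trace.re

/-- A dimension function on the representation ring `R(G)`: a function `d` of the class of a
representation which is additive, multiplicative, invariant under conjugation and positive on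
nonzero representations. -/
structure IsDimensionFunction (G : CompactQuantumGroup Q H) (d : Rep G → ℝ) : Prop where
  congr : ∀ u w : Rep G, u.Equivalent w → d u = d w
  sum : ∀ u w : Rep G, d (u.sum w) = d u + d w
  tensor : ∀ u w : Rep G, d (u.tensor w) = d u * d w
  conj : ∀ u w : Rep G, u.IsConjugate w → d w = d u
  pos : ∀ u : Rep G, u.dim ≠ 0 → 0 < d u

/-- `b(u, n) = ∑ d(x)²`, the sum over the inequivalent irreducible subrepresentations `x` of the
tensor powers `u^{⊗ k}`, `0 ≤ k ≤ n`. There are finitely many of them. -/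
def growth (d : Rep G → ℝ) (u : Rep G) (n : ℕ) : ℝ :=
  ∑ᶠ (x : Irr G) (_ : ∃ k ≤ n, Rep.IsSubrep x.rep (u.tpow k)), d x.rep ^ 2

/-- `d` has polynomial growth. -/
def PolynomialGrowth (d : Rep G → ℝ) : Prop :=
  ∀ u : Rep G, ∃ γ : ℝ, 0 < γ ∧
    (fun n : ℕ => growth d u n) =O[Filter.atTop] fun n : ℕ => (n : ℝ) ^ γ

/-- `d` has subexponential growth. -/
def SubexponentialGrowth (d : Rep G → ℝ) : Prop :=
  ∀ u : Rep G,
    Filter.Tendsto (fun n : ℕ => growth d u n ^ (1 / (n : ℝ))) Filter.atTop (nhds 1)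

end CompactQuantumGroup

end

/-!
# Dimension functions of subexponential growth on compact quantum groups

The comparison of dimension functions is an application of the Cauchy-Schwarz inequality. If `m_x` is
the multiplicity of the irreducible `x` in `u^{⊗ n}`, then
`d(u)^{2n} = (∑ m_x d(x))² ≤ (∑ m_x²) b(u, n) ≤ d'(u)^{2n} b(u, n)` for all `d'` with `d'(x) ≥ 1`; if
`b(u, n)` grows subexponentially, taking `2n`-th roots gives `d(u) ≤ d'(u)` (`le_of_growth`). For
dimension functions `d'(x) ≥ 1` holds because `x` tensored with its conjugate contains the trivial
representation (`IsDimensionFunction.one_le`), and for the vector dimension it is evident.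

This applies to the quantum dimension `d = dim_q` and the vector dimension `d' = dim`. As
`Tr F_u = Tr F_u⁻¹` implies `Tr F_u ≥ dim u` with equality only for `F_u = 1`, the inequality
`dim_q ≤ dim` says that `G` is of Kac type (`isKac_of_qdim_le`); conversely the two dimensions agree
if `G` is of Kac type.

What takes most of the work is that `dim_q` is well defined and multiplicative. This needs

* the Haar state `h` (`exists_isHaar`), which is constructed in the abstract setting of a C⋆-algebra
  with slice maps, `SlicedCoproduct.exists_haar`, by compactness of the state space;
* the decomposition of representations into irreducible ones, stated as an induction principle
  (`Rep.induction`), and Schur's lemma;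
* the existence of conjugates of an irreducible `u` (`IsIrreducible.exists_conjugation`): the Haar
  averages of `ū⋆ ū` and `ū ū⋆`, where `ū = (u_ij⋆)`, are invertible, because `h` is faithful on the
  coefficients of a row of `u` (`IsHaar.eq_zero_of_row`), and the first of them serves to turn `ū`
  into a unitary representation;
* a description of `dim_q(u)` for all `u` as the trace of an operator `F` that intertwines `u` with
  its double conjugate and satisfies `Tr (F T) = Tr (F⁻¹ T)` for all self-intertwiners `T`
  (`IsSpherical`). The trace of such an `F` is unique, and if `F` and `K` are such operators for `u`
  and `w`, so is `F ⊗ K` for `u ⊗ w` (`IsSpherical.tensor`).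
-/

open scoped CStarAlgebra ComplexOrder

noncomputable section

/-! ### Slice maps on the minimal tensor product -/

section MinTensorSlices

variable {H K : Type*} [NormedAddCommGroup H] [InnerProductSpace ℂ H]
  [NormedAddCommGroup K] [InnerProductSpace ℂ K]

theorem HilbertTensor.coe_add (x y : H ⊗[ℂ] K) :
    HilbertTensor.coe (x + y) = HilbertTensor.coe x + HilbertTensor.coe y :=
  UniformSpace.Completion.coe_add x y

theorem HilbertTensor.coe_smul (c : ℂ) (x : H ⊗[ℂ] K) :
    HilbertTensor.coe (c • x) = c • HilbertTensor.coe x :=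
  UniformSpace.Completion.coe_smul c x

theorem HilbertTensor.inner_coe (x y : H ⊗[ℂ] K) :
    inner ℂ (HilbertTensor.coe x) (HilbertTensor.coe y) = inner ℂ x y :=
  UniformSpace.Completion.inner_coe x y

theorem HilbertTensor.norm_coe_tmul (x : H) (y : K) :
    ‖HilbertTensor.coe (x ⊗ₜ[ℂ] y)‖ = ‖x‖ * ‖y‖ :=
  (UniformSpace.Completion.norm_coe _).trans (TensorProduct.norm_tmul x y)

theorem opTensor_coe_tmul (S : H →L[ℂ] H) (T : K →L[ℂ] K) (x : H) (y : K) :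
    opTensor S T (HilbertTensor.coe (x ⊗ₜ y)) = HilbertTensor.coe (S x ⊗ₜ T y) := by
  rw [opTensor_coe, TensorProduct.mapL_tmul]

theorem opTensor_add_left (S S' : H →L[ℂ] H) (T : K →L[ℂ] K) :
    opTensor (S + S') T = opTensor S T + opTensor S' T := by
  refine opTensor_ext fun x => ?_
  simp only [opTensor_coe, TensorProduct.mapL_add_left, add_apply, HilbertTensor.coe_add]

theorem opTensor_add_right (S : H →L[ℂ] H) (T T' : K →L[ℂ] K) :
    opTensor S (T + T') = opTensor S T + opTensor S T' := by
  refine opTensor_ext fun x => ?_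
  simp only [opTensor_coe, TensorProduct.mapL_add_right, add_apply, HilbertTensor.coe_add]

theorem opTensor_smul_left (c : ℂ) (S : H →L[ℂ] H) (T : K →L[ℂ] K) :
    opTensor (c • S) T = c • opTensor S T := by
  refine opTensor_ext fun x => ?_
  simp only [opTensor_coe, TensorProduct.mapL_smul_left, smul_apply,
    HilbertTensor.coe_smul]

theorem opTensor_smul_right (c : ℂ) (S : H →L[ℂ] H) (T : K →L[ℂ] K) :
    opTensor S (c • T) = c • opTensor S T := by
  refine opTensor_ext fun x => ?_
  simp only [opTensor_coe, TensorProduct.mapL_smul_right, smul_apply,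
    HilbertTensor.coe_smul]

variable [CompleteSpace H] [CompleteSpace K]

theorem opTensor_star (S : H →L[ℂ] H) (T : K →L[ℂ] K) :
    star (opTensor S T) = opTensor (star S) (star T) := by
  refine opTensor_ext fun x => ?_
  refine ext_inner_right ℂ fun z => ?_
  refine UniformSpace.Completion.induction_on z
    (isClosed_eq (continuous_const.inner continuous_id) (continuous_const.inner continuous_id))
    fun y => ?_
  change inner ℂ _ (HilbertTensor.coe y) = inner ℂ _ (HilbertTensor.coe y)
  rw [ContinuousLinearMap.star_eq_adjoint, ContinuousLinearMap.adjoint_inner_left, opTensor_coe,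
    opTensor_coe, HilbertTensor.inner_coe, HilbertTensor.inner_coe]
  induction x with
  | zero => simp
  | add x x' hx hx' => simp only [map_add, inner_add_left, hx, hx']
  | tmul a b =>
    induction y with
    | zero => simp
    | add y y' hy hy' => simp only [map_add, inner_add_right, hy, hy']
    | tmul c d =>
      simp only [TensorProduct.mapL_tmul, TensorProduct.inner_tmul,
        ContinuousLinearMap.star_eq_adjoint, ContinuousLinearMap.adjoint_inner_left]

variable {A B : Type*} [CStarAlgebra A] [CStarAlgebra B]
  (π : A →⋆ₐ[ℂ] (H →L[ℂ] H)) (ρ : B →⋆ₐ[ℂ] (K →L[ℂ] K))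

/-- The map `(a, b) ↦ a ⊗ b` into the minimal tensor product, as a bilinear map. -/
def minTmulₗ : A →ₗ[ℂ] B →ₗ[ℂ] MinTensor π ρ :=
  LinearMap.mk₂ ℂ (minTmul π ρ)
    (fun a a' b => MinTensor.rep_injective π ρ (by
      simp [MinTensor.rep_minTmul, opTensor_add_left]))
    (fun c a b => MinTensor.rep_injective π ρ (by
      simp [MinTensor.rep_minTmul, opTensor_smul_left]))
    (fun a b b' => MinTensor.rep_injective π ρ (by
      simp [MinTensor.rep_minTmul, opTensor_add_right]))
    (fun c a b => MinTensor.rep_injective π ρ (by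
      simp [MinTensor.rep_minTmul, opTensor_smul_right]))

@[simp]
theorem minTmulₗ_apply (a : A) (b : B) : minTmulₗ π ρ a b = minTmul π ρ a b := rfl

theorem minTmul_star (a : A) (b : B) :
    star (minTmul π ρ a b) = minTmul π ρ (star a) (star b) :=
  MinTensor.rep_injective π ρ (by simp [MinTensor.rep_minTmul, opTensor_star, map_star])

/-- The inclusion `a ↦ a ⊗ 1` of the first factor. -/
def minInclLeft : A →⋆ₐ[ℂ] MinTensor π ρ where
  toFun a := minTmul π ρ a 1
  map_one' := minTmul_one π ρ
  map_mul' a a' := by rw [← minTmul_mul, mul_one]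
  map_zero' := minTmul_zero_left π ρ 1
  map_add' a a' := by simp only [← minTmulₗ_apply, map_add, LinearMap.add_apply]
  commutes' c := by
    simp only [Algebra.algebraMap_eq_smul_one, ← minTmul_one π ρ, ← minTmulₗ_apply, map_smul,
      LinearMap.smul_apply]
  map_star' a := by rw [minTmul_star, star_one]

/-- The inclusion `b ↦ 1 ⊗ b` of the second factor. -/
def minInclRight : B →⋆ₐ[ℂ] MinTensor π ρ where
  toFun b := minTmul π ρ 1 b
  map_one' := minTmul_one π ρ
  map_mul' a a' := by rw [← minTmul_mul, mul_one]
  map_zero' := minTmul_zero_right π ρ 1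
  map_add' a a' := by simp only [← minTmulₗ_apply, map_add]
  commutes' c := by
    simp only [Algebra.algebraMap_eq_smul_one, ← minTmul_one π ρ, ← minTmulₗ_apply, map_smul]
  map_star' a := by rw [minTmul_star, star_one]

theorem continuous_minTmul_left (b : B) : Continuous fun a => minTmul π ρ a b := by
  have h : (fun a => minTmul π ρ a b) = fun a => minInclLeft π ρ a * minTmul π ρ 1 b := by
    funext a
    change _ = minTmul π ρ a 1 * minTmul π ρ 1 b
    rw [← minTmul_mul, mul_one, one_mul]
  rw [h]
  exact (map_continuous (minInclLeft π ρ)).mul continuous_const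

/-- The canonical map of the algebraic into the minimal tensor product. -/
def algToMin : A ⊗[ℂ] B →ₗ[ℂ] MinTensor π ρ := TensorProduct.lift (minTmulₗ π ρ)

@[simp]
theorem algToMin_tmul (a : A) (b : B) : algToMin π ρ (a ⊗ₜ b) = minTmul π ρ a b := rfl

/-- The linear span of the elementary tensors is already a `⋆`-algebra, so its closure is the
`C⋆`-algebra generated by the elementary tensors. -/
theorem denseRange_algToMin : DenseRange (algToMin π ρ) := by
  have key : ∀ x ∈ StarAlgebra.adjoin ℂ {x | ∃ a b, x = opTensor (π a) (ρ b)},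
      ∃ z, MinTensor.rep π ρ (algToMin π ρ z) = x := by
    intro x hx
    induction hx using StarAlgebra.adjoin_induction with
    | mem x hx =>
      obtain ⟨a, b, rfl⟩ := hx
      exact ⟨a ⊗ₜ b, MinTensor.rep_minTmul π ρ a b⟩
    | algebraMap c =>
      refine ⟨c • (1 ⊗ₜ 1), ?_⟩
      rw [map_smul, map_smul, algToMin_tmul, minTmul_one, map_one, Algebra.algebraMap_eq_smul_one]
    | add x y _ _ hx hy =>
      obtain ⟨z, rfl⟩ := hx
      obtain ⟨w, rfl⟩ := hy
      exact ⟨z + w, by simp⟩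
    | mul x y _ _ hx hy =>
      obtain ⟨z, rfl⟩ := hx
      obtain ⟨w, rfl⟩ := hy
      rw [← map_mul]
      refine ⟨z * w, congrArg _ ?_⟩
      clear * -
      induction z with
      | zero => simp
      | add z z' hz hz' => simp only [add_mul, map_add, hz, hz']
      | tmul a b =>
        induction w with
        | zero => simp
        | add w w' hw hw' => simp only [mul_add, map_add, hw, hw']
        | tmul c d =>
          rw [Algebra.TensorProduct.tmul_mul_tmul, algToMin_tmul, algToMin_tmul, algToMin_tmul,
            minTmul_mul]
    | star x _ hx =>
      obtain ⟨z, rfl⟩ := hx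
      rw [← map_star]
      clear * -
      induction z with
      | zero => exact ⟨0, by simp⟩
      | add z z' hz hz' =>
        obtain ⟨w, hw⟩ := hz
        obtain ⟨w', hw'⟩ := hz'
        exact ⟨w + w', by simp only [map_add, star_add, hw, hw']⟩
      | tmul a b =>
        exact ⟨star a ⊗ₜ star b, by rw [algToMin_tmul, algToMin_tmul, minTmul_star]⟩
  intro y
  have hy : (MinTensor.rep π ρ y) ∈
      closure (StarAlgebra.adjoin ℂ {x | ∃ a b, x = opTensor (π a) (ρ b)} :
        Set (HilbertTensor H K →L[ℂ] HilbertTensor H K)) := by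
    rw [← StarSubalgebra.topologicalClosure_coe]
    exact Subtype.property (p := fun x => x ∈ minTensorSubalgebra π ρ) y
  have hind : Topology.IsInducing (MinTensor.rep π ρ) := Topology.IsInducing.subtypeVal
  rw [hind.closure_eq_preimage_closure_image]
  refine closure_mono ?_ hy
  intro x hx
  obtain ⟨z, hz⟩ := key x hx
  exact ⟨_, ⟨z, rfl⟩, hz⟩

/-- Two continuous maps on the minimal tensor product that are additive agree as soon as they agree
on elementary tensors. -/
theorem minTensor_ext {E : Type*} [AddCommMonoid E] [Module ℂ E] [TopologicalSpace E] [T2Space E]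
    {f g : MinTensor π ρ →ₗ[ℂ] E} (hf : Continuous f) (hg : Continuous g)
    (h : ∀ a b, f (minTmul π ρ a b) = g (minTmul π ρ a b)) : f = g := by
  have h1 : f ∘ₗ algToMin π ρ = g ∘ₗ algToMin π ρ := TensorProduct.ext' h
  refine LinearMap.coe_injective ((denseRange_algToMin π ρ).equalizer hf hg ?_)
  funext z
  exact LinearMap.congr_fun h1 z

/-- The slice map `φ ⊗ id` on the algebraic tensor product. -/
def algSliceLeft (φ : A →ₗ[ℂ] ℂ) : A ⊗[ℂ] B →ₗ[ℂ] B :=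
  TensorProduct.lift (LinearMap.lsmul ℂ B ∘ₗ φ)

@[simp]
theorem algSliceLeft_tmul (φ : A →ₗ[ℂ] ℂ) (a : A) (b : B) :
    algSliceLeft φ (a ⊗ₜ[ℂ] b) = φ a • b := rfl

/-- The slice map `id ⊗ φ` on the algebraic tensor product. -/
def algSliceRight (φ : B →ₗ[ℂ] ℂ) : A ⊗[ℂ] B →ₗ[ℂ] A :=
  TensorProduct.lift (LinearMap.lsmul ℂ A ∘ₗ φ).flip

@[simp]
theorem algSliceRight_tmul (φ : B →ₗ[ℂ] ℂ) (a : A) (b : B) :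
    algSliceRight φ (a ⊗ₜ[ℂ] b) = φ b • a := rfl

/-- The vector functional `a ↦ ⟪ξ', π a ξ⟫`. -/
def vectorFunctional (ξ' ξ : H) : A →ₗ[ℂ] ℂ where
  toFun a := inner ℂ ξ' (π a ξ)
  map_add' a b := by simp
  map_smul' c a := by simp

theorem vectorFunctional_apply (ξ' ξ : H) (a : A) :
    vectorFunctional π ξ' ξ a = inner ℂ ξ' (π a ξ) := rfl

variable {π ρ}

/-- The slice by a vector functional of the second factor is the compression of an operator, hence
bounded for the norm of the minimal tensor product. -/
theorem norm_algSliceRight_vectorFunctional_le (hπ : Function.Injective π) (η' η : K)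
    (z : A ⊗[ℂ] B) :
    ‖algSliceRight (vectorFunctional ρ η' η) z‖ ≤ ‖η'‖ * ‖η‖ * ‖algToMin π ρ z‖ := by
  set s := algSliceRight (vectorFunctional ρ η' η) (A := A)
  have hs : ∀ x y : H, inner ℂ y (π (s z) x) = inner ℂ (HilbertTensor.coe (y ⊗ₜ[ℂ] η'))
      (MinTensor.rep π ρ (algToMin π ρ z) (HilbertTensor.coe (x ⊗ₜ[ℂ] η))) := by
    intro x y
    induction z with
    | zero => simp
    | add z z' hz hz' => simp only [map_add, add_apply, inner_add_right, hz, hz']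
    | tmul a b =>
      rw [algToMin_tmul, MinTensor.rep_minTmul, opTensor_coe_tmul, HilbertTensor.inner_coe,
        TensorProduct.inner_tmul]
      simp [s, vectorFunctional_apply, mul_comm]
  rw [← (NonUnitalStarAlgHom.isometry π hπ).norm_map_of_map_zero (map_zero π)]
  refine ContinuousLinearMap.opNorm_le_of_re_inner_le (by positivity) fun x y hx hy => ?_
  have h1 : ‖MinTensor.rep π ρ (algToMin π ρ z)‖ ≤ ‖algToMin π ρ z‖ := le_rfl
  calc RCLike.re (inner ℂ (π (s z) x) y) = RCLike.re (inner ℂ y (π (s z) x)) := inner_re_symm _ _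
    _ ≤ ‖inner ℂ y (π (s z) x)‖ := RCLike.re_le_norm _
    _ ≤ ‖HilbertTensor.coe (y ⊗ₜ[ℂ] η')‖ * ‖MinTensor.rep π ρ (algToMin π ρ z)
        (HilbertTensor.coe (x ⊗ₜ[ℂ] η))‖ := by rw [hs]; exact norm_inner_le_norm _ _
    _ ≤ ‖η'‖ * (‖algToMin π ρ z‖ * ‖η‖) := by
      rw [HilbertTensor.norm_coe_tmul, hy, one_mul]
      gcongr
      refine (ContinuousLinearMap.le_opNorm _ _).trans ?_
      rw [HilbertTensor.norm_coe_tmul, hx, one_mul]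
      gcongr
    _ = _ := by ring

theorem norm_algSliceLeft_vectorFunctional_le (hρ : Function.Injective ρ) (ξ' ξ : H)
    (z : A ⊗[ℂ] B) :
    ‖algSliceLeft (vectorFunctional π ξ' ξ) z‖ ≤ ‖ξ'‖ * ‖ξ‖ * ‖algToMin π ρ z‖ := by
  set s := algSliceLeft (vectorFunctional π ξ' ξ) (B := B)
  have hs : ∀ x y : K, inner ℂ y (ρ (s z) x) = inner ℂ (HilbertTensor.coe (ξ' ⊗ₜ[ℂ] y))
      (MinTensor.rep π ρ (algToMin π ρ z) (HilbertTensor.coe (ξ ⊗ₜ[ℂ] x))) := by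
    intro x y
    induction z with
    | zero => simp
    | add z z' hz hz' => simp only [map_add, add_apply, inner_add_right, hz, hz']
    | tmul a b =>
      rw [algToMin_tmul, MinTensor.rep_minTmul, opTensor_coe_tmul, HilbertTensor.inner_coe,
        TensorProduct.inner_tmul]
      simp [s, vectorFunctional_apply]
  rw [← (NonUnitalStarAlgHom.isometry ρ hρ).norm_map_of_map_zero (map_zero ρ)]
  refine ContinuousLinearMap.opNorm_le_of_re_inner_le (by positivity) fun x y hx hy => ?_
  have h1 : ‖MinTensor.rep π ρ (algToMin π ρ z)‖ ≤ ‖algToMin π ρ z‖ := le_rfl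
  calc RCLike.re (inner ℂ (ρ (s z) x) y) = RCLike.re (inner ℂ y (ρ (s z) x)) := inner_re_symm _ _
    _ ≤ ‖inner ℂ y (ρ (s z) x)‖ := RCLike.re_le_norm _
    _ ≤ ‖HilbertTensor.coe (ξ' ⊗ₜ[ℂ] y)‖ * ‖MinTensor.rep π ρ (algToMin π ρ z)
        (HilbertTensor.coe (ξ ⊗ₜ[ℂ] x))‖ := by rw [hs]; exact norm_inner_le_norm _ _
    _ ≤ ‖ξ'‖ * (‖algToMin π ρ z‖ * ‖ξ‖) := by
      rw [HilbertTensor.norm_coe_tmul, hy, mul_one]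
      gcongr
      refine (ContinuousLinearMap.le_opNorm _ _).trans ?_
      rw [HilbertTensor.norm_coe_tmul, hx, mul_one]
      gcongr
    _ = _ := by ring

/-- The slice map `φ ⊗ id : A ⊗ B → B` of a bounded functional `φ` on `A` is bounded, with norm at
most `‖φ‖`. Slicing against vectors of `K` reduces the bound to the vector slices
`id ⊗ ⟪η', ρ · η⟫`, which are compressions of operators. -/
theorem exists_slice_left (hπ : Function.Injective π) (hρ : Function.Injective ρ)
    (φ : A →L[ℂ] ℂ) :
    ∃ S : MinTensor π ρ →L[ℂ] B, (∀ a b, S (minTmul π ρ a b) = φ a • b) ∧ ‖S‖ ≤ ‖φ‖ := by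
  set g : A ⊗[ℂ] B →ₗ[ℂ] B := algSliceLeft (φ : A →ₗ[ℂ] ℂ)
  have hg : ∀ z, ‖g z‖ ≤ ‖φ‖ * ‖algToMin π ρ z‖ := by
    intro z
    rw [← (NonUnitalStarAlgHom.isometry ρ hρ).norm_map_of_map_zero (map_zero ρ)]
    refine ContinuousLinearMap.opNorm_le_of_re_inner_le (by positivity) fun η η' h1 h2 => ?_
    have h3 := norm_algSliceRight_vectorFunctional_le (ρ := ρ) hπ η' η z
    rw [h1, h2, one_mul, one_mul] at h3
    calc RCLike.re (inner ℂ (ρ (g z) η) η') = RCLike.re (inner ℂ η' (ρ (g z) η)) :=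
          inner_re_symm _ _
      _ ≤ ‖inner ℂ η' (ρ (g z) η)‖ := RCLike.re_le_norm _
      _ = ‖φ (algSliceRight (vectorFunctional ρ η' η) z)‖ := by
        congr 1
        clear h3
        induction z with
        | zero => simp
        | add z z' hz hz' => simp only [map_add, add_apply, inner_add_right, hz, hz']
        | tmul a b => simp [g, vectorFunctional_apply, mul_comm]
      _ ≤ ‖φ‖ * _ := φ.le_opNorm _
      _ ≤ _ := by gcongr
  refine ⟨g.extendOfNorm (algToMin π ρ), fun a b => ?_, ?_⟩
  · exact LinearMap.extendOfNorm_eq (denseRange_algToMin π ρ) ⟨_, hg⟩ (a ⊗ₜ b)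
  · exact LinearMap.opNorm_extendOfNorm_le (denseRange_algToMin π ρ) (norm_nonneg _) hg

/-- The slice map `id ⊗ φ : A ⊗ B → A` of a bounded functional `φ` on `B` is bounded, with norm at
most `‖φ‖`. -/
theorem exists_slice_right (hπ : Function.Injective π) (hρ : Function.Injective ρ)
    (φ : B →L[ℂ] ℂ) :
    ∃ S : MinTensor π ρ →L[ℂ] A, (∀ a b, S (minTmul π ρ a b) = φ b • a) ∧ ‖S‖ ≤ ‖φ‖ := by
  set g : A ⊗[ℂ] B →ₗ[ℂ] A := algSliceRight (φ : B →ₗ[ℂ] ℂ)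
  have hg : ∀ z, ‖g z‖ ≤ ‖φ‖ * ‖algToMin π ρ z‖ := by
    intro z
    rw [← (NonUnitalStarAlgHom.isometry π hπ).norm_map_of_map_zero (map_zero π)]
    refine ContinuousLinearMap.opNorm_le_of_re_inner_le (by positivity) fun ξ ξ' h1 h2 => ?_
    have h3 := norm_algSliceLeft_vectorFunctional_le (π := π) hρ ξ' ξ z
    rw [h1, h2, one_mul, one_mul] at h3
    calc RCLike.re (inner ℂ (π (g z) ξ) ξ') = RCLike.re (inner ℂ ξ' (π (g z) ξ)) :=
          inner_re_symm _ _
      _ ≤ ‖inner ℂ ξ' (π (g z) ξ)‖ := RCLike.re_le_norm _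
      _ = ‖φ (algSliceLeft (vectorFunctional π ξ' ξ) z)‖ := by
        congr 1
        clear h3
        induction z with
        | zero => simp
        | add z z' hz hz' => simp only [map_add, add_apply, inner_add_right, hz, hz']
        | tmul a b => simp [g, vectorFunctional_apply, mul_comm]
      _ ≤ ‖φ‖ * _ := φ.le_opNorm _
      _ ≤ _ := by gcongr
  refine ⟨g.extendOfNorm (algToMin π ρ), fun a b => ?_, ?_⟩
  · exact LinearMap.extendOfNorm_eq (denseRange_algToMin π ρ) ⟨_, hg⟩ (a ⊗ₜ b)
  · exact LinearMap.opNorm_extendOfNorm_le (denseRange_algToMin π ρ) (norm_nonneg _) hg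

end MinTensorSlices

/-! ### Positive functionals -/

section PositiveFunctionals

variable {A : Type*} [CStarAlgebra A]

/-- A bounded functional is positive if it is nonnegative on the elements `a⋆ a`. -/
def IsPositiveFunctional (φ : A →L[ℂ] ℂ) : Prop := ∀ a, 0 ≤ φ (star a * a)

/-- A state: a positive functional of norm one. -/
structure IsState (φ : A →L[ℂ] ℂ) : Prop where
  norm_le : ‖φ‖ ≤ 1
  map_one : φ 1 = 1
  pos : IsPositiveFunctional φ

theorem IsPositiveFunctional.star_mul_comm {φ : A →L[ℂ] ℂ} (hφ : IsPositiveFunctional φ) (x y : A) :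
    φ (star y * x) = star (φ (star x * y)) := by
  have h1 := hφ (x + y)
  have h2 := hφ (x + Complex.I • y)
  have hx := hφ x
  have hy := hφ y
  simp only [star_add, star_smul, add_mul, mul_add, map_add, smul_mul_assoc, mul_smul_comm,
    map_smul, smul_eq_mul, Complex.star_def, Complex.conj_I] at h1 h2
  simp only [Complex.le_def, Complex.zero_re, Complex.zero_im, Complex.add_re, Complex.add_im,
    Complex.mul_re, Complex.mul_im, Complex.I_re, Complex.I_im, Complex.neg_re,
    Complex.neg_im] at h1 h2 hx hy
  refine Complex.ext ?_ ?_ <;>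
    simp only [Complex.star_def, Complex.conj_re, Complex.conj_im] <;> linarith [h1.2, h2.2, hx.2, hy.2]

theorem IsPositiveFunctional.map_star {φ : A →L[ℂ] ℂ} (hφ : IsPositiveFunctional φ) (x : A) :
    φ (star x) = star (φ x) := by
  simpa using hφ.star_mul_comm 1 x

/-- The degenerate case of the Cauchy–Schwarz inequality. -/
theorem IsPositiveFunctional.mul_eq_zero {φ : A →L[ℂ] ℂ} (hφ : IsPositiveFunctional φ) {y : A}
    (hy : φ (star y * y) = 0) (x : A) : φ (x * y) = 0 := by
  set z := star x
  have hz : x = star z := (star_star x).symm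
  rw [hz]
  set α := φ (star z * y) with hα
  have key : ∀ t : ℂ, 0 ≤ (φ (star z * z)).re + 2 * (t * α).re := by
    intro t
    have h := (Complex.le_def.1 (hφ (z + t • y))).1
    simp only [star_add, star_smul, add_mul, mul_add, map_add, smul_mul_assoc, mul_smul_comm,
      map_smul, smul_eq_mul, hy, mul_zero, add_zero, hφ.star_mul_comm z y, ← hα] at h
    simp only [Complex.zero_re, Complex.add_re, Complex.mul_re, Complex.star_def, Complex.conj_re,
      Complex.conj_im] at h ⊢
    linarith
  by_contra hne
  have hpos : 0 < Complex.normSq α := Complex.normSq_pos.2 hne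
  have h := key (-(((φ (star z * z)).re + 1) / Complex.normSq α : ℝ) * star α)
  rw [neg_mul, neg_mul, mul_assoc, Complex.star_def, ← Complex.normSq_eq_conj_mul_self,
    ← Complex.ofReal_mul, div_mul_cancel₀ _ hpos.ne', Complex.neg_re, Complex.ofReal_re] at h
  have h0 := (Complex.le_def.1 (hφ z)).1
  simp only [Complex.zero_re] at h0
  linarith

theorem IsPositiveFunctional.mul_eq_zero' {φ : A →L[ℂ] ℂ} (hφ : IsPositiveFunctional φ) {y : A}
    (hy : φ (star y * y) = 0) (x : A) : φ (star y * x) = 0 := by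
  have h := hφ.star_mul_comm x y
  rw [hφ.mul_eq_zero hy, star_zero] at h
  exact h

theorem IsPositiveFunctional.posSemidef_map {φ : A →L[ℂ] ℂ}
    (hφ : IsPositiveFunctional φ) {ι κ : Type*} [Fintype ι] [Fintype κ] (X : Matrix κ ι A) :
    ((X.conjTranspose * X).map φ).PosSemidef := by
  refine Matrix.PosSemidef.of_dotProduct_mulVec_nonneg ?_ fun x => ?_
  · ext i j
    simp only [Matrix.conjTranspose_apply, Matrix.map_apply]
    rw [← hφ.map_star, ← Matrix.star_apply, Matrix.star_eq_conjTranspose,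
      Matrix.conjTranspose_mul, Matrix.conjTranspose_conjTranspose]
  · have h : star x ⬝ᵥ (((X.conjTranspose * X).map φ).mulVec x) =
        ∑ k, φ (star (∑ i, x i • X k i) * ∑ i, x i • X k i) := by
      simp only [star_sum, star_smul, map_sum, smul_mul_smul_comm, map_smul,
        dotProduct, Matrix.mulVec, Matrix.map_apply, Matrix.mul_apply, Matrix.conjTranspose_apply,
        Pi.star_apply, smul_eq_mul, Finset.mul_sum, Finset.sum_mul]
      rw [Finset.sum_comm]
      refine Eq.trans (Finset.sum_congr rfl fun j _ => Finset.sum_comm) ?_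
      rw [Finset.sum_comm]
      refine Finset.sum_congr rfl fun k _ => ?_
      rw [Finset.sum_comm]
      refine Finset.sum_comm.trans ?_
      exact Finset.sum_congr rfl fun i _ => Finset.sum_congr rfl fun j _ => by ring
    rw [h]
    exact Finset.sum_nonneg fun k _ => hφ _

theorem IsPositiveFunctional.posSemidef {φ : A →L[ℂ] ℂ} (hφ : IsPositiveFunctional φ)
    {n : ℕ} (a : Fin n → A) : (Matrix.of fun i j => φ (star (a i) * a j)).PosSemidef := by
  convert hφ.posSemidef_map (Matrix.of fun (_ : Unit) i => a i)
  ext i j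
  simp [Matrix.mul_apply]

end PositiveFunctionals

/-! ### Invariant states for coproducts with slice maps -/

/-- The structure of a compact quantum group on a C⋆-algebra `Q` that matters for the Haar state: a
completed tensor square `T` of `Q` with bounded slice maps, and a coproduct with commuting left and
right convolution operators that satisfies the cancellation properties. It is symmetric in the two
tensor factors, see `SlicedCoproduct.flip`. -/
structure SlicedCoproduct (Q T : Type*) [CStarAlgebra Q] [CStarAlgebra T] where
  /-- elementary tensors -/
  tm : Q →ₗ[ℂ] Q →ₗ[ℂ] T
  tm_one : tm 1 1 = 1
  tm_mul : ∀ a a' b b', tm (a * a') (b * b') = tm a b * tm a' b'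
  tm_star : ∀ a b, star (tm a b) = tm (star a) (star b)
  denseRange : DenseRange (TensorProduct.lift tm)
  /-- the slice map `φ ⊗ id` -/
  sl : (Q →L[ℂ] ℂ) → T →L[ℂ] Q
  sl_tm : ∀ φ a b, sl φ (tm a b) = φ a • b
  norm_sl : ∀ φ, ‖sl φ‖ ≤ ‖φ‖
  /-- the slice map `id ⊗ φ` -/
  sr : (Q →L[ℂ] ℂ) → T →L[ℂ] Q
  sr_tm : ∀ φ a b, sr φ (tm a b) = φ b • a
  norm_sr : ∀ φ, ‖sr φ‖ ≤ ‖φ‖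
  /-- the coproduct -/
  Δ : Q →⋆ₐ[ℂ] T
  sl_sr_comm : ∀ φ ψ a, sl φ (Δ (sr ψ (Δ a))) = sr ψ (Δ (sl φ (Δ a)))
  dense_right : Dense (Submodule.span ℂ {x | ∃ a b, x = tm 1 a * Δ b} : Set T)
  dense_left : Dense (Submodule.span ℂ {x | ∃ a b, x = tm a 1 * Δ b} : Set T)

namespace SlicedCoproduct

variable {Q T : Type*} [CStarAlgebra Q] [CStarAlgebra T] (D : SlicedCoproduct Q T)

/-- The opposite coproduct, with the tensor factors exchanged. -/
def flip : SlicedCoproduct Q T where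
  tm := D.tm.flip
  tm_one := D.tm_one
  tm_mul a a' b b' := D.tm_mul b b' a a'
  tm_star a b := D.tm_star b a
  denseRange := by
    refine D.denseRange.mono ?_
    rintro _ ⟨z, rfl⟩
    refine ⟨TensorProduct.comm ℂ Q Q z, ?_⟩
    induction z with
    | zero => simp
    | add x y hx hy => simp only [map_add, hx, hy]
    | tmul x y => simp
  sl := D.sr
  sl_tm φ a b := D.sr_tm φ b a
  norm_sl := D.norm_sr
  sr := D.sl
  sr_tm φ a b := D.sl_tm φ b a
  norm_sr := D.norm_sl
  Δ := D.Δ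
  sl_sr_comm φ ψ a := (D.sl_sr_comm ψ φ a).symm
  dense_right := D.dense_left
  dense_left := D.dense_right

variable {D}

theorem ext_tm {E : Type*} [AddCommMonoid E] [TopologicalSpace E] [T2Space E] [Module ℂ E]
    {f g : T →L[ℂ] E} (h : ∀ a b, f (D.tm a b) = g (D.tm a b)) (Y : T) : f Y = g Y := by
  have h1 : (f : T →ₗ[ℂ] E) ∘ₗ TensorProduct.lift D.tm =
      (g : T →ₗ[ℂ] E) ∘ₗ TensorProduct.lift D.tm := TensorProduct.ext' fun a b => by simpa using h a b
  refine congrFun (D.denseRange.equalizer f.continuous g.continuous ?_) Y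
  funext z
  exact LinearMap.congr_fun h1 z

variable (D)

theorem apply_sl (φ ψ : Q →L[ℂ] ℂ) (Y : T) : ψ (D.sl φ Y) = φ (D.sr ψ Y) :=
  ext_tm (D := D) (f := ψ ∘L D.sl φ) (g := φ ∘L D.sr ψ)
    (fun a b => by simp [D.sl_tm, D.sr_tm, mul_comm]) Y

theorem sr_mul_tm (φ : Q →L[ℂ] ℂ) (a : Q) (Y : T) : D.sr φ (D.tm a 1 * Y) = a * D.sr φ Y :=
  ext_tm (D := D) (f := D.sr φ ∘L ContinuousLinearMap.mul ℂ T (D.tm a 1))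
    (g := ContinuousLinearMap.mul ℂ Q a ∘L D.sr φ)
    (fun x y => by simp [D.sr_tm, ← D.tm_mul]) Y

theorem sr_tm_mul (φ : Q →L[ℂ] ℂ) (a : Q) (Y : T) : D.sr φ (Y * D.tm a 1) = D.sr φ Y * a :=
  ext_tm (D := D) (f := D.sr φ ∘L (ContinuousLinearMap.mul ℂ T).flip (D.tm a 1))
    (g := (ContinuousLinearMap.mul ℂ Q).flip a ∘L D.sr φ)
    (fun x y => by simp [D.sr_tm, ← D.tm_mul]) Y

theorem sl_tm_mul (φ : Q →L[ℂ] ℂ) (a : Q) (Y : T) : D.sl φ (Y * D.tm 1 a) = D.sl φ Y * a :=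
  D.flip.sr_tm_mul φ a Y

theorem sr_one (φ : Q →L[ℂ] ℂ) : D.sr φ 1 = φ 1 • 1 := by rw [← D.tm_one, D.sr_tm]

theorem sr_add (φ ψ : Q →L[ℂ] ℂ) (Y : T) : D.sr (φ + ψ) Y = D.sr φ Y + D.sr ψ Y :=
  ext_tm (D := D) (f := D.sr (φ + ψ)) (g := D.sr φ + D.sr ψ)
    (fun a b => by simp [D.sr_tm, add_smul]) Y

theorem sr_smul (c : ℂ) (φ : Q →L[ℂ] ℂ) (Y : T) : D.sr (c • φ) Y = c • D.sr φ Y :=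
  ext_tm (D := D) (f := D.sr (c • φ)) (g := c • D.sr φ)
    (fun a b => by simp [D.sr_tm, mul_smul]) Y

theorem sr_star {φ : Q →L[ℂ] ℂ} (hφ : IsPositiveFunctional φ) (Y : T) :
    D.sr φ (star Y) = star (D.sr φ Y) := by
  refine congrFun (D.denseRange.equalizer ((D.sr φ).continuous.comp continuous_star)
    (continuous_star.comp (D.sr φ).continuous) ?_) Y
  funext z
  simp only [Function.comp_apply]
  induction z with
  | zero => simp
  | add x y hx hy => simp only [map_add, star_add, hx, hy]
  | tmul a b => simp [D.tm_star, D.sr_tm, hφ.map_star]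

/-- The functional `ψ ⊗ φ` is positive if `ψ` and `φ` are. On finite sums of elementary tensors this
is the Schur product theorem. -/
theorem apply_sr_nonneg {φ ψ : Q →L[ℂ] ℂ} (hφ : IsPositiveFunctional φ)
    (hψ : IsPositiveFunctional ψ) (Y : T) : 0 ≤ ψ (D.sr φ (star Y * Y)) := by
  have hc : Continuous fun Y : T => ψ (D.sr φ (star Y * Y)) := by fun_prop
  refine D.denseRange.induction_on (p := fun Y => 0 ≤ ψ (D.sr φ (star Y * Y))) Y
    (isClosed_le continuous_const hc) fun z => ?_
  obtain ⟨n, a, b, rfl⟩ := TensorProduct.exists_sum_tmul_eq z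
  have h := ((hψ.posSemidef a).hadamard (hφ.posSemidef b)).dotProduct_mulVec_nonneg 1
  refine h.trans_eq ?_
  simp only [dotProduct, Matrix.mulVec, Matrix.hadamard_apply, Matrix.of_apply, Pi.star_apply,
    Pi.one_apply, star_one, one_mul, mul_one, map_sum, TensorProduct.lift.tmul, star_sum,
    Finset.sum_mul_sum, D.tm_star, ← D.tm_mul, D.sr_tm, map_smul, smul_eq_mul]
  exact Finset.sum_congr rfl fun i _ => Finset.sum_congr rfl fun j _ => mul_comm _ _

/-- The convolution operator `(φ ⊗ id) Δ`. -/
def convL (φ : Q →L[ℂ] ℂ) : Q →L[ℂ] Q := D.sl φ ∘L ⟨D.Δ.toAlgHom.toLinearMap, map_continuous D.Δ⟩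

/-- The convolution operator `(id ⊗ φ) Δ`. -/
def convR (φ : Q →L[ℂ] ℂ) : Q →L[ℂ] Q := D.sr φ ∘L ⟨D.Δ.toAlgHom.toLinearMap, map_continuous D.Δ⟩

theorem convR_apply (φ : Q →L[ℂ] ℂ) (a : Q) : D.convR φ a = D.sr φ (D.Δ a) := rfl

theorem apply_convL (φ ψ : Q →L[ℂ] ℂ) (a : Q) : ψ (D.convL φ a) = φ (D.convR ψ a) :=
  D.apply_sl φ ψ _

theorem convL_convR (φ ψ : Q →L[ℂ] ℂ) (a : Q) :
    D.convL φ (D.convR ψ a) = D.convR ψ (D.convL φ a) := D.sl_sr_comm φ ψ a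

theorem eq_of_forall_functional {x y : Q} (h : ∀ φ : Q →L[ℂ] ℂ, φ x = φ y) : x = y :=
  (SeparatingDual.eq_iff_forall_dual_eq (R := ℂ)).2 h

theorem convR_convR (φ ψ : Q →L[ℂ] ℂ) (a : Q) :
    D.convR φ (D.convR ψ a) = D.convR (φ ∘L D.convR ψ) a := by
  refine eq_of_forall_functional fun χ => ?_
  rw [← D.apply_convL, convL_convR]
  exact D.apply_convL χ (φ ∘L D.convR ψ) a

theorem convR_one (φ : Q →L[ℂ] ℂ) : D.convR φ 1 = φ 1 • 1 := by
  rw [convR_apply, map_one, sr_one]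

theorem IsState.comp_convL {φ ψ : Q →L[ℂ] ℂ} (hφ : IsState φ) (hψ : IsState ψ) :
    IsState (ψ ∘L D.convL φ) where
  norm_le := by
    refine ContinuousLinearMap.opNorm_le_bound _ zero_le_one fun a => ?_
    change ‖ψ (D.sl φ (D.Δ a))‖ ≤ _
    calc ‖ψ (D.sl φ (D.Δ a))‖ ≤ ‖ψ‖ * (‖D.sl φ‖ * ‖D.Δ a‖) :=
          (ψ.le_opNorm _).trans (by gcongr; exact (D.sl φ).le_opNorm _)
      _ ≤ 1 * (1 * ‖a‖) := by
        gcongr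
        · exact hψ.norm_le
        · exact (D.norm_sl φ).trans hφ.norm_le
        · exact NonUnitalStarAlgHom.norm_apply_le D.Δ a
      _ = 1 * ‖a‖ := by ring
  map_one := by
    rw [ContinuousLinearMap.comp_apply, D.apply_convL, convR_one, hψ.map_one, one_smul, hφ.map_one]
  pos a := by
    rw [ContinuousLinearMap.comp_apply, D.apply_convL, convR_apply, map_mul, map_star D.Δ]
    exact D.apply_sr_nonneg hψ.pos hφ.pos _

/-- If a state `h` is invariant under convolution with a positive functional `φ`, then it is
invariant under left convolution with every positive `ρ` that `φ` dominates. With `b = (id ⊗ h) Δ a`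
one has `(h ⊗ φ) |Δ b - b ⊗ 1|² = 0`, hence also `(h ⊗ ρ) |Δ b - b ⊗ 1|² = 0`, and one concludes
with the density of `(Q ⊗ 1) Δ(Q)`. -/
theorem apply_convL_of_dominated {h φ ρ : Q →L[ℂ] ℂ} (hh : IsState h) (hφ : IsState φ)
    (hL : ∀ a, h (D.convL φ a) = h a) (hR : ∀ a, h (D.convR φ a) = h a)
    (hρ : IsPositiveFunctional ρ) {c : ℝ} (hc : 0 < c)
    (hle : IsPositiveFunctional (φ - (c : ℂ) • ρ)) (a : Q) :
    h (D.convL ρ a) = ρ 1 * h a := by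
  have hfix : ∀ a, D.convR φ (D.convR h a) = D.convR h a := by
    intro a
    refine eq_of_forall_functional fun ψ => ?_
    rw [← D.apply_convL, convL_convR, ← D.apply_convL, hL, D.apply_convL]
  have key : ∀ a e, h (e * D.convR ρ (D.convR h a)) = ρ 1 * h (e * D.convR h a) := by
    intro a e
    set b := D.convR h a with hb
    set Z := D.Δ b - D.tm b 1 with hZ
    have hZ0 : h (D.sr φ (star Z * Z)) = 0 := by
      have h1 : D.sr φ (D.Δ (star b)) = star b := by
        rw [map_star, D.sr_star hφ.pos, ← convR_apply, hfix]
      have h2 : D.sr φ (D.Δ b) = b := hfix a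
      have h3 : star Z * Z = D.Δ (star b * b) - D.tm (star b) 1 * D.Δ b
          - D.Δ (star b) * D.tm b 1 + D.tm (star b) 1 * D.tm b 1 := by
        rw [hZ, star_sub, D.tm_star, star_one, map_mul, map_star D.Δ]
        noncomm_ring
      have h4 := hR (star b * b)
      rw [convR_apply] at h4
      rw [h3, map_add, map_sub, map_sub, D.sr_mul_tm, D.sr_tm_mul, D.sr_mul_tm, D.sr_tm, h1, h2,
        hφ.map_one, one_smul, map_add, map_sub, map_sub, h4]
      ring
    have hZρ : h (D.sr ρ (star Z * Z)) = 0 := by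
      have h1 := D.apply_sr_nonneg hle hh.pos Z
      have h2 := D.apply_sr_nonneg hρ hh.pos Z
      have h0 : φ - (c : ℂ) • ρ = φ + (-c : ℂ) • ρ := by ext; simp [sub_eq_add_neg]
      rw [h0, D.sr_add, D.sr_smul, map_add, hZ0, zero_add, map_smul,
        smul_eq_mul, neg_mul, Left.nonneg_neg_iff] at h1
      have h3 : (c : ℂ) * h (D.sr ρ (star Z * Z)) = 0 :=
        le_antisymm h1 (mul_nonneg (by exact_mod_cast hc.le) h2)
      exact (mul_eq_zero.1 h3).resolve_left (by exact_mod_cast hc.ne')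
    have hpos : IsPositiveFunctional (h ∘L D.sr ρ) := fun Y => D.apply_sr_nonneg hρ hh.pos Y
    have h1 := hpos.mul_eq_zero hZρ (D.tm e 1)
    rw [ContinuousLinearMap.comp_apply, hZ, mul_sub, map_sub, ← D.tm_mul, D.sr_mul_tm, D.sr_tm,
      map_sub, mul_one, map_smul, smul_eq_mul, sub_eq_zero] at h1
    exact h1
  set f : T →L[ℂ] ℂ := h ∘L D.sr (ρ ∘L D.convR h)
  set g : T →L[ℂ] ℂ := ρ 1 • (h ∘L D.sr h)
  have hfg : (f : T → ℂ) = g := by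
    refine Continuous.ext_on D.dense_left f.continuous g.continuous ?_
    intro x hx
    refine Submodule.span_induction (p := fun x _ => f x = g x) ?_ (by simp)
      (fun x y _ _ hx hy => by simp only [map_add, hx, hy])
      (fun r x _ hx => by simp only [map_smul, hx]) hx
    rintro _ ⟨e, a, rfl⟩
    have h1 := key a e
    rw [convR_convR, convR_apply, convR_apply, ← D.sr_mul_tm, ← D.sr_mul_tm] at h1
    simpa [f, g] using h1
  have h1 := congrFun hfg (D.tm 1 a)
  simp only [f, g, ContinuousLinearMap.comp_apply, smul_apply, D.sr_tm, map_smul, hh.map_one,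
    smul_eq_mul, mul_one] at h1
  rw [D.apply_convL, h1]

theorem apply_convR_of_dominated {h φ ρ : Q →L[ℂ] ℂ} (hh : IsState h) (hφ : IsState φ)
    (hL : ∀ a, h (D.convL φ a) = h a) (hR : ∀ a, h (D.convR φ a) = h a)
    (hρ : IsPositiveFunctional ρ) {c : ℝ} (hc : 0 < c)
    (hle : IsPositiveFunctional (φ - (c : ℂ) • ρ)) (a : Q) :
    h (D.convR ρ a) = ρ 1 * h a :=
  D.flip.apply_convL_of_dominated hh hφ hR hL hρ hc hle a

/-- The convolution powers `φ, φ * φ, φ * φ * φ, …` -/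
def convPow (φ : Q →L[ℂ] ℂ) : ℕ → Q →L[ℂ] ℂ
  | 0 => φ
  | n + 1 => convPow φ n ∘L D.convL φ

theorem isState_convPow {φ : Q →L[ℂ] ℂ} (hφ : IsState φ) (n : ℕ) : IsState (D.convPow φ n) := by
  induction n with
  | zero => exact hφ
  | succ n ih => exact IsState.comp_convL D hφ ih

/-- The convolution powers of `φ` commute with `φ`. -/
theorem convPow_comp_convR (φ : Q →L[ℂ] ℂ) (n : ℕ) :
    D.convPow φ n ∘L D.convR φ = D.convPow φ n ∘L D.convL φ := by
  induction n with
  | zero => exact ContinuousLinearMap.ext fun a => (D.apply_convL φ φ a).symm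
  | succ n ih =>
    refine ContinuousLinearMap.ext fun a => ?_
    have h := DFunLike.congr_fun ih (D.convL φ a)
    simp only [convPow, ContinuousLinearMap.comp_apply, convL_convR] at h ⊢
    exact h

/-- The Cesàro means of the convolution powers. -/
def convMean (φ : Q →L[ℂ] ℂ) (n : ℕ) : Q →L[ℂ] ℂ :=
  ((n : ℂ) + 1)⁻¹ • ∑ k ∈ Finset.range (n + 1), D.convPow φ k

theorem isState_convMean {φ : Q →L[ℂ] ℂ} (hφ : IsState φ) (n : ℕ) : IsState (D.convMean φ n) where
  norm_le := by
    have h1 : ‖∑ k ∈ Finset.range (n + 1), D.convPow φ k‖ ≤ n + 1 := by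
      refine (norm_sum_le _ _).trans
        ((Finset.sum_le_sum fun k _ => (D.isState_convPow hφ k).norm_le).trans ?_)
      simp
    have h2 : ‖((n : ℂ) + 1)⁻¹‖ = ((n : ℝ) + 1)⁻¹ := by
      rw [norm_inv]
      norm_cast
    rw [convMean, norm_smul, h2, inv_mul_le_iff₀ (by positivity), mul_one]
    exact h1
  map_one := by
    have h : ((n : ℂ) + 1) ≠ 0 := by exact_mod_cast n.succ_ne_zero
    simp [convMean, (D.isState_convPow hφ _).map_one, h]
  pos a := by
    have h1 : (0 : ℂ) ≤ ((n : ℂ) + 1)⁻¹ := by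
      rw [← Nat.cast_succ, ← Complex.ofReal_natCast, ← Complex.ofReal_inv]
      exact_mod_cast inv_nonneg.2 (Nat.cast_nonneg (α := ℝ) _)
    simp only [convMean, smul_apply, sum_apply, smul_eq_mul]
    exact mul_nonneg h1 (Finset.sum_nonneg fun k _ => (D.isState_convPow hφ k).pos a)

theorem norm_convMean_convL_sub_le {φ : Q →L[ℂ] ℂ} (hφ : IsState φ) (n : ℕ) (a : Q) :
    ‖D.convMean φ n (D.convL φ a) - D.convMean φ n a‖ ≤ 2 * ‖a‖ * (1 / ((n : ℝ) + 1)) := by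
  have h1 : D.convMean φ n (D.convL φ a) - D.convMean φ n a =
      ((n : ℂ) + 1)⁻¹ * (D.convPow φ (n + 1) a - D.convPow φ 0 a) := by
    rw [← Finset.sum_range_sub (fun k => D.convPow φ k a), Finset.sum_sub_distrib]
    simp [convMean, mul_sub, convPow]
  have h2 : ‖((n : ℂ) + 1)⁻¹‖ = ((n : ℝ) + 1)⁻¹ := by
    rw [norm_inv]
    norm_cast
  have h3 : ∀ k, ‖D.convPow φ k a‖ ≤ ‖a‖ := fun k => by
    simpa using (D.convPow φ k).le_of_opNorm_le (D.isState_convPow hφ k).norm_le a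
  rw [h1, norm_mul, h2, one_div, mul_comm]
  gcongr
  exact (norm_sub_le _ _).trans (by linarith [h3 (n + 1), h3 0])

end SlicedCoproduct

/-- The state space is weak-⋆ compact, by the Banach-Alaoglu theorem. -/
theorem isCompact_setOf_isState (A : Type*) [CStarAlgebra A] :
    IsCompact {h : WeakDual ℂ A | IsState (WeakDual.toStrongDual h)} := by
  have hs : {h : WeakDual ℂ A | IsState (WeakDual.toStrongDual h)} =
      WeakDual.toStrongDual ⁻¹' Metric.closedBall (0 : StrongDual ℂ A) 1 ∩
      ({h : WeakDual ℂ A | h 1 = 1} ∩ ⋂ a : A, {h : WeakDual ℂ A | 0 ≤ h (star a * a)}) := by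
    ext h
    simp only [Set.mem_ofPred_eq, Set.mem_inter_iff, Set.mem_preimage, mem_closedBall_zero_iff,
      Set.mem_iInter]
    exact ⟨fun H => ⟨H.norm_le, H.map_one, H.pos⟩, fun H => ⟨H.1, H.2.1, H.2.2⟩⟩
  rw [hs]
  refine (WeakDual.isCompact_closedBall _ _).inter_right (IsClosed.inter ?_ (isClosed_iInter ?_))
  · exact isClosed_eq (WeakDual.eval_continuous 1) continuous_const
  · exact fun a => isClosed_le continuous_const (WeakDual.eval_continuous _)

namespace SlicedCoproduct

variable {Q T : Type*} [CStarAlgebra Q] [CStarAlgebra T] (D : SlicedCoproduct Q T)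

/-- The states that are invariant under convolution with `φ` on both sides. -/
def invariantStates (φ : Q →L[ℂ] ℂ) : Set (WeakDual ℂ Q) :=
  {h | IsState (WeakDual.toStrongDual h) ∧
    (∀ a, h (D.convL φ a) = h a) ∧ ∀ a, h (D.convR φ a) = h a}

theorem isClosed_invariantStates (φ : Q →L[ℂ] ℂ) : IsClosed (D.invariantStates φ) := by
  have hs : D.invariantStates φ = {h : WeakDual ℂ Q | IsState (WeakDual.toStrongDual h)} ∩
      ((⋂ a : Q, {h : WeakDual ℂ Q | h (D.convL φ a) = h a}) ∩
        ⋂ a : Q, {h : WeakDual ℂ Q | h (D.convR φ a) = h a}) := by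
    ext h
    simp [invariantStates]
  rw [hs]
  refine (isCompact_setOf_isState Q).isClosed.inter
    ((isClosed_iInter fun a => ?_).inter (isClosed_iInter fun a => ?_)) <;>
  exact isClosed_eq (WeakDual.eval_continuous _) (WeakDual.eval_continuous _)

theorem isCompact_invariantStates (φ : Q →L[ℂ] ℂ) : IsCompact (D.invariantStates φ) :=
  (isCompact_setOf_isState Q).of_isClosed_subset (D.isClosed_invariantStates φ) fun _ h => h.1

/-- A weak-⋆ cluster point of the Cesàro means of the convolution powers is invariant. -/
theorem nonempty_invariantStates {φ : Q →L[ℂ] ℂ} (hφ : IsState φ) :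
    (D.invariantStates φ).Nonempty := by
  let U : Ultrafilter ℕ := Ultrafilter.of Filter.atTop
  have hU : (U : Filter ℕ) ≤ Filter.atTop := Ultrafilter.of_le _
  let m : ℕ → WeakDual ℂ Q := fun n => WeakDual.toStrongDual.symm (D.convMean φ n)
  obtain ⟨h, hh, hlim⟩ := (isCompact_setOf_isState Q).ultrafilter_le_nhds (U.map m) (by
    rw [Filter.le_principal_iff]
    exact Filter.mem_map.2 (Filter.univ_mem' fun n => D.isState_convMean hφ n))
  have hev : ∀ a, Filter.Tendsto (fun n => D.convMean φ n a) U (nhds (h a)) := fun a =>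
    ((WeakDual.eval_continuous a).tendsto h).comp hlim
  have hL : ∀ a, h (D.convL φ a) = h a := by
    intro a
    refine sub_eq_zero.1 (tendsto_nhds_unique ((hev (D.convL φ a)).sub (hev a)) ?_)
    refine Filter.Tendsto.mono_left ?_ hU
    refine squeeze_zero_norm (D.norm_convMean_convL_sub_le hφ · a) ?_
    simpa using (tendsto_one_div_add_atTop_nhds_zero_nat (𝕜 := ℝ)).const_mul (2 * ‖a‖)
  refine ⟨h, hh, hL, fun a => ?_⟩
  refine Eq.trans ?_ (hL a)
  refine tendsto_nhds_unique (hev (D.convR φ a)) ((hev (D.convL φ a)).congr fun n => ?_)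
  have h1 := fun k => DFunLike.congr_fun (D.convPow_comp_convR φ k) a
  simp only [ContinuousLinearMap.comp_apply] at h1
  simp [convMean, h1]

theorem isState_midpoint {φ ψ : Q →L[ℂ] ℂ} (hφ : IsState φ) (hψ : IsState ψ) :
    IsState ((2⁻¹ : ℂ) • (φ + ψ)) where
  norm_le := by
    rw [norm_smul, norm_inv, Complex.norm_ofNat]
    linarith [norm_add_le φ ψ, hφ.norm_le, hψ.norm_le]
  map_one := by
    simp only [smul_apply, add_apply, hφ.map_one, hψ.map_one, smul_eq_mul]
    norm_num
  pos a := mul_nonneg (by rw [Complex.le_def]; norm_num) (add_nonneg (hφ.pos a) (hψ.pos a))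

/-- Invariance passes to `φ` and `ψ` from their midpoint, which dominates both up to a factor `2`. So
the sets of invariant states form a directed family. -/
theorem invariantStates_midpoint_subset {φ ψ : Q →L[ℂ] ℂ} (hφ : IsState φ) (hψ : IsState ψ) :
    D.invariantStates ((2⁻¹ : ℂ) • (φ + ψ)) ⊆ D.invariantStates φ := by
  rintro h ⟨hh, hL, hR⟩
  have hle : IsPositiveFunctional ((2⁻¹ : ℂ) • (φ + ψ) - ((2⁻¹ : ℝ) : ℂ) • φ) := by
    intro a
    have h0 : ((2⁻¹ : ℂ) • (φ + ψ) - ((2⁻¹ : ℝ) : ℂ) • φ) (star a * a) = 2⁻¹ * ψ (star a * a) := by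
      simp
    rw [h0]
    exact mul_nonneg (by rw [Complex.le_def]; norm_num) (hψ.pos a)
  refine ⟨hh, fun a => ?_, fun a => ?_⟩
  · have := D.apply_convL_of_dominated hh (isState_midpoint hφ hψ) hL hR hφ.pos
      (c := 2⁻¹) (by norm_num) hle a
    rwa [hφ.map_one, one_mul] at this
  · have := D.apply_convR_of_dominated hh (isState_midpoint hφ hψ) hL hR hφ.pos
      (c := 2⁻¹) (by norm_num) hle a
    rwa [hφ.map_one, one_mul] at this

/-- Existence of the Haar state. By compactness there is a state invariant under convolution with
all states; as the states separate points, this is invariance under the coproduct. -/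
theorem exists_haar (hne : ∃ φ : Q →L[ℂ] ℂ, IsState φ)
    (hsep : ∀ x : Q, (∀ φ : Q →L[ℂ] ℂ, IsState φ → φ x = 0) → x = 0) :
    ∃ h : Q →L[ℂ] ℂ, IsState h ∧ (∀ a, D.sl h (D.Δ a) = h a • 1) ∧
      ∀ a, D.sr h (D.Δ a) = h a • 1 := by
  obtain ⟨φ₀, hφ₀⟩ := hne
  have : Nonempty {φ : Q →L[ℂ] ℂ // IsState φ} := ⟨⟨φ₀, hφ₀⟩⟩
  obtain ⟨h, hh⟩ := IsCompact.nonempty_iInter_of_directed_nonempty_isCompact_isClosed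
    (fun φ : {φ : Q →L[ℂ] ℂ // IsState φ} => D.invariantStates φ.1)
    (by
      rintro ⟨φ, hφ⟩ ⟨ψ, hψ⟩
      refine ⟨⟨_, isState_midpoint hφ hψ⟩, D.invariantStates_midpoint_subset hφ hψ, ?_⟩
      change D.invariantStates ((2⁻¹ : ℂ) • (φ + ψ)) ⊆ D.invariantStates ψ
      rw [add_comm]
      exact D.invariantStates_midpoint_subset hψ hφ)
    (fun φ => D.nonempty_invariantStates φ.2) (fun φ => D.isCompact_invariantStates φ.1)
    (fun φ => D.isClosed_invariantStates φ.1)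
  rw [Set.mem_iInter] at hh
  refine ⟨WeakDual.toStrongDual h, (hh ⟨φ₀, hφ₀⟩).1, fun a => ?_, fun a => ?_⟩
  · refine sub_eq_zero.1 (hsep _ fun φ hφ => ?_)
    rw [map_sub, map_smul, hφ.map_one, D.apply_sl, sub_eq_zero, smul_eq_mul, mul_one]
    exact (hh ⟨φ, hφ⟩).2.2 a
  · refine sub_eq_zero.1 (hsep _ fun φ hφ => ?_)
    rw [map_sub, map_smul, hφ.map_one, ← D.apply_sl, sub_eq_zero, smul_eq_mul, mul_one]
    exact (hh ⟨φ, hφ⟩).2.1 a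

end SlicedCoproduct

/-! ### The Haar state of a compact quantum group -/

namespace CompactQuantumGroup

section ScalarMat

variable {Q : Type*} [CStarAlgebra Q] {ι : Type*} [Fintype ι]

/-- A complex matrix, viewed as a matrix over `Q`. -/
abbrev scalarMat (Q : Type*) [CStarAlgebra Q] {m n : Type*} (T : Matrix m n ℂ) : Matrix m n Q :=
  T.map (algebraMap ℂ Q)

theorem scalarMat_mul_apply {κ μ : Type*} (T : Matrix κ ι ℂ) (v : Matrix ι μ Q) (i : κ) (j : μ) :
    (scalarMat Q T * v) i j = ∑ k, T i k • v k j := by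
  simp [Matrix.mul_apply, Algebra.smul_def]

theorem mul_scalarMat_apply {κ μ : Type*} (T : Matrix ι κ ℂ) (v : Matrix μ ι Q) (i : μ) (j : κ) :
    (v * scalarMat Q T) i j = ∑ k, T k j • v i k := by
  simp only [Matrix.mul_apply, Algebra.smul_def, Matrix.map_apply]
  exact Finset.sum_congr rfl fun k _ => (Algebra.commutes _ _).symm

theorem scalarMat_mul {κ μ : Type*} (S : Matrix κ ι ℂ) (T : Matrix ι μ ℂ) :
    scalarMat Q (S * T) = scalarMat Q S * scalarMat Q T := Matrix.map_mul

theorem scalarMat_one {κ : Type*} [DecidableEq κ] : scalarMat Q (1 : Matrix κ κ ℂ) = 1 :=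
  Matrix.map_one _ (map_zero _) (map_one _)

theorem scalarMat_conjTranspose {κ μ : Type*} (T : Matrix κ μ ℂ) :
    scalarMat Q T.conjTranspose = (scalarMat Q T).conjTranspose := by
  ext i j
  simp only [Matrix.map_apply, Matrix.conjTranspose_apply, algebraMap_star_comm]

/-- Averaging a complex matrix `T` with respect to `v`: the matrix `(id ⊗ h)(v⋆ T v)`. -/
def avgLeft (h : Q →L[ℂ] ℂ) (v : Matrix ι ι Q) (T : Matrix ι ι ℂ) : Matrix ι ι ℂ :=
  (v.conjTranspose * scalarMat Q T * v).map h

/-- Averaging a complex matrix `T` with respect to `v⋆`: the matrix `(id ⊗ h)(v T v⋆)`. -/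
def avgRight (h : Q →L[ℂ] ℂ) (v : Matrix ι ι Q) (T : Matrix ι ι ℂ) : Matrix ι ι ℂ :=
  (v * scalarMat Q T * v.conjTranspose).map h

theorem conjTranspose_mul_scalarMat_mul_apply (v : Matrix ι ι Q) (T : Matrix ι ι ℂ) (j l : ι) :
    (v.conjTranspose * scalarMat Q T * v) j l = ∑ m, ∑ k, T k m • (star (v k j) * v m l) := by
  rw [Matrix.mul_apply]
  refine Finset.sum_congr rfl fun m _ => ?_
  rw [mul_scalarMat_apply, Finset.sum_mul]
  exact Finset.sum_congr rfl fun k _ => by rw [smul_mul_assoc, Matrix.conjTranspose_apply]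

theorem mul_scalarMat_mul_conjTranspose_apply (v : Matrix ι ι Q) (T : Matrix ι ι ℂ) (j l : ι) :
    (v * scalarMat Q T * v.conjTranspose) j l = ∑ m, ∑ k, T k m • (v j k * star (v l m)) := by
  rw [Matrix.mul_apply]
  refine Finset.sum_congr rfl fun m _ => ?_
  rw [mul_scalarMat_apply, Finset.sum_mul]
  exact Finset.sum_congr rfl fun k _ => by rw [smul_mul_assoc, Matrix.conjTranspose_apply]

end ScalarMat

variable {Q : Type u} [CStarAlgebra Q] [Nontrivial Q] {H : Type v}
  [NormedAddCommGroup H] [InnerProductSpace ℂ H] [CompleteSpace H] (G : CompactQuantumGroup Q H)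

/-- Slice maps for `Q ⊗ Q`. The last property is the form in which coassociativity is used: the
operators `(φ ⊗ id) Δ` and `(id ⊗ ψ) Δ` on `Q` commute. -/
theorem exists_slices_comm :
    ∃ (sl sr : (Q →L[ℂ] ℂ) → MinTensor G.π G.π →L[ℂ] Q),
      (∀ φ a b, sl φ (minTmul G.π G.π a b) = φ a • b) ∧ (∀ φ, ‖sl φ‖ ≤ ‖φ‖) ∧
      (∀ φ a b, sr φ (minTmul G.π G.π a b) = φ b • a) ∧ (∀ φ, ‖sr φ‖ ≤ ‖φ‖) ∧
      ∀ φ ψ a, sl φ (G.Δ (sr ψ (G.Δ a))) = sr ψ (G.Δ (sl φ (G.Δ a))) := by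
  have hπ := G.π_injective
  have hρ := MinTensor.rep_injective G.π G.π
  choose sl hsl hsl' using fun φ : Q →L[ℂ] ℂ => exists_slice_left hπ hπ φ
  choose sr hsr hsr' using fun φ : Q →L[ℂ] ℂ => exists_slice_right hπ hπ φ
  choose sl₃ hsl₃ _ using fun φ : Q →L[ℂ] ℂ => exists_slice_left hπ hρ φ
  choose sr₃ hsr₃ _ using fun φ : Q →L[ℂ] ℂ => exists_slice_right hρ hπ φ
  refine ⟨sl, sr, hsl, hsl', hsr, hsr', fun φ ψ a => ?_⟩
  obtain ⟨ΔI, IΔ, assoc, hΔI, hIΔ, hassoc, hco⟩ := G.coassoc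
  -- slicing the last factor of `(Δ ⊗ id) Y`, and the first factor of `(id ⊗ Δ) Y`
  have h1 : ∀ Y, sr₃ ψ (ΔI Y) = G.Δ (sr ψ Y) := by
    have := minTensor_ext G.π G.π
      (f := (sr₃ ψ : _ →ₗ[ℂ] _) ∘ₗ ΔI.toAlgHom.toLinearMap)
      (g := G.Δ.toAlgHom.toLinearMap ∘ₗ (sr ψ : _ →ₗ[ℂ] _))
      ((sr₃ ψ).continuous.comp (map_continuous ΔI)) ((map_continuous G.Δ).comp (sr ψ).continuous)
      (fun a b => by
        change sr₃ ψ (ΔI _) = G.Δ (sr ψ _)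
        rw [hΔI, hsr₃, hsr, map_smul])
    exact fun Y => LinearMap.congr_fun this Y
  have h2 : ∀ Y, sl₃ φ (IΔ Y) = G.Δ (sl φ Y) := by
    have := minTensor_ext G.π G.π
      (f := (sl₃ φ : _ →ₗ[ℂ] _) ∘ₗ IΔ.toAlgHom.toLinearMap)
      (g := G.Δ.toAlgHom.toLinearMap ∘ₗ (sl φ : _ →ₗ[ℂ] _))
      ((sl₃ φ).continuous.comp (map_continuous IΔ)) ((map_continuous G.Δ).comp (sl φ).continuous)
      (fun a b => by
        change sl₃ φ (IΔ _) = G.Δ (sl φ _)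
        rw [hIΔ, hsl₃, hsl, map_smul])
    exact fun Y => LinearMap.congr_fun this Y
  -- slicing both outer factors does not depend on the order
  have h3 : ∀ W, sl φ (sr₃ ψ W) = sr ψ (sl₃ φ (assoc W)) := by
    have hcont : Continuous assoc := (StarAlgEquiv.isometry assoc).continuous
    let α : MinTensor (MinTensor.rep G.π G.π) G.π →ₗ[ℂ] MinTensor G.π (MinTensor.rep G.π G.π) :=
      { toFun := assoc, map_add' := map_add assoc, map_smul' := map_smul assoc }
    have := minTensor_ext (MinTensor.rep G.π G.π) G.π
      (f := (sl φ).toLinearMap ∘ₗ (sr₃ ψ).toLinearMap)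
      (g := (sr ψ).toLinearMap ∘ₗ (sl₃ φ).toLinearMap ∘ₗ α)
      ((sl φ).continuous.comp (sr₃ ψ).continuous)
      ((sr ψ).continuous.comp ((sl₃ φ).continuous.comp hcont))
      (fun Y c => by
        have := minTensor_ext G.π G.π
          (f := (sl φ).toLinearMap ∘ₗ (sr₃ ψ).toLinearMap ∘ₗ
            (minTmulₗ (MinTensor.rep G.π G.π) G.π).flip c)
          (g := (sr ψ).toLinearMap ∘ₗ (sl₃ φ).toLinearMap ∘ₗ α ∘ₗ
            (minTmulₗ (MinTensor.rep G.π G.π) G.π).flip c)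
          ((sl φ).continuous.comp ((sr₃ ψ).continuous.comp (continuous_minTmul_left _ _ c)))
          ((sr ψ).continuous.comp ((sl₃ φ).continuous.comp
            (hcont.comp (continuous_minTmul_left _ _ c))))
          (fun a b => by
            change sl φ (sr₃ ψ (minTmul _ _ _ c)) = sr ψ (sl₃ φ (assoc (minTmul _ _ _ c)))
            rw [hsr₃, hassoc, hsl₃, map_smul, map_smul, hsl, hsr, smul_comm])
        exact LinearMap.congr_fun this Y)
    exact fun W => LinearMap.congr_fun this W
  rw [← h1, h3, hco, h2]

/-- The coproduct of `G` with its slice maps. -/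
def sliced : SlicedCoproduct Q (MinTensor G.π G.π) where
  tm := minTmulₗ G.π G.π
  tm_one := minTmul_one _ _
  tm_mul := minTmul_mul _ _
  tm_star := minTmul_star _ _
  denseRange := denseRange_algToMin _ _
  sl := G.exists_slices_comm.choose
  sl_tm := G.exists_slices_comm.choose_spec.choose_spec.1
  norm_sl := G.exists_slices_comm.choose_spec.choose_spec.2.1
  sr := G.exists_slices_comm.choose_spec.choose
  sr_tm := G.exists_slices_comm.choose_spec.choose_spec.2.2.1
  norm_sr := G.exists_slices_comm.choose_spec.choose_spec.2.2.2.1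
  Δ := G.Δ
  sl_sr_comm := G.exists_slices_comm.choose_spec.choose_spec.2.2.2.2
  dense_right := G.dense_right
  dense_left := G.dense_left

theorem exists_isState_vector (G : CompactQuantumGroup Q H) (ξ : H) (hξ : ‖ξ‖ = 1) :
    ∃ φ : Q →L[ℂ] ℂ, IsState φ ∧ ∀ a, φ a = inner ℂ ξ (G.π a ξ) := by
  have hb : ∀ a, ‖vectorFunctional G.π ξ ξ a‖ ≤ 1 * ‖a‖ := fun a => by
    rw [vectorFunctional_apply]
    refine (norm_inner_le_norm _ _).trans ?_
    rw [hξ]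
    refine mul_le_mul_of_nonneg_left ?_ zero_le_one
    refine ((G.π a).le_opNorm ξ).trans ?_
    rw [hξ, mul_one]
    exact NonUnitalStarAlgHom.norm_apply_le G.π a
  refine ⟨LinearMap.mkContinuous (vectorFunctional G.π ξ ξ) 1 hb,
    ⟨LinearMap.mkContinuous_norm_le _ zero_le_one _, ?_, fun a => ?_⟩, fun a => rfl⟩
  · rw [LinearMap.mkContinuous_apply, vectorFunctional_apply, map_one, one_apply_eq_self,
      inner_self_eq_norm_sq_to_K (𝕜 := ℂ), hξ]
    simp
  · rw [LinearMap.mkContinuous_apply, vectorFunctional_apply, map_mul, map_star, mul_apply_eq_comp,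
      ContinuousLinearMap.star_eq_adjoint, ContinuousLinearMap.adjoint_inner_right]
    rw [inner_self_eq_norm_sq_to_K (𝕜 := ℂ)]
    exact (Complex.zero_le_real.2 (sq_nonneg ‖G.π a ξ‖)).trans_eq (Complex.ofReal_pow _ _)

/-- States separate the points of `Q`; the vector states of `π` suffice. -/
theorem eq_zero_of_forall_isState (G : CompactQuantumGroup Q H) {x : Q}
    (h : ∀ φ : Q →L[ℂ] ℂ, IsState φ → φ x = 0) : x = 0 := by
  refine G.π_injective ?_
  rw [map_zero]
  refine ContinuousLinearMap.ext fun ξ => ?_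
  have key : ∀ ξ : H, inner ℂ (G.π x ξ) ξ = 0 := by
    intro ξ
    by_cases hξ : ξ = 0
    · simp [hξ]
    have hn : (‖ξ‖ : ℂ) ≠ 0 := by exact_mod_cast norm_ne_zero_iff.2 hξ
    obtain ⟨φ, hφ, hφ'⟩ := G.exists_isState_vector ((‖ξ‖ : ℂ)⁻¹ • ξ) (by
      rw [norm_smul, norm_inv, Complex.norm_real, norm_norm, inv_mul_cancel₀ (norm_ne_zero_iff.2 hξ)])
    have h1 := h φ hφ
    rw [hφ', map_smul, inner_smul_left, inner_smul_right] at h1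
    have h2 : inner ℂ ξ (G.π x ξ) = 0 := by simpa [hn] using h1
    rw [← inner_conj_symm, h2, map_zero]
  have h0 : (G.π x : H →ₗ[ℂ] H) = 0 := (inner_map_self_eq_zero _).1 key
  exact LinearMap.congr_fun h0 ξ

/-- The Haar state of `G`: a state `h` with `(h ⊗ id) Δ a = h a = (id ⊗ h) Δ a`. -/
structure IsHaar (h : Q →L[ℂ] ℂ) : Prop extends IsState h where
  left : ∀ a, G.sliced.sl h (G.Δ a) = h a • 1
  right : ∀ a, G.sliced.sr h (G.Δ a) = h a • 1

theorem exists_isHaar : ∃ h, G.IsHaar h := by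
  have hne : ∃ φ : Q →L[ℂ] ℂ, IsState φ := by
    by_contra hcon
    push Not at hcon
    exact one_ne_zero (G.eq_zero_of_forall_isState (x := 1) fun φ hφ => (hcon φ hφ).elim)
  obtain ⟨h, hs, hl, hr⟩ := G.sliced.exists_haar hne fun x => G.eq_zero_of_forall_isState
  exact ⟨h, hs, hl, hr⟩

/-- A matrix `v` over `Q` with `Δ (v i j) = ∑ k, v i k ⊗ v k j`, not necessarily unitary. -/
def IsCorep {ι : Type*} [Fintype ι] (v : Matrix ι ι Q) : Prop :=
  ∀ i j, G.Δ (v i j) = ∑ k, minTmul G.π G.π (v i k) (v k j)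

variable {G}

theorem IsCorep.conj {ι : Type*} [Fintype ι] {v : Matrix ι ι Q} (hv : G.IsCorep v) :
    G.IsCorep (v.map star) := by
  intro i j
  simp only [Matrix.map_apply, map_star, hv i j, star_sum, minTmul_star]

section Averaging

variable {ι : Type*} [Fintype ι] {h : Q →L[ℂ] ℂ}

/-- Averages over the Haar state are invariant; here `v` is a corepresentation that need not be
unitary. -/
theorem IsHaar.conj_avgLeft (hh : G.IsHaar h) {v : Matrix ι ι Q} (hv : G.IsCorep v)
    (T : Matrix ι ι ℂ) :
    v.conjTranspose * scalarMat Q (avgLeft h v T) * v = scalarMat Q (avgLeft h v T) := by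
  ext j l
  have h1 := hh.left ((v.conjTranspose * scalarMat Q T * v) j l)
  rw [← Algebra.algebraMap_eq_smul_one] at h1
  rw [conjTranspose_mul_scalarMat_mul_apply]
  refine Eq.trans ?_ h1
  have h2 : ∀ k m, G.sliced.sl h (G.Δ (star (v k j) * v m l)) =
      ∑ q, ∑ p, h (star (v k p) * v m q) • (star (v p j) * v q l) := by
    intro k m
    have h3 : ∀ a b : Q, G.sliced.sl h (minTmul G.π G.π a b) = h a • b := G.sliced.sl_tm h
    rw [map_mul, map_star, hv k j, hv m l, star_sum, Finset.sum_mul_sum, Finset.sum_comm]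
    simp only [minTmul_star, ← minTmul_mul, map_sum, h3]
  simp only [conjTranspose_mul_scalarMat_mul_apply, avgLeft, Matrix.map_apply, map_sum, map_smul,
    h2, Finset.sum_smul, Finset.smul_sum, smul_smul, smul_eq_mul, ← Fintype.sum_prod_type']
  exact Fintype.sum_equiv ⟨fun x => ((x.2.2.1, x.2.2.2), x.1, x.2.1),
    fun y => (y.2.1, y.2.2, y.1.1, y.1.2), fun _ => rfl, fun _ => rfl⟩ _ _ fun _ => rfl

theorem IsHaar.conj_avgRight (hh : G.IsHaar h) {v : Matrix ι ι Q} (hv : G.IsCorep v)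
    (T : Matrix ι ι ℂ) :
    v * scalarMat Q (avgRight h v T) * v.conjTranspose = scalarMat Q (avgRight h v T) := by
  ext j l
  have h1 := hh.right ((v * scalarMat Q T * v.conjTranspose) j l)
  rw [← Algebra.algebraMap_eq_smul_one] at h1
  rw [mul_scalarMat_mul_conjTranspose_apply]
  refine Eq.trans ?_ h1
  have h2 : ∀ k m, G.sliced.sr h (G.Δ (v j k * star (v l m))) =
      ∑ q, ∑ p, h (v p k * star (v q m)) • (v j p * star (v l q)) := by
    intro k m
    have h3 : ∀ a b : Q, G.sliced.sr h (minTmul G.π G.π a b) = h b • a := G.sliced.sr_tm h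
    rw [map_mul, map_star, hv j k, hv l m, star_sum, Finset.sum_mul_sum, Finset.sum_comm]
    simp only [minTmul_star, ← minTmul_mul, map_sum, h3]
  simp only [mul_scalarMat_mul_conjTranspose_apply, avgRight, Matrix.map_apply, map_sum, map_smul,
    h2, Finset.sum_smul, Finset.smul_sum, smul_smul, smul_eq_mul, ← Fintype.sum_prod_type']
  exact Fintype.sum_equiv ⟨fun x => ((x.2.2.1, x.2.2.2), x.1, x.2.1),
    fun y => (y.2.1, y.2.2, y.1.1, y.1.2), fun _ => rfl, fun _ => rfl⟩ _ _ fun _ => rfl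

/-- Strong invariance of the Haar state for the coefficients of a unitary representation. -/
theorem IsHaar.sl_mul_tmul (hh : G.IsHaar h) [DecidableEq ι] {u : Matrix ι ι Q} (hu : G.IsCorep u)
    (huu : u * u.conjTranspose = 1) (x r : Q) (i k : ι) :
    G.sliced.sl h (G.Δ x * minTmul G.π G.π (u i k) r) =
      ∑ j, h (x * u i j) • (star (u k j) * r) := by
  set g : ι → Q := fun k => G.sliced.sl h (G.Δ x * minTmul G.π G.π (u i k) 1) with hg
  have hmod : ∀ k r, G.sliced.sl h (G.Δ x * minTmul G.π G.π (u i k) r) = g k * r := by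
    intro k r
    have h1 := G.sliced.sl_tm_mul h r (G.Δ x * minTmul G.π G.π (u i k) 1)
    have h2 : minTmul G.π G.π (u i k) r = minTmul G.π G.π (u i k) 1 * minTmul G.π G.π 1 r := by
      rw [← minTmul_mul, one_mul, mul_one]
    rw [h2, ← mul_assoc]
    exact h1
  have h1 : ∀ j, ∑ k, g k * u k j = h (x * u i j) • 1 := by
    intro j
    rw [← hh.left, map_mul, hu i j, Finset.mul_sum, map_sum]
    exact Finset.sum_congr rfl fun k _ => (hmod k _).symm
  have h2 : g k = ∑ j, h (x * u i j) • star (u k j) := by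
    calc g k = ∑ l, g l * (u * u.conjTranspose) l k := by
          simp [huu, Matrix.one_apply]
      _ = ∑ l, ∑ j, g l * u l j * star (u k j) := by
        simp [Matrix.mul_apply, Finset.mul_sum, mul_assoc]
      _ = ∑ j, (∑ l, g l * u l j) * star (u k j) := by
        rw [Finset.sum_comm]
        simp [Finset.sum_mul]
      _ = _ := by simp [h1]
  rw [hmod, h2, Finset.sum_mul]
  simp

/-- The Haar state is faithful on the coefficients of a row of a unitary representation, although it
need not be faithful on `Q`. If `h (y_j⋆ y_j) = 0` for all entries `y_j` of the row, then by strong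
invariance and density the entries `z_i` of the corresponding column satisfy `h (z_i⋆ z_i) = 0`;
but `∑ z_i⋆ z_i` is a nonzero scalar. -/
theorem IsHaar.eq_zero_of_row (hh : G.IsHaar h) [DecidableEq ι] {u : Matrix ι ι Q}
    (hu : G.IsCorep u) (huu : u * u.conjTranspose = 1) (huu' : u.conjTranspose * u = 1)
    (ξ : ι → ℂ) (hξ : ∀ j, h (star (∑ k, star (ξ k) • u k j) * ∑ k, star (ξ k) • u k j) = 0) :
    ξ = 0 := by
  set z : ι → Q := fun i => ∑ k, ξ k • u i k with hz
  have h1 : ∀ i x r, h (G.sliced.sl h (G.Δ x * minTmul G.π G.π 1 r * minTmul G.π G.π (z i) 1)) = 0 := by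
    intro i x r
    have h2 : minTmul G.π G.π 1 r * minTmul G.π G.π (z i) 1 = ∑ k, ξ k • minTmul G.π G.π (u i k) r := by
      rw [← minTmul_mul, one_mul, mul_one, hz, ← minTmulₗ_apply, map_sum, LinearMap.sum_apply]
      simp
    rw [mul_assoc, h2]
    simp only [Finset.mul_sum, mul_smul_comm, map_sum, map_smul, hh.sl_mul_tmul hu huu]
    have h3 : ∀ j, ∑ k, ξ k • h (star (u k j) * r) = 0 := by
      intro j
      have h4 := hh.pos.mul_eq_zero' (hξ j) r
      simpa [star_sum, Finset.sum_mul] using h4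
    simp only [Finset.smul_sum]
    rw [Finset.sum_comm]
    refine Finset.sum_eq_zero fun j _ => ?_
    have h5 := congrArg (fun t => h (x * u i j) • t) (h3 j)
    simp only [Finset.smul_sum, smul_zero] at h5
    rw [← h5]
    exact Finset.sum_congr rfl fun k _ => smul_comm _ _ _
  have h6 : ∀ i Y, h (G.sliced.sl h (Y * minTmul G.π G.π (z i) 1)) = 0 := by
    intro i Y
    have hc : Continuous fun Y => h (G.sliced.sl h (star Y * minTmul G.π G.π (z i) 1)) := by fun_prop
    have h7 : (fun Y => h (G.sliced.sl h (star Y * minTmul G.π G.π (z i) 1))) = fun _ => 0 := by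
      refine Continuous.ext_on G.dense_right hc continuous_const ?_
      intro Y hY
      refine Submodule.span_induction
        (p := fun Y _ => h (G.sliced.sl h (star Y * minTmul G.π G.π (z i) 1)) = 0) ?_ (by simp)
        (fun x y _ _ hx hy => by simp only [star_add, add_mul, map_add, hx, hy, add_zero])
        (fun r x _ hx => by simp only [star_smul, smul_mul_assoc, map_smul, hx, smul_zero]) hY
      rintro _ ⟨a, b, rfl⟩
      rw [star_mul, minTmul_star, star_one, ← map_star]
      exact h1 i _ _
    simpa using congrFun h7 (star Y)
  have h8 : ∀ i, h (star (z i) * z i) = 0 := by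
    intro i
    have h9 := h6 i (minTmul G.π G.π (star (z i)) 1)
    rw [← minTmul_mul] at h9
    have h10 : G.sliced.sl h (minTmul G.π G.π (star (z i) * z i) (1 * 1)) =
      h (star (z i) * z i) • (1 * 1) := G.sliced.sl_tm h _ _
    rw [h10, map_smul, one_mul, hh.map_one, smul_eq_mul, mul_one] at h9
    exact h9
  have h11 : ∑ i, star (z i) * z i = (∑ k, star (ξ k) * ξ k) • (1 : Q) := by
    have h12 : ∀ k l, ∑ i, star (u i k) * u i l = if k = l then 1 else 0 := fun k l => by
      rw [← Matrix.one_apply, ← huu', Matrix.mul_apply]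
      simp
    calc ∑ i, star (z i) * z i = ∑ k, ∑ l, (star (ξ k) * ξ l) • ∑ i, star (u i k) * u i l := by
          simp only [hz, star_sum, Finset.sum_mul_sum, star_smul, smul_mul_smul_comm,
            Finset.smul_sum]
          rw [Finset.sum_comm]
          exact Finset.sum_congr rfl fun k _ => Finset.sum_comm
      _ = _ := by simp [h12, Finset.sum_smul]
  have h13 := congrArg h h11
  rw [map_sum, Finset.sum_eq_zero fun i _ => h8 i, map_smul, hh.map_one, smul_eq_mul, mul_one] at h13
  have h14 : star ξ ⬝ᵥ ξ = 0 := h13.symm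
  exact dotProduct_star_self_eq_zero.1 h14

end Averaging

end CompactQuantumGroup

/-! ### Intertwiners and complete reducibility -/

section MatrixLemmas

variable {ι : Type*} [Fintype ι] [DecidableEq ι]

/-- A function of a Hermitian matrix, defined by applying `f` to the eigenvalues. -/
def Matrix.IsHermitian.fnCalc {T : Matrix ι ι ℂ} (hT : T.IsHermitian) (f : ℝ → ℂ) :
    Matrix ι ι ℂ :=
  (hT.eigenvectorUnitary : Matrix ι ι ℂ) * Matrix.diagonal (fun i => f (hT.eigenvalues i)) *
    (hT.eigenvectorUnitary : Matrix ι ι ℂ).conjTranspose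

theorem Matrix.IsHermitian.conjTranspose_mul_eigenvectorUnitary {T : Matrix ι ι ℂ}
    (hT : T.IsHermitian) :
    (hT.eigenvectorUnitary : Matrix ι ι ℂ).conjTranspose * hT.eigenvectorUnitary = 1 :=
  (Unitary.mem_iff.1 hT.eigenvectorUnitary.2).1

theorem Matrix.IsHermitian.eigenvectorUnitary_mul_conjTranspose {T : Matrix ι ι ℂ}
    (hT : T.IsHermitian) :
    (hT.eigenvectorUnitary : Matrix ι ι ℂ) *
      (hT.eigenvectorUnitary : Matrix ι ι ℂ).conjTranspose = 1 :=
  (Unitary.mem_iff.1 hT.eigenvectorUnitary.2).2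

theorem Matrix.IsHermitian.fnCalc_ofReal {T : Matrix ι ι ℂ} (hT : T.IsHermitian) :
    hT.fnCalc (fun x => (x : ℂ)) = T := by
  conv_rhs => rw [hT.spectral_theorem, Unitary.conjStarAlgAut_apply]
  rfl

/-- The eigenspace of a Hermitian matrix is the range of an isometry, built from the columns of the
diagonalizing unitary. -/
theorem Matrix.IsHermitian.exists_isometry_eigenspace {ι : Type} [Fintype ι] [DecidableEq ι]
    {T : Matrix ι ι ℂ} (hT : T.IsHermitian) (μ : ℝ) :
    ∃ S : Matrix ι {i // hT.eigenvalues i = μ} ℂ, S.conjTranspose * S = 1 ∧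
      S * S.conjTranspose = hT.fnCalc fun x => if x = μ then 1 else 0 := by
  have hU := hT.conjTranspose_mul_eigenvectorUnitary
  simp only [fnCalc]
  generalize (hT.eigenvectorUnitary : Matrix ι ι ℂ) = U at hU ⊢
  refine ⟨U.submatrix id Subtype.val, ?_, ?_⟩
  · have h : (U.conjTranspose * U).submatrix (Subtype.val : {i // hT.eigenvalues i = μ} → ι)
        (Subtype.val : {i // hT.eigenvalues i = μ} → ι) = 1 := by
      rw [hU, Matrix.submatrix_one _ Subtype.val_injective]
    exact h
  · ext i j
    rw [Matrix.mul_apply, Matrix.mul_apply]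
    simp only [Matrix.mul_diagonal, Matrix.submatrix_apply, id, Matrix.conjTranspose_apply,
      mul_ite, mul_one, mul_zero, ite_mul, zero_mul]
    rw [← Finset.sum_filter]
    exact (Finset.sum_subtype (p := fun i => hT.eigenvalues i = μ) _ (by simp)
      (fun k => U i k * star (U j k))).symm

/-- A Hermitian projection is the range projection of an isometry. -/
theorem Matrix.IsHermitian.exists_isometry_of_projection {ι : Type} [Fintype ι] [DecidableEq ι]
    {P : Matrix ι ι ℂ} (hP : P.IsHermitian) (hPP : P * P = P) :
    ∃ (κ : Type) (_ : Fintype κ) (_ : DecidableEq κ) (S : Matrix ι κ ℂ),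
      S.conjTranspose * S = 1 ∧ S * S.conjTranspose = P := by
  obtain ⟨S, hS, hS'⟩ := hP.exists_isometry_eigenspace 1
  refine ⟨_, inferInstance, inferInstance, S, hS, ?_⟩
  rw [hS']
  have hU := hP.conjTranspose_mul_eigenvectorUnitary
  have e := hP.fnCalc_ofReal
  simp only [fnCalc] at e ⊢
  generalize (hP.eigenvectorUnitary : Matrix ι ι ℂ) = U at hU e ⊢
  set D := Matrix.diagonal fun i => ((hP.eigenvalues i : ℝ) : ℂ) with hD
  have hd : D = U.conjTranspose * P * U := by
    calc D = (U.conjTranspose * U) * D * (U.conjTranspose * U) := by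
          rw [hU, Matrix.one_mul, Matrix.mul_one]
      _ = U.conjTranspose * (U * D * U.conjTranspose) * U := by simp only [Matrix.mul_assoc]
      _ = _ := by rw [e]
  have hdd : D * D = D := by
    calc D * D = U.conjTranspose * (U * D * U.conjTranspose) * (U * D * U.conjTranspose) * U := by
          calc D * D = (U.conjTranspose * U) * D * (U.conjTranspose * U) * D *
                (U.conjTranspose * U) := by simp only [hU, Matrix.one_mul, Matrix.mul_one]
            _ = _ := by simp only [Matrix.mul_assoc]
      _ = D := by rw [e, Matrix.mul_assoc _ P P, hPP, hd]
  have hev : ∀ i, (if hP.eigenvalues i = 1 then (1 : ℂ) else 0) = hP.eigenvalues i := by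
    intro i
    have h := congrFun (congrFun hdd i) i
    rw [hD, Matrix.diagonal_mul_diagonal, Matrix.diagonal_apply_eq, Matrix.diagonal_apply_eq] at h
    have h' : hP.eigenvalues i * hP.eigenvalues i = hP.eigenvalues i := by exact_mod_cast h
    rcases eq_or_ne (hP.eigenvalues i) 0 with h0 | h0
    · simp [h0]
    · simp [mul_left_cancel₀ h0 (h'.trans (mul_one _).symm)]
  simp only [hev]
  exact e

/-- If `T⋆ T` is a scalar and `T ≠ 0`, then a positive multiple of `T` is an isometry. -/
theorem Matrix.exists_smul_isometry {ι κ : Type*} [Fintype κ] [DecidableEq ι] {T : Matrix κ ι ℂ} {c : ℂ}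
    (h : T.conjTranspose * T = c • 1) (hT : T ≠ 0) :
    ∃ r : ℝ, 0 < r ∧ c = ((r ^ 2 : ℝ) : ℂ) ∧
      ((r⁻¹ : ℝ) • T).conjTranspose * ((r⁻¹ : ℝ) • T) = 1 := by
  obtain ⟨k, i, hki⟩ : ∃ k i, T k i ≠ 0 := by
    by_contra hcon
    push Not at hcon
    exact hT (Matrix.ext hcon)
  have h1 : c = ((∑ k, Complex.normSq (T k i) : ℝ) : ℂ) := by
    have h2 := congrFun (congrFun h i) i
    simp only [Matrix.mul_apply, Matrix.conjTranspose_apply, Matrix.smul_apply,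
      Matrix.one_apply_eq, smul_eq_mul, mul_one] at h2
    rw [← h2]
    push_cast
    exact Finset.sum_congr rfl fun k _ => (Complex.normSq_eq_conj_mul_self).symm
  have h2 : 0 < ∑ k, Complex.normSq (T k i) :=
    Finset.sum_pos' (fun k _ => Complex.normSq_nonneg _)
      ⟨k, Finset.mem_univ _, Complex.normSq_pos.2 hki⟩
  refine ⟨√(∑ k, Complex.normSq (T k i)), Real.sqrt_pos.2 h2, by rw [Real.sq_sqrt h2.le, h1], ?_⟩
  set s := ∑ k, Complex.normSq (T k i)
  rw [Matrix.conjTranspose_smul, star_trivial, Matrix.smul_mul, Matrix.mul_smul, h, smul_smul, h1,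
    ← mul_inv, Real.mul_self_sqrt h2.le]
  ext a b
  simp only [Matrix.smul_apply, Complex.real_smul, smul_eq_mul]
  rw [← mul_assoc, ← Complex.ofReal_mul, inv_mul_cancel₀ h2.ne', Complex.ofReal_one, one_mul]

end MatrixLemmas

namespace CompactQuantumGroup

variable {Q : Type u} [CStarAlgebra Q] [Nontrivial Q] {H : Type v}
  [NormedAddCommGroup H] [InnerProductSpace ℂ H] [CompleteSpace H] {G : CompactQuantumGroup Q H}

/-- The corepresentation property in leg numbering notation, `(id ⊗ Δ) w = w₁₂ w₁₃`. -/
theorem isCorep_iff {ι : Type*} [Fintype ι] {w : Matrix ι ι Q} :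
    G.IsCorep w ↔ w.map G.Δ =
      w.map (minInclLeft G.π G.π) * w.map (minInclRight G.π G.π) := by
  have h : ∀ a b, minTmul G.π G.π a b = minInclLeft G.π G.π a * minInclRight G.π G.π b := by
    intro a b
    change _ = minTmul G.π G.π a 1 * minTmul G.π G.π 1 b
    rw [← minTmul_mul, one_mul, mul_one]
  simp only [IsCorep, h, ← Matrix.ext_iff, Matrix.mul_apply, Matrix.map_apply]

theorem map_scalarMat {Q : Type*} [CStarAlgebra Q] {B : Type*} [CStarAlgebra B]
    (f : Q →⋆ₐ[ℂ] B) {m n : Type*} (T : Matrix m n ℂ) : (scalarMat Q T).map f = scalarMat B T := by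
  ext i j
  simp [AlgHomClass.commutes]

/-- `A v B` is a corepresentation if `v` is one and `v B A = v` in the middle of the coproduct. -/
theorem IsCorep.conjugate {ι κ : Type*} [Fintype ι] [Fintype κ] {w : Matrix ι ι Q}
    (hw : G.IsCorep w) (A : Matrix κ ι ℂ) (B : Matrix ι κ ℂ)
    (h : scalarMat Q A * w * scalarMat Q (B * A) = scalarMat Q A * w) :
    G.IsCorep (scalarMat Q A * w * scalarMat Q B) := by
  have h1 := congrArg (fun M => M.map (minInclLeft G.π G.π)) h
  rw [isCorep_iff] at hw ⊢
  simp only [Matrix.map_mul, map_scalarMat, hw] at h1 ⊢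
  rw [← Matrix.mul_assoc] at h1
  set A' := scalarMat (MinTensor G.π G.π) A
  set B' := scalarMat (MinTensor G.π G.π) B
  set w₁ : Matrix ι ι (MinTensor G.π G.π) := w.map (minInclLeft G.π G.π)
  set w₂ : Matrix ι ι (MinTensor G.π G.π) := w.map (minInclRight G.π G.π)
  have h2 : A' * w₁ * B' * A' * (w₂ * B') = A' * w₁ * (w₂ * B') := congrArg (· * (w₂ * B')) h1
  simp only [Matrix.mul_assoc] at h2 ⊢
  exact h2.symm

namespace Rep

theorem conjTranspose_mul (u : Rep G) : u.mat.conjTranspose * u.mat = 1 :=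
  (Unitary.mem_iff.1 u.unitary).1

theorem mul_conjTranspose (u : Rep G) : u.mat * u.mat.conjTranspose = 1 :=
  (Unitary.mem_iff.1 u.unitary).2

theorem mem_Hom {u w : Rep G} {T : Matrix w.ι u.ι ℂ} :
    T ∈ Hom u w ↔ scalarMat Q T * u.mat = w.mat * scalarMat Q T := Iff.rfl

theorem one_mem_Hom (u : Rep G) : (1 : Matrix u.ι u.ι ℂ) ∈ Hom u u := by
  rw [mem_Hom, scalarMat_one, Matrix.one_mul, Matrix.mul_one]

theorem mul_mem_Hom {u w x : Rep G} {S : Matrix x.ι w.ι ℂ} {T : Matrix w.ι u.ι ℂ}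
    (hS : S ∈ Hom w x) (hT : T ∈ Hom u w) : S * T ∈ Hom u x := by
  rw [mem_Hom] at *
  rw [scalarMat_mul, Matrix.mul_assoc, hT, ← Matrix.mul_assoc, hS, Matrix.mul_assoc]

/-- The adjoint of an intertwiner is an intertwiner; this uses that representations are unitary. -/
theorem conjTranspose_mem_Hom {u w : Rep G} {T : Matrix w.ι u.ι ℂ} (hT : T ∈ Hom u w) :
    T.conjTranspose ∈ Hom w u := by
  rw [mem_Hom] at *
  have h := congrArg Matrix.conjTranspose hT
  rw [Matrix.conjTranspose_mul, Matrix.conjTranspose_mul, ← scalarMat_conjTranspose] at h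
  calc scalarMat Q T.conjTranspose * w.mat
      = u.mat * u.mat.conjTranspose * scalarMat Q T.conjTranspose * w.mat := by
        rw [mul_conjTranspose, Matrix.one_mul]
    _ = u.mat * scalarMat Q T.conjTranspose * (w.mat.conjTranspose * w.mat) := by
        rw [Matrix.mul_assoc u.mat, h]
        simp only [Matrix.mul_assoc]
    _ = _ := by rw [conjTranspose_mul, Matrix.mul_one]

/-- Functions of a Hermitian intertwiner are intertwiners. -/
theorem fnCalc_mem_Hom {u : Rep G} {T : Matrix u.ι u.ι ℂ} (hT : T.IsHermitian)
    (h : T ∈ Hom u u) (f : ℝ → ℂ) : hT.fnCalc f ∈ Hom u u := by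
  have hU : scalarMat Q (hT.eigenvectorUnitary : Matrix u.ι u.ι ℂ).conjTranspose *
      scalarMat Q (hT.eigenvectorUnitary : Matrix u.ι u.ι ℂ) = 1 := by
    rw [← scalarMat_mul, hT.conjTranspose_mul_eigenvectorUnitary, scalarMat_one]
  have hU' : scalarMat Q (hT.eigenvectorUnitary : Matrix u.ι u.ι ℂ) *
      scalarMat Q (hT.eigenvectorUnitary : Matrix u.ι u.ι ℂ).conjTranspose = 1 := by
    rw [← scalarMat_mul, hT.eigenvectorUnitary_mul_conjTranspose, scalarMat_one]
  -- in the eigenbasis, commuting with `T` means that `y i j = 0` if the eigenvalues differ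
  set y := scalarMat Q (hT.eigenvectorUnitary : Matrix u.ι u.ι ℂ).conjTranspose * u.mat *
    scalarMat Q (hT.eigenvectorUnitary : Matrix u.ι u.ι ℂ) with hy
  have hu : u.mat = scalarMat Q (hT.eigenvectorUnitary : Matrix u.ι u.ι ℂ) * y *
      scalarMat Q (hT.eigenvectorUnitary : Matrix u.ι u.ι ℂ).conjTranspose := by
    rw [hy, ← Matrix.mul_assoc, ← Matrix.mul_assoc, hU', Matrix.one_mul, Matrix.mul_assoc, hU',
      Matrix.mul_one]
  have key : ∀ g : ℝ → ℂ, hT.fnCalc g ∈ Hom u u ↔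
      ∀ i j, g (hT.eigenvalues i) • y i j = g (hT.eigenvalues j) • y i j := by
    intro g
    have h1 : hT.fnCalc g ∈ Hom u u ↔ scalarMat Q (Matrix.diagonal fun i => g (hT.eigenvalues i)) * y =
        y * scalarMat Q (Matrix.diagonal fun i => g (hT.eigenvalues i)) := by
      rw [mem_Hom, Matrix.IsHermitian.fnCalc, hu, scalarMat_mul, scalarMat_mul]
      set U := scalarMat Q (hT.eigenvectorUnitary : Matrix u.ι u.ι ℂ)
      set V := scalarMat Q (hT.eigenvectorUnitary : Matrix u.ι u.ι ℂ).conjTranspose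
      set D := scalarMat Q (Matrix.diagonal fun i => g (hT.eigenvalues i))
      have e1 : U * D * V * (U * y * V) = U * (D * y) * V := by
        calc _ = U * D * (V * U) * y * V := by simp only [Matrix.mul_assoc]
          _ = _ := by rw [hU, Matrix.mul_one]; simp only [Matrix.mul_assoc]
      have e2 : U * y * V * (U * D * V) = U * (y * D) * V := by
        calc _ = U * y * (V * U) * D * V := by simp only [Matrix.mul_assoc]
          _ = _ := by rw [hU, Matrix.mul_one]; simp only [Matrix.mul_assoc]
      rw [e1, e2]
      refine ⟨fun e => ?_, fun e => by rw [e]⟩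
      have e3 := congrArg (fun M => V * M * U) e
      have e4 : ∀ X, V * (U * X * V) * U = X := fun X => by
        calc _ = (V * U) * X * (V * U) := by simp only [Matrix.mul_assoc]
          _ = _ := by rw [hU, Matrix.one_mul, Matrix.mul_one]
      simpa only [e4] using e3
    rw [h1, ← Matrix.ext_iff]
    refine forall_congr' fun i => forall_congr' fun j => ?_
    rw [scalarMat_mul_apply, mul_scalarMat_apply]
    simp [Matrix.diagonal_apply]
  rw [key]
  have h0 : hT.fnCalc (fun x => (x : ℂ)) ∈ Hom u u := by rwa [hT.fnCalc_ofReal]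
  rw [key] at h0
  intro i j
  by_cases hij : hT.eigenvalues i = hT.eigenvalues j
  · rw [hij]
  · have h2 : ((hT.eigenvalues i : ℂ) - hT.eigenvalues j) • y i j = 0 := by
      rw [sub_smul, h0 i j, sub_self]
    have h3 : ((hT.eigenvalues i : ℂ) - hT.eigenvalues j) ≠ 0 :=
      sub_ne_zero.2 (by exact_mod_cast hij)
    rw [(smul_eq_zero.1 h2).resolve_left h3, smul_zero, smul_zero]

/-- The subrepresentation on the range of an isometry `S`, if the range projection `S S⋆` is an
intertwiner. -/
def restrict (u : Rep G) {κ : Type} [Fintype κ] [DecidableEq κ] (S : Matrix u.ι κ ℂ)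
    (hS : S.conjTranspose * S = 1) (hp : S * S.conjTranspose ∈ Hom u u) : Rep G where
  ι := κ
  mat := scalarMat Q S.conjTranspose * u.mat * scalarMat Q S
  unitary := by
    have h1 : scalarMat Q S.conjTranspose * scalarMat Q S = 1 := by
      rw [← scalarMat_mul, hS, scalarMat_one]
    have h2 := mem_Hom.1 hp
    rw [scalarMat_mul] at h2
    have h3 : (scalarMat Q S.conjTranspose * u.mat * scalarMat Q S).conjTranspose =
        scalarMat Q S.conjTranspose * u.mat.conjTranspose * scalarMat Q S := by
      rw [Matrix.conjTranspose_mul, Matrix.conjTranspose_mul, ← scalarMat_conjTranspose,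
        ← scalarMat_conjTranspose, Matrix.conjTranspose_conjTranspose, Matrix.mul_assoc]
    set V := scalarMat Q S
    set W := scalarMat Q S.conjTranspose
    rw [Unitary.mem_iff, Matrix.star_eq_conjTranspose, h3]
    constructor
    · calc W * u.mat.conjTranspose * V * (W * u.mat * V) =
          W * u.mat.conjTranspose * (V * W * u.mat) * V := by simp only [Matrix.mul_assoc]
        _ = W * (u.mat.conjTranspose * u.mat) * V * (W * V) := by
          rw [h2]; simp only [Matrix.mul_assoc]
        _ = 1 := by rw [conjTranspose_mul, Matrix.mul_one, h1, Matrix.one_mul]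
    · calc W * u.mat * V * (W * u.mat.conjTranspose * V) =
          W * (u.mat * (V * W)) * u.mat.conjTranspose * V := by simp only [Matrix.mul_assoc]
        _ = (W * V) * W * (u.mat * u.mat.conjTranspose) * V := by
          rw [← h2]; simp only [Matrix.mul_assoc]
        _ = 1 := by rw [mul_conjTranspose, Matrix.mul_one, h1, Matrix.one_mul, h1]
  comul := by
    refine IsCorep.conjugate (G := G) u.comul S.conjTranspose S ?_
    rw [Matrix.mul_assoc, ← mem_Hom.1 hp, ← Matrix.mul_assoc, ← scalarMat_mul, ← Matrix.mul_assoc, hS,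
      Matrix.one_mul]

theorem isometry_mem_Hom_restrict (u : Rep G) {κ : Type} [Fintype κ] [DecidableEq κ]
    (S : Matrix u.ι κ ℂ) (hS : S.conjTranspose * S = 1) (hp : S * S.conjTranspose ∈ Hom u u) :
    S ∈ Hom (u.restrict S hS hp) u := by
  change scalarMat Q S * (scalarMat Q S.conjTranspose * u.mat * scalarMat Q S) = _
  have h2 := mem_Hom.1 hp
  rw [← Matrix.mul_assoc, ← Matrix.mul_assoc, ← scalarMat_mul, h2, Matrix.mul_assoc, ← scalarMat_mul,
    Matrix.mul_assoc, hS, Matrix.mul_one]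
  rfl

theorem exists_subrep_of_projection {u : Rep G} {P : Matrix u.ι u.ι ℂ} (hP : P ∈ Hom u u)
    (hh : P.IsHermitian) (hPP : P * P = P) :
    ∃ (x : Rep G) (S : Matrix u.ι x.ι ℂ), S ∈ Hom x u ∧ S.conjTranspose * S = 1 ∧
      S * S.conjTranspose = P := by
  obtain ⟨κ, _, _, S, hS, hSS⟩ := hh.exists_isometry_of_projection hPP
  have hp : S * S.conjTranspose ∈ Hom u u := hSS ▸ hP
  exact ⟨u.restrict S hS hp, S, isometry_mem_Hom_restrict u S hS hp, hS, hSS⟩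

/-- Schur's lemma. An eigenspace of a Hermitian intertwiner is a subrepresentation. -/
theorem IsIrreducible.exists_eq_smul_one {u : Rep G} (hu : u.IsIrreducible)
    {T : Matrix u.ι u.ι ℂ} (hT : T ∈ Hom u u) : ∃ c : ℂ, T = c • 1 := by
  have herm : ∀ T ∈ Hom u u, T.IsHermitian → ∃ c : ℂ, T = c • (1 : Matrix u.ι u.ι ℂ) := by
    intro T hT hTh
    obtain ⟨i₀⟩ : Nonempty u.ι := Fintype.card_pos_iff.1 (Nat.pos_of_ne_zero hu.1)
    obtain ⟨S, hS, hS'⟩ := hTh.exists_isometry_eigenspace (hTh.eigenvalues i₀)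
    have hp : S * S.conjTranspose ∈ Hom u u := by
      rw [hS']
      exact fnCalc_mem_Hom hTh hT _
    have hall : ∀ i, hTh.eigenvalues i = hTh.eigenvalues i₀ := by
      rcases hu.2 (u.restrict S hS hp) ⟨S, isometry_mem_Hom_restrict u S hS hp, hS⟩ with h0 | h1
      · exact absurd h0 (Fintype.card_pos_iff.2 ⟨⟨i₀, rfl⟩⟩).ne'
      · intro i
        by_contra hi
        exact (Fintype.card_subtype_lt (p := fun i => hTh.eigenvalues i = hTh.eigenvalues i₀) hi).ne h1
    refine ⟨(hTh.eigenvalues i₀ : ℝ), ?_⟩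
    conv_lhs => rw [← hTh.fnCalc_ofReal]
    simp only [Matrix.IsHermitian.fnCalc, hall]
    rw [← Matrix.smul_one_eq_diagonal, Matrix.mul_smul, Matrix.mul_one, Matrix.smul_mul,
      hTh.eigenvectorUnitary_mul_conjTranspose]
  -- the real and imaginary parts of `T` are Hermitian intertwiners
  have hT' := conjTranspose_mem_Hom hT
  obtain ⟨a, ha⟩ := herm (T + T.conjTranspose) (add_mem hT hT') (by
    rw [Matrix.IsHermitian, Matrix.conjTranspose_add, Matrix.conjTranspose_conjTranspose, add_comm])
  obtain ⟨b, hb⟩ := herm (Complex.I • (T - T.conjTranspose))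
    (Submodule.smul_mem _ _ (sub_mem hT hT')) (by
    rw [Matrix.IsHermitian, Matrix.conjTranspose_smul, Matrix.conjTranspose_sub,
      Matrix.conjTranspose_conjTranspose, Complex.star_def, Complex.conj_I, neg_smul, ← smul_neg,
      neg_sub])
  refine ⟨(a - Complex.I * b) / 2, ?_⟩
  have h1 : T = (2⁻¹ : ℂ) •
      ((T + T.conjTranspose) - Complex.I • (Complex.I • (T - T.conjTranspose))) := by
    rw [smul_smul, Complex.I_mul_I, neg_one_smul, sub_neg_eq_add, add_add_sub_cancel, ← two_smul ℂ T,
      smul_smul]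
    norm_num
  rw [h1, ha, hb, smul_smul, ← sub_smul, smul_smul]
  congr 1
  ring

/-- Every representation is unitarily equivalent to a direct sum of irreducible ones; stated as an
induction principle. -/
theorem induction {P : Rep G → Prop} (zero : ∀ u : Rep G, u.dim = 0 → P u)
    (irr : ∀ u : Rep G, u.IsIrreducible → P u) (sum : ∀ u w : Rep G, P u → P w → P (u.sum w))
    (congr : ∀ (u w : Rep G) (T : Matrix w.ι u.ι ℂ), T ∈ Hom u w → T.conjTranspose * T = 1 →
      T * T.conjTranspose = 1 → P u → P w) (u : Rep G) : P u := by
  induction hn : u.dim using Nat.strong_induction_on generalizing u with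
  | _ n ih =>
    by_cases h0 : u.dim = 0
    · exact zero u h0
    by_cases hi : u.IsIrreducible
    · exact irr u hi
    obtain ⟨w, ⟨T, hT, hTT⟩, hw0, hwu⟩ : ∃ w : Rep G, IsSubrep w u ∧ w.dim ≠ 0 ∧ w.dim ≠ u.dim := by
      by_contra hcon
      push Not at hcon
      exact hi ⟨h0, fun w hw => or_iff_not_imp_left.2 (hcon w hw)⟩
    -- `u` is the direct sum of the ranges of the projections `T T⋆` and `1 - T T⋆`
    have hp : T * T.conjTranspose ∈ Hom u u := mul_mem_Hom hT (conjTranspose_mem_Hom hT)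
    have hq : 1 - T * T.conjTranspose ∈ Hom u u := sub_mem (one_mem_Hom u) hp
    have hpp : T * T.conjTranspose * (T * T.conjTranspose) = T * T.conjTranspose := by
      rw [← Matrix.mul_assoc, Matrix.mul_assoc T, hTT, Matrix.mul_one]
    obtain ⟨x, S, hS', hS, hSS⟩ := exists_subrep_of_projection hq (by simp [Matrix.IsHermitian]) (by
      rw [Matrix.mul_sub, Matrix.mul_one, Matrix.sub_mul, Matrix.one_mul, hpp, sub_self, sub_zero])
    have hTS : T.conjTranspose * S = 0 := by
      calc T.conjTranspose * S = T.conjTranspose * (S * S.conjTranspose) * S := by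
            rw [Matrix.mul_assoc, Matrix.mul_assoc, hS, Matrix.mul_one]
        _ = 0 := by
          rw [hSS, Matrix.mul_sub, ← Matrix.mul_assoc, hTT, Matrix.mul_one, Matrix.one_mul, sub_self,
            Matrix.zero_mul]
    have hST : S.conjTranspose * T = 0 := by
      have := congrArg Matrix.conjTranspose hTS
      simpa [Matrix.conjTranspose_mul] using this
    let R : Matrix u.ι (w.sum x).ι ℂ := Matrix.fromCols T S
    have hR : R.conjTranspose = Matrix.fromRows T.conjTranspose S.conjTranspose :=
      Matrix.conjTranspose_fromCols_eq_fromRows_conjTranspose T S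
    have h1 : R.conjTranspose * R = 1 := by
      have e1 : Matrix.fromRows T.conjTranspose S.conjTranspose * Matrix.fromCols T S = 1 := by
        rw [Matrix.fromRows_mul_fromCols, hTT, hS, hTS, hST, Matrix.fromBlocks_one]
      rw [hR]
      exact e1
    have h2 : R * R.conjTranspose = 1 := by
      have e1 : Matrix.fromCols T S * Matrix.fromRows T.conjTranspose S.conjTranspose = 1 := by
        rw [Matrix.fromCols_mul_fromRows, hSS, add_sub_cancel]
      rw [hR]
      exact e1
    have hRm : R ∈ Hom (w.sum x) u := by
      have e1 : scalarMat Q R = Matrix.fromCols (scalarMat Q T) (scalarMat Q S) := by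
        ext i (j | j) <;> rfl
      have e2 : Matrix.fromCols (scalarMat Q T) (scalarMat Q S) *
          Matrix.fromBlocks w.mat 0 0 x.mat =
          u.mat * Matrix.fromCols (scalarMat Q T) (scalarMat Q S) := by
        rw [Matrix.fromCols_mul_fromBlocks, Matrix.mul_fromCols, mem_Hom.1 hT, mem_Hom.1 hS',
          Matrix.mul_zero, Matrix.mul_zero, add_zero, zero_add]
      rw [mem_Hom, e1]
      exact e2
    have hdim : (w.sum x).dim = u.dim := by
      have e1 := congrArg Matrix.trace h1
      rw [Matrix.trace_mul_comm, h2, Matrix.trace_one, Matrix.trace_one] at e1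
      exact_mod_cast e1.symm
    have hdim' : w.dim + x.dim = u.dim := by
      rw [← hdim]
      exact Fintype.card_sum.symm
    refine congr _ _ R hRm h1 h2 (sum _ _ (ih w.dim ?_ w rfl) (ih x.dim ?_ x rfl)) <;> omega

end Rep

end CompactQuantumGroup

/-! ### Multiplicities -/

namespace CompactQuantumGroup

variable {Q : Type u} [CStarAlgebra Q] [Nontrivial Q] {H : Type v}
  [NormedAddCommGroup H] [InnerProductSpace ℂ H] [CompleteSpace H] {G : CompactQuantumGroup Q H}

namespace Rep

theorem finrank_Hom_le {u w : Rep G} (x : Rep G) {T : Matrix w.ι u.ι ℂ} (hT : T ∈ Hom u w)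
    {S : Matrix u.ι w.ι ℂ} (hS : S * T = 1) :
    Module.finrank ℂ (Hom x u) ≤ Module.finrank ℂ (Hom x w) := by
  let f : Hom x u →ₗ[ℂ] Hom x w :=
    { toFun := fun A => ⟨T * A.1, mul_mem_Hom hT A.2⟩
      map_add' := fun A B => Subtype.ext (Matrix.mul_add _ _ _)
      map_smul' := fun c A => Subtype.ext (Matrix.mul_smul _ _ _) }
  refine LinearMap.finrank_le_finrank_of_injective (f := f) fun A B hAB => Subtype.ext ?_
  have h : T * A.1 = T * B.1 := congrArg Subtype.val hAB
  rw [← Matrix.one_mul A.1, ← Matrix.one_mul B.1, ← hS, Matrix.mul_assoc, h, Matrix.mul_assoc]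

theorem Equivalent.finrank_Hom_eq {u w : Rep G} (h : u.Equivalent w) (x : Rep G) :
    Module.finrank ℂ (Hom x u) = Module.finrank ℂ (Hom x w) := by
  refine le_antisymm ?_ ?_
  · obtain ⟨T, hT, S, hS, -⟩ := h
    exact finrank_Hom_le x hT hS
  · obtain ⟨T, hT, S, hS, -⟩ := h.symm
    exact finrank_Hom_le x hT hS

theorem finrank_Hom_of_dim_eq_zero {u : Rep G} (hu : u.dim = 0) (x : Rep G) :
    Module.finrank ℂ (Hom x u) = 0 := by
  have : IsEmpty u.ι := Fintype.card_eq_zero_iff.1 hu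
  exact Module.finrank_zero_of_subsingleton

theorem fromRows_mem_Hom {x u w : Rep G} {A : Matrix u.ι x.ι ℂ} {B : Matrix w.ι x.ι ℂ} :
    (Matrix.fromRows A B : Matrix (u.sum w).ι x.ι ℂ) ∈ Hom x (u.sum w) ↔
      A ∈ Hom x u ∧ B ∈ Hom x w := by
  have e1 : scalarMat Q (Matrix.fromRows A B) = Matrix.fromRows (scalarMat Q A) (scalarMat Q B) := by
    ext (i | i) j <;> rfl
  have e2 : Matrix.fromBlocks u.mat 0 0 w.mat * Matrix.fromRows (scalarMat Q A) (scalarMat Q B) =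
      Matrix.fromRows (u.mat * scalarMat Q A) (w.mat * scalarMat Q B) := by
    rw [Matrix.fromBlocks_mul_fromRows, Matrix.zero_mul, Matrix.zero_mul, zero_add, add_zero]
  have e3 : (Matrix.fromRows A B : Matrix (u.sum w).ι x.ι ℂ) ∈ Hom x (u.sum w) ↔
      scalarMat Q (Matrix.fromRows A B) * x.mat =
        Matrix.fromBlocks u.mat 0 0 w.mat * scalarMat Q (Matrix.fromRows A B) := Iff.rfl
  rw [e3, e1, e2, Matrix.fromRows_mul, Matrix.fromRows_ext_iff]
  rfl

theorem finrank_Hom_sum (x u w : Rep G) :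
    Module.finrank ℂ (Hom x (u.sum w)) =
      Module.finrank ℂ (Hom x u) + Module.finrank ℂ (Hom x w) := by
  have hmem : ∀ M : Matrix (u.sum w).ι x.ι ℂ, M ∈ Hom x (u.sum w) ↔
      (M.toRows₁ : Matrix u.ι x.ι ℂ) ∈ Hom x u ∧ (M.toRows₂ : Matrix w.ι x.ι ℂ) ∈ Hom x w := by
    intro M
    have e : (Matrix.fromRows M.toRows₁ M.toRows₂ : Matrix (u.ι ⊕ w.ι) x.ι ℂ) = M :=
      Matrix.fromRows_toRows M
    exact (iff_of_eq (congrArg (· ∈ Hom x (u.sum w)) e.symm)).trans fromRows_mem_Hom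
  let e : Hom x (u.sum w) ≃ₗ[ℂ] Hom x u × Hom x w :=
    { toFun := fun M => (⟨Matrix.toRows₁ M.1, ((hmem _).1 M.2).1⟩,
        ⟨Matrix.toRows₂ M.1, ((hmem _).1 M.2).2⟩)
      map_add' := fun _ _ => rfl
      map_smul' := fun _ _ => rfl
      invFun := fun p => ⟨Matrix.fromRows p.1.1 p.2.1, fromRows_mem_Hom.2 ⟨p.1.2, p.2.2⟩⟩
      left_inv := fun M => Subtype.ext (Matrix.fromRows_toRows M.1)
      right_inv := fun p => rfl }
  rw [e.finrank_eq, Module.finrank_prod]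

/-- A nonzero intertwiner from an irreducible representation is a multiple of an isometry. -/
theorem IsIrreducible.exists_isometry {x u : Rep G} (hx : x.IsIrreducible) {T : Matrix u.ι x.ι ℂ}
    (hT : T ∈ Hom x u) (h0 : T ≠ 0) : ∃ S ∈ Hom x u, S.conjTranspose * S = 1 := by
  obtain ⟨c, hc⟩ := hx.exists_eq_smul_one (mul_mem_Hom (conjTranspose_mem_Hom hT) hT)
  obtain ⟨r, -, -, hr⟩ := Matrix.exists_smul_isometry hc h0
  refine ⟨(r⁻¹ : ℝ) • T, ?_, hr⟩
  have h := Submodule.smul_mem (Hom x u) ((r⁻¹ : ℝ) : ℂ) hT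
  have e : ((r⁻¹ : ℝ) : ℂ) • T = (r⁻¹ : ℝ) • T := by
    ext i j
    simp
  rwa [e] at h

/-- An irreducible representation is contained in `u` as soon as there is a nonzero intertwiner. -/
theorem isSubrep_iff {x u : Rep G} (hx : x.IsIrreducible) :
    IsSubrep x u ↔ Module.finrank ℂ (Hom x u) ≠ 0 := by
  rw [← Nat.pos_iff_ne_zero, Module.finrank_pos_iff_exists_ne_zero]
  constructor
  · rintro ⟨T, hT, hTT⟩
    refine ⟨⟨T, hT⟩, fun h => hx.1 ?_⟩
    have h0 : T = 0 := congrArg Subtype.val h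
    rw [h0, Matrix.mul_zero] at hTT
    have h1 := congrArg Matrix.trace hTT
    rw [Matrix.trace_zero, Matrix.trace_one] at h1
    exact_mod_cast h1.symm
  · rintro ⟨⟨T, hT⟩, h0⟩
    exact hx.exists_isometry hT fun h => h0 (Subtype.ext h)

/-- A nonzero intertwiner between irreducible representations gives a unitary equivalence. -/
theorem IsIrreducible.exists_unitary {x u : Rep G} (hx : x.IsIrreducible) (hu : u.IsIrreducible)
    {T : Matrix u.ι x.ι ℂ} (hT : T ∈ Hom x u) (h0 : T ≠ 0) :
    ∃ S ∈ Hom x u, S.conjTranspose * S = 1 ∧ S * S.conjTranspose = 1 := by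
  obtain ⟨S, hS, hSS⟩ := hx.exists_isometry hT h0
  refine ⟨S, hS, hSS, ?_⟩
  obtain ⟨c, hc⟩ := hu.exists_eq_smul_one (mul_mem_Hom hS (conjTranspose_mem_Hom hS))
  have h1 : c • S = S := by
    rw [← Matrix.one_mul S, ← Matrix.smul_mul, ← hc, Matrix.mul_assoc, hSS, Matrix.mul_one,
      Matrix.one_mul]
  have h2 : S ≠ 0 := by
    rintro rfl
    rw [Matrix.mul_zero] at hSS
    have h1 := congrArg Matrix.trace hSS
    rw [Matrix.trace_zero, Matrix.trace_one] at h1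
    exact hx.1 (by exact_mod_cast h1.symm)
  have h3 : (c - 1) • S = 0 := by rw [sub_smul, h1, one_smul, sub_self]
  rw [hc, sub_eq_zero.1 ((smul_eq_zero.1 h3).resolve_right h2), one_smul]

theorem Equivalent.exists_unitary {x u : Rep G} (h : x.Equivalent u) (hx : x.IsIrreducible)
    (hu : u.IsIrreducible) :
    ∃ S ∈ Hom x u, S.conjTranspose * S = 1 ∧ S * S.conjTranspose = 1 := by
  obtain ⟨T, hT, S, hST, -⟩ := h
  refine hx.exists_unitary hu hT fun h0 => hx.1 ?_
  rw [h0, Matrix.mul_zero] at hST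
  have h1 := congrArg Matrix.trace hST
  rw [Matrix.trace_zero, Matrix.trace_one] at h1
  exact_mod_cast h1.symm

theorem finrank_Hom_of_equivalent {x u : Rep G} (hx : x.IsIrreducible) (h : x.Equivalent u) :
    Module.finrank ℂ (Hom x u) = 1 := by
  rw [← h.finrank_Hom_eq x]
  have h0 : (⟨1, one_mem_Hom x⟩ : Hom x x) ≠ 0 := by
    intro h
    have h0 : (1 : Matrix x.ι x.ι ℂ) = 0 := congrArg Subtype.val h
    have h1 := congrArg Matrix.trace h0
    rw [Matrix.trace_zero, Matrix.trace_one] at h1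
    exact hx.1 (by exact_mod_cast h1)
  rw [finrank_eq_one_iff_of_nonzero' _ h0]
  rintro ⟨T, hT⟩
  obtain ⟨c, hc⟩ := hx.exists_eq_smul_one hT
  exact ⟨c, Subtype.ext hc.symm⟩

theorem finrank_Hom_of_not_equivalent {x u : Rep G} (hx : x.IsIrreducible) (hu : u.IsIrreducible)
    (h : ¬ x.Equivalent u) : Module.finrank ℂ (Hom x u) = 0 := by
  by_contra h1
  obtain ⟨T, hT, hTT⟩ := (isSubrep_iff hx).2 h1
  have h0 : T ≠ 0 := by
    rintro rfl
    rw [Matrix.mul_zero] at hTT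
    have h1 := congrArg Matrix.trace hTT
    rw [Matrix.trace_zero, Matrix.trace_one] at h1
    exact hx.1 (by exact_mod_cast h1.symm)
  obtain ⟨S, hS, h2, h3⟩ := hx.exists_unitary hu hT h0
  exact h ⟨S, hS, _, h2, h3⟩

theorem equivalent_of_unitary {u w : Rep G} {T : Matrix w.ι u.ι ℂ} (hT : T ∈ Hom u w)
    (h1 : T.conjTranspose * T = 1) (h2 : T * T.conjTranspose = 1) : u.Equivalent w :=
  ⟨T, hT, _, h1, h2⟩

theorem Equivalent.dim_eq {u w : Rep G} (h : u.Equivalent w) : u.dim = w.dim := by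
  obtain ⟨T, -, S, h1, h2⟩ := h
  have e := congrArg Matrix.trace h1
  rw [Matrix.trace_mul_comm, h2, Matrix.trace_one, Matrix.trace_one] at e
  exact_mod_cast e.symm

end Rep

theorem Irr.isIrreducible (x : Irr G) : x.rep.IsIrreducible :=
  (Quotient.out (s := irrSetoid G) x).2

/-- The class of an irreducible representation. -/
def Irr.mk (u : Rep G) (hu : u.IsIrreducible) : Irr G := Quotient.mk (irrSetoid G) ⟨u, hu⟩

theorem Irr.rep_mk_equivalent (u : Rep G) (hu : u.IsIrreducible) :
    (Irr.mk u hu).rep.Equivalent u :=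
  Quotient.mk_out (s := irrSetoid G) ⟨u, hu⟩

theorem Irr.eq_mk {x : Irr G} {u : Rep G} (hu : u.IsIrreducible) (h : x.rep.Equivalent u) :
    x = Irr.mk u hu := by
  exact (Quotient.out_eq (s := irrSetoid G) x).symm.trans (Quotient.sound h)

/-- The multiplicity of the irreducible class `x` in `u`. -/
def mult (x : Irr G) (u : Rep G) : ℕ := Module.finrank ℂ (Rep.Hom x.rep u)

theorem mult_congr {u w : Rep G} (h : u.Equivalent w) (x : Irr G) : mult x u = mult x w :=
  h.finrank_Hom_eq x.rep

theorem mult_sum (x : Irr G) (u w : Rep G) : mult x (u.sum w) = mult x u + mult x w :=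
  Rep.finrank_Hom_sum x.rep u w

theorem mult_of_dim_eq_zero {u : Rep G} (hu : u.dim = 0) (x : Irr G) : mult x u = 0 :=
  Rep.finrank_Hom_of_dim_eq_zero hu x.rep

theorem mult_mk {u : Rep G} (hu : u.IsIrreducible) : mult (Irr.mk u hu) u = 1 :=
  Rep.finrank_Hom_of_equivalent (Irr.isIrreducible _) (Irr.rep_mk_equivalent u hu)

theorem mult_of_ne_mk {u : Rep G} (hu : u.IsIrreducible) {x : Irr G} (hx : x ≠ Irr.mk u hu) :
    mult x u = 0 :=
  Rep.finrank_Hom_of_not_equivalent x.isIrreducible hu fun h => hx (Irr.eq_mk hu h)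

theorem isSubrep_rep_iff {x : Irr G} {u : Rep G} : Rep.IsSubrep x.rep u ↔ mult x u ≠ 0 :=
  Rep.isSubrep_iff x.isIrreducible

theorem finite_support_mult (u : Rep G) : (Function.support fun x : Irr G => mult x u).Finite := by
  induction u using Rep.induction with
  | zero u hu => simp [Function.support, mult_of_dim_eq_zero hu]
  | irr u hu =>
    refine (Set.finite_singleton (Irr.mk u hu)).subset fun x hx => ?_
    by_contra hne
    exact hx (mult_of_ne_mk hu hne)
  | sum u w hu hw =>
    refine (hu.union hw).subset fun x hx => ?_
    simp only [Function.mem_support, mult_sum, Set.mem_union] at hx ⊢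
    omega
  | congr u w T hT h1 h2 hu =>
    simpa only [mult_congr (Rep.equivalent_of_unitary hT h1 h2)] using hu

/-- The additive extension of a function on irreducible classes to all representations. -/
def additiveExt (f : Irr G → ℝ) (u : Rep G) : ℝ := ∑ᶠ x : Irr G, (mult x u : ℝ) * f x

theorem finite_support_mult_mul (f : Irr G → ℝ) (u : Rep G) :
    (Function.support fun x : Irr G => (mult x u : ℝ) * f x).Finite :=
  (finite_support_mult u).subset fun x hx h0 => hx (by simp [show mult x u = 0 from h0])

theorem additiveExt_congr (f : Irr G → ℝ) {u w : Rep G} (h : u.Equivalent w) :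
    additiveExt f u = additiveExt f w := by
  simp only [additiveExt, mult_congr h]

theorem additiveExt_sum (f : Irr G → ℝ) (u w : Rep G) :
    additiveExt f (u.sum w) = additiveExt f u + additiveExt f w := by
  simp only [additiveExt, mult_sum, Nat.cast_add, add_mul]
  exact finsum_add_distrib (finite_support_mult_mul f u) (finite_support_mult_mul f w)

theorem additiveExt_of_dim_eq_zero (f : Irr G → ℝ) {u : Rep G} (hu : u.dim = 0) :
    additiveExt f u = 0 := by
  simp [additiveExt, mult_of_dim_eq_zero hu]

theorem additiveExt_of_isIrreducible (f : Irr G → ℝ) {u : Rep G} (hu : u.IsIrreducible) :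
    additiveExt f u = f (Irr.mk u hu) := by
  rw [additiveExt, finsum_eq_single _ (Irr.mk u hu) fun x hx => by rw [mult_of_ne_mk hu hx]; simp,
    mult_mk hu, Nat.cast_one, one_mul]

/-- An additive function of classes of representations is determined by its values on irreducible
ones. -/
theorem eq_additiveExt {d : Rep G → ℝ} (congr : ∀ u w : Rep G, u.Equivalent w → d u = d w)
    (sum : ∀ u w : Rep G, d (u.sum w) = d u + d w) (u : Rep G) :
    d u = additiveExt (fun x => d x.rep) u := by
  induction u using Rep.induction with
  | zero u hu =>
    rw [additiveExt_of_dim_eq_zero _ hu]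
    have : IsEmpty u.ι := Fintype.card_eq_zero_iff.1 hu
    have : IsEmpty (u.sum u).ι := inferInstanceAs (IsEmpty (u.ι ⊕ u.ι))
    have h : (u.sum u).Equivalent u :=
      ⟨0, zero_mem _, 0, Subsingleton.elim _ _, Subsingleton.elim _ _⟩
    linarith [congr _ _ h, sum u u]
  | irr u hu =>
    rw [additiveExt_of_isIrreducible _ hu]
    exact (congr _ _ (Irr.rep_mk_equivalent u hu)).symm
  | sum u w hu hw => rw [sum, additiveExt_sum, hu, hw]
  | congr u w T hT h1 h2 hu =>
    have h := Rep.equivalent_of_unitary hT h1 h2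
    rw [← congr _ _ h, hu, additiveExt_congr _ h]

end CompactQuantumGroup

/-! ### Invertibility of the matrix of adjoint coefficients -/

open scoped MatrixOrder in
theorem Matrix.PosSemidef.exists_eq_conjTranspose_mul_self {ι : Type*} [Fintype ι]
    {M : Matrix ι ι ℂ} (hM : M.PosSemidef) : ∃ B : Matrix ι ι ℂ, M = B.conjTranspose * B := by
  classical
  exact CStarAlgebra.nonneg_iff_eq_star_mul_self.mp hM.nonneg

theorem Matrix.eq_zero_of_conjTranspose_mul_self {A : Type*} [CStarAlgebra A] {ι κ : Type*}
    [Fintype κ] {X : Matrix κ ι A} (h : X.conjTranspose * X = 0) : X = 0 := by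
  let _ := CStarAlgebra.spectralOrder A
  let _ := CStarAlgebra.spectralOrderedRing (A := A)
  ext k i
  have h1 : ∑ k, star (X k i) * X k i = 0 := congrFun (congrFun h i) i
  rw [Finset.sum_eq_zero_iff_of_nonneg fun k _ => star_mul_self_nonneg _] at h1
  exact CStarRing.star_mul_self_eq_zero_iff _ |>.1 (h1 k (Finset.mem_univ _))

namespace CompactQuantumGroup

variable {Q : Type u} [CStarAlgebra Q] [Nontrivial Q] {H : Type v}
  [NormedAddCommGroup H] [InnerProductSpace ℂ H] [CompleteSpace H] {G : CompactQuantumGroup Q H}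

namespace Rep

/-- The Haar average `(id ⊗ h)(u⋆ T u)` is an intertwiner. -/
theorem avgLeft_mem_Hom {h : Q →L[ℂ] ℂ} (hh : G.IsHaar h) (u : Rep G) (T : Matrix u.ι u.ι ℂ) :
    avgLeft h u.mat T ∈ Hom u u := by
  have h1 := congrArg (u.mat * ·) (hh.conj_avgLeft u.comul T)
  simp only [← Matrix.mul_assoc, u.mul_conjTranspose, Matrix.one_mul] at h1
  exact h1

/-- The coefficients of an irreducible representation `u` do not vanish between nonzero complex
matrices. Averaging `T⋆ T` gives an intertwiner, hence a scalar `c`, with `c R = 0`. If `c = 0`, then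
the Haar state vanishes on the squares of the entries of `T u`, so `T = 0`. -/
theorem IsIrreducible.eq_zero_or_eq_zero {u : Rep G} (hu : u.IsIrreducible) {κ μ : Type*}
    [Fintype κ] [Fintype μ] {T : Matrix κ u.ι ℂ} {R : Matrix u.ι μ ℂ}
    (hTR : scalarMat Q T * u.mat * scalarMat Q R = 0) : T = 0 ∨ R = 0 := by
  obtain ⟨h, hh⟩ := G.exists_isHaar
  obtain ⟨c, hc⟩ := hu.exists_eq_smul_one (avgLeft_mem_Hom hh u (T.conjTranspose * T))
  have hE : u.mat.conjTranspose * scalarMat Q (T.conjTranspose * T) * u.mat =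
      (scalarMat Q T * u.mat).conjTranspose * (scalarMat Q T * u.mat) := by
    rw [scalarMat_mul, scalarMat_conjTranspose, Matrix.conjTranspose_mul]
    simp only [Matrix.mul_assoc]
  have h1 : avgLeft h u.mat (T.conjTranspose * T) * R = 0 := by
    have e : avgLeft h u.mat (T.conjTranspose * T) * R =
        ((scalarMat Q T * u.mat).conjTranspose * (scalarMat Q T * u.mat * scalarMat Q R)).map h := by
      have e' : ∀ Y : Matrix u.ι u.ι Q, Y.map h * R = (Y * scalarMat Q R).map h := by
        intro Y
        ext i j
        rw [Matrix.map_apply, mul_scalarMat_apply, map_sum, Matrix.mul_apply]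
        exact Finset.sum_congr rfl fun k _ => by
          rw [map_smul, smul_eq_mul, mul_comm, Matrix.map_apply]
      rw [avgLeft, hE, e', Matrix.mul_assoc]
    rw [e, hTR, Matrix.mul_zero]
    ext i j
    exact map_zero h
  rw [hc, Matrix.smul_mul, Matrix.one_mul] at h1
  refine (smul_eq_zero.1 h1).imp_left fun h0 => ?_
  rw [h0, zero_smul, avgLeft, hE] at hc
  have h2 : ∀ i j, h (star (∑ k, T i k • u.mat k j) * ∑ k, T i k • u.mat k j) = 0 := by
    intro i j
    have h3 : h (∑ k, star ((scalarMat Q T * u.mat) k j) * (scalarMat Q T * u.mat) k j) = 0 :=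
      congrFun (congrFun hc j) j
    rw [map_sum, Finset.sum_eq_zero_iff_of_nonneg fun k _ => hh.pos _] at h3
    simpa only [scalarMat_mul_apply] using h3 i (Finset.mem_univ _)
  ext i k
  have h4 := hh.eq_zero_of_row u.comul u.mul_conjTranspose u.conjTranspose_mul (fun k => star (T i k))
    (by simpa only [star_star] using h2 i)
  simpa using congrFun h4 k

/-- The matrix `ū` of adjoints of the coefficients. It is a corepresentation, but in general not
unitary. -/
abbrev bar (u : Rep G) : Matrix u.ι u.ι Q := u.mat.map star

/-- The nonvanishing of `T ū R`; take adjoints of the entries in `IsIrreducible.eq_zero_or_eq_zero`. -/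
theorem IsIrreducible.eq_zero_or_eq_zero_bar {u : Rep G} (hu : u.IsIrreducible) {κ μ : Type*}
    [Fintype κ] [Fintype μ] {T : Matrix κ u.ι ℂ} {R : Matrix u.ι μ ℂ}
    (hTR : scalarMat Q T * u.bar * scalarMat Q R = 0) : T = 0 ∨ R = 0 := by
  have h := hu.eq_zero_or_eq_zero (T := T.map star) (R := R.map star) (by
    ext i j
    have h1 := congrArg star (congrFun (congrFun hTR i) j)
    rw [mul_scalarMat_apply] at h1 ⊢
    simp only [scalarMat_mul_apply, star_sum, star_smul, Matrix.map_apply, star_star,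
      Matrix.zero_apply, star_zero] at h1 ⊢
    exact h1)
  refine h.imp (fun h => ?_) fun h => ?_ <;>
  · ext i j
    have := congrFun (congrFun h i) j
    simpa using this

/-- The averages `L = (id ⊗ h)(ū⋆ ū)` and `M = (id ⊗ h)(ū ū⋆)` are positive definite. They have trace
`dim u ≠ 0`, and `L = B⋆ B` is invariant, so that `L v = 0` implies `B ū v = 0`; similarly for `M`. -/
theorem IsIrreducible.posDef_avg {u : Rep G} (hu : u.IsIrreducible) {h : Q →L[ℂ] ℂ}
    (hh : G.IsHaar h) : (avgLeft h u.bar 1).PosDef ∧ (avgRight h u.bar 1).PosDef := by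
  have hpos : (Fintype.card u.ι : ℂ) ≠ 0 := by exact_mod_cast hu.1
  have hinv : ∀ L : Matrix u.ι u.ι ℂ, L.PosSemidef → (∀ v, L.mulVec v = 0 → v = 0) → L.PosDef := by
    intro L hL hv
    rw [hL.posDef_iff_det_ne_zero]
    intro h0
    obtain ⟨v, hv0, hv1⟩ := Matrix.exists_mulVec_eq_zero_iff.2 h0
    exact hv0 (hv v hv1)
  have hcol : ∀ (L : Matrix u.ι u.ι ℂ) v, L.mulVec v = 0 → L * Matrix.replicateCol Unit v = 0 := by
    intro L v hv
    rw [← Matrix.replicateCol_mulVec, hv]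
    rfl
  have htrace : (avgLeft h u.bar 1).trace = Fintype.card u.ι ∧
      (avgRight h u.bar 1).trace = Fintype.card u.ι := by
    have h1 : ∀ X : Matrix u.ι u.ι Q, X = 1 → ∑ i, h (X i i) = Fintype.card u.ι := by
      rintro X rfl
      simp [hh.map_one]
    constructor
    · rw [← h1 _ u.mul_conjTranspose]
      simp only [Matrix.trace, Matrix.diag, avgLeft, Matrix.map_apply, scalarMat_one,
        Matrix.mul_one, Matrix.mul_apply, Matrix.conjTranspose_apply, star_star, map_sum]
      exact Finset.sum_comm
    · rw [← h1 _ u.conjTranspose_mul]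
      simp only [Matrix.trace, Matrix.diag, avgRight, Matrix.map_apply, scalarMat_one,
        Matrix.mul_one, Matrix.mul_apply, Matrix.conjTranspose_apply, star_star, map_sum]
      exact Finset.sum_comm
  have hne : ∀ L : Matrix u.ι u.ι ℂ, L.trace = Fintype.card u.ι → L ≠ 0 := by
    rintro L hL rfl
    exact hpos (by rw [← hL, Matrix.trace_zero])
  constructor
  · have hpsd : (avgLeft h u.bar 1).PosSemidef := by
      rw [avgLeft, scalarMat_one, Matrix.mul_one]
      exact hh.pos.posSemidef_map _
    refine hinv _ hpsd fun v hv => ?_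
    have e := hh.conj_avgLeft (G := G) (IsCorep.conj u.comul) 1
    have h0 := hne _ htrace.1
    generalize avgLeft h u.bar 1 = L at hpsd hv e h0
    obtain ⟨B, rfl⟩ := hpsd.exists_eq_conjTranspose_mul_self
    have h2 := hcol _ _ hv
    have h3 : scalarMat Q B * u.bar * scalarMat Q (Matrix.replicateCol Unit v) = 0 := by
      refine Matrix.eq_zero_of_conjTranspose_mul_self ?_
      calc _ = scalarMat Q (Matrix.replicateCol Unit v).conjTranspose *
            (u.bar.conjTranspose * scalarMat Q (B.conjTranspose * B) * u.bar) *
            scalarMat Q (Matrix.replicateCol Unit v) := by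
            simp only [Matrix.conjTranspose_mul, scalarMat_mul, scalarMat_conjTranspose,
              Matrix.mul_assoc]
        _ = 0 := by
          rw [e, Matrix.mul_assoc, ← scalarMat_mul, h2]
          ext; simp [Matrix.mul_apply]
    rcases hu.eq_zero_or_eq_zero_bar h3 with h4 | h4
    · exact absurd (by rw [h4, Matrix.mul_zero]) h0
    · exact Matrix.replicateCol_eq_zero v |>.1 h4
  · have hpsd : (avgRight h u.bar 1).PosSemidef := by
      rw [avgRight, scalarMat_one, Matrix.mul_one]
      have := hh.pos.posSemidef_map u.bar.conjTranspose
      rwa [Matrix.conjTranspose_conjTranspose] at this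
    refine hinv _ hpsd fun v hv => ?_
    have e := hh.conj_avgRight (G := G) (IsCorep.conj u.comul) 1
    have h0 := hne _ htrace.2
    generalize avgRight h u.bar 1 = L at hpsd hv e h0
    obtain ⟨B, rfl⟩ := hpsd.exists_eq_conjTranspose_mul_self
    have h2 := hcol _ _ hv
    have h3 : scalarMat Q (Matrix.replicateCol Unit v).conjTranspose * u.bar *
        scalarMat Q B.conjTranspose = 0 := by
      rw [← Matrix.conjTranspose_eq_zero]
      refine Matrix.eq_zero_of_conjTranspose_mul_self ?_
      calc _ = scalarMat Q (Matrix.replicateCol Unit v).conjTranspose *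
            (u.bar * scalarMat Q (B.conjTranspose * B) * u.bar.conjTranspose) *
            scalarMat Q (Matrix.replicateCol Unit v) := by
            simp only [Matrix.conjTranspose_mul, scalarMat_mul, scalarMat_conjTranspose,
              Matrix.mul_assoc, Matrix.conjTranspose_conjTranspose]
        _ = 0 := by
          rw [e, Matrix.mul_assoc, ← scalarMat_mul, h2]
          ext; simp [Matrix.mul_apply]
    rcases hu.eq_zero_or_eq_zero_bar h3 with h4 | h4
    · exact Matrix.replicateCol_eq_zero v |>.1 (Matrix.conjTranspose_eq_zero.1 h4)
    · exact absurd (by rw [h4, Matrix.zero_mul]) h0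

end Rep

end CompactQuantumGroup

/-! ### Existence of conjugates -/

namespace CompactQuantumGroup

variable {Q : Type u} [CStarAlgebra Q] [Nontrivial Q] {H : Type v}
  [NormedAddCommGroup H] [InnerProductSpace ℂ H] [CompleteSpace H] {G : CompactQuantumGroup Q H}

namespace Rep

/-- For irreducible `u`, there is a positive invertible `P` with `ū⋆ P ū = P`. The Haar averages of
`ū⋆ ū` and `ū ū⋆` are invariant and invertible, so `ū` has a left and a right inverse. -/
theorem IsIrreducible.exists_posDef {u : Rep G} (hu : u.IsIrreducible) :
    ∃ P : Matrix u.ι u.ι ℂ, P.PosDef ∧ P.trace = P⁻¹.trace ∧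
      u.bar.conjTranspose * scalarMat Q P * u.bar = scalarMat Q P ∧
      u.bar * scalarMat Q P⁻¹ * u.bar.conjTranspose = scalarMat Q P⁻¹ := by
  obtain ⟨h, hh⟩ := G.exists_isHaar
  have : Nonempty u.ι := Fintype.card_pos_iff.1 (Nat.pos_of_ne_zero hu.1)
  obtain ⟨hL, hM⟩ := hu.posDef_avg hh
  have eL := hh.conj_avgLeft (G := G) (IsCorep.conj u.comul) 1
  have eM := hh.conj_avgRight (G := G) (IsCorep.conj u.comul) 1
  generalize avgLeft h u.bar 1 = L at hL eL
  generalize avgRight h u.bar 1 = M at hM eM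
  have hLi : L⁻¹ * L = 1 := Matrix.nonsing_inv_mul _ ((Matrix.isUnit_iff_isUnit_det _).1 hL.isUnit)
  have hLi' : L * L⁻¹ = 1 := Matrix.mul_nonsing_inv _ ((Matrix.isUnit_iff_isUnit_det _).1 hL.isUnit)
  have hMi : M * M⁻¹ = 1 := Matrix.mul_nonsing_inv _ ((Matrix.isUnit_iff_isUnit_det _).1 hM.isUnit)
  -- the left inverse of `ū` given by `L` coincides with the right inverse given by `M`
  have h1 : scalarMat Q L⁻¹ * u.bar.conjTranspose * scalarMat Q L * u.bar = 1 := by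
    simp only [Matrix.mul_assoc] at eL ⊢
    rw [eL, ← scalarMat_mul, hLi, scalarMat_one]
  have h2 : u.bar * (scalarMat Q M * u.bar.conjTranspose * scalarMat Q M⁻¹) = 1 := by
    simp only [← Matrix.mul_assoc] at eM ⊢
    rw [eM, ← scalarMat_mul, hMi, scalarMat_one]
  have h3 := left_inv_eq_right_inv h1 h2
  rw [← h3] at h2
  have eL' : u.bar * scalarMat Q L⁻¹ * u.bar.conjTranspose = scalarMat Q L⁻¹ := by
    have h4 := congrArg (· * scalarMat Q L⁻¹) h2
    simp only [Matrix.mul_assoc, ← scalarMat_mul, hLi', Matrix.one_mul] at h4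
    rw [scalarMat_one, Matrix.mul_one] at h4
    rw [Matrix.mul_assoc, h4]
  obtain ⟨a, ha⟩ : ∃ a : ℝ, L.trace = a := ⟨_, (Complex.eq_re_of_ofReal_le hL.trace_pos.le)⟩
  obtain ⟨b, hb⟩ : ∃ b : ℝ, L⁻¹.trace = b := ⟨_, (Complex.eq_re_of_ofReal_le hL.inv.trace_pos.le)⟩
  have ha0 : 0 < a := by
    have := hL.trace_pos
    rw [ha] at this
    exact_mod_cast this
  have hb0 : 0 < b := by
    have := hL.inv.trace_pos
    rw [hb] at this
    exact_mod_cast this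
  -- rescale `L` so that the traces agree
  have ht : 0 < √(b / a) := Real.sqrt_pos.2 (div_pos hb0 ha0)
  set t := √(b / a) with ht'
  have htt : t * t = b / a := Real.mul_self_sqrt (div_pos hb0 ha0).le
  have ht0 : (t : ℂ) ≠ 0 := by exact_mod_cast ht.ne'
  have hinv : ((t : ℂ) • L)⁻¹ = (t : ℂ)⁻¹ • L⁻¹ :=
    Matrix.inv_eq_left_inv (by
      rw [Matrix.smul_mul, Matrix.mul_smul, smul_smul, inv_mul_cancel₀ ht0, one_smul, hLi])
  have hsm : ∀ (c : ℂ) (X : Matrix u.ι u.ι ℂ), scalarMat Q (c • X) = c • scalarMat Q X := by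
    intro c X
    ext i j
    exact (map_mul (algebraMap ℂ Q) c (X i j)).trans (Algebra.smul_def _ _).symm
  refine ⟨(t : ℂ) • L, hL.smul (by exact_mod_cast ht), ?_, ?_, ?_⟩
  · rw [hinv, Matrix.trace_smul, Matrix.trace_smul, ha, hb, smul_eq_mul, smul_eq_mul]
    norm_cast
    rw [eq_comm, inv_mul_eq_iff_eq_mul₀ ht.ne', ← mul_assoc, htt, div_mul_cancel₀ _ ha0.ne']
  · rw [hsm, Matrix.mul_smul, Matrix.smul_mul, eL]
  · rw [hinv, hsm, Matrix.mul_smul, Matrix.smul_mul, eL']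

/-- The unitary representation equivalent to `ū`, given by `P = S⋆ S` with `ū⋆ P ū = P`. -/
def conjRep (u : Rep G) (S Si : Matrix u.ι u.ι ℂ) (h1 : S * Si = 1)
    (h2 : u.bar.conjTranspose * scalarMat Q (S.conjTranspose * S) * u.bar =
      scalarMat Q (S.conjTranspose * S))
    (h3 : u.bar * scalarMat Q (Si * Si.conjTranspose) * u.bar.conjTranspose =
      scalarMat Q (Si * Si.conjTranspose)) : Rep G where
  ι := u.ι
  mat := scalarMat Q S * u.bar * scalarMat Q Si
  unitary := by
    have e : (scalarMat Q S * u.bar * scalarMat Q Si).conjTranspose =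
        scalarMat Q Si.conjTranspose * (u.bar.conjTranspose * scalarMat Q S.conjTranspose) := by
      rw [Matrix.conjTranspose_mul, Matrix.conjTranspose_mul, ← scalarMat_conjTranspose,
        ← scalarMat_conjTranspose]
    rw [Unitary.mem_iff, Matrix.star_eq_conjTranspose, e]
    constructor
    · calc _ = scalarMat Q Si.conjTranspose *
          (u.bar.conjTranspose * scalarMat Q (S.conjTranspose * S) * u.bar) * scalarMat Q Si := by
            simp only [scalarMat_mul, Matrix.mul_assoc]
        _ = scalarMat Q ((S * Si).conjTranspose * (S * Si)) := by
          rw [h2, Matrix.conjTranspose_mul]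
          simp only [scalarMat_mul, Matrix.mul_assoc]
        _ = 1 := by rw [h1, Matrix.conjTranspose_one, Matrix.one_mul, scalarMat_one]
    · calc _ = scalarMat Q S *
          (u.bar * scalarMat Q (Si * Si.conjTranspose) * u.bar.conjTranspose) *
            scalarMat Q S.conjTranspose := by
            simp only [scalarMat_mul, Matrix.mul_assoc]
        _ = scalarMat Q ((S * Si) * (S * Si).conjTranspose) := by
          rw [h3, Matrix.conjTranspose_mul]
          simp only [scalarMat_mul, Matrix.mul_assoc]
        _ = 1 := by rw [h1, Matrix.conjTranspose_one, Matrix.one_mul, scalarMat_one]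
  comul := by
    refine IsCorep.conjugate (G := G) (IsCorep.conj u.comul) S Si ?_
    rw [mul_eq_one_comm.1 h1, scalarMat_one, Matrix.mul_one]

/-- The coefficients of `A ū B`, written as in the definition of a conjugation. -/
theorem mul_bar_mul_apply (u : Rep G) {κ μ : Type*} (A : Matrix κ u.ι ℂ) (B : Matrix u.ι μ ℂ)
    (k : κ) (l : μ) : (scalarMat Q A * u.bar * scalarMat Q B) k l =
      star (∑ a, ∑ b, (star (A k a) * star (B b l)) • u.mat a b) := by
  rw [mul_scalarMat_apply]
  simp only [scalarMat_mul_apply, star_sum, Finset.smul_sum, smul_smul, star_smul, star_mul,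
    star_star, Matrix.map_apply]
  exact Finset.sum_comm

theorem Conjugation.mat_eq {u w : Rep G} (c : Conjugation u w) :
    w.mat = scalarMat Q c.Jinv.conjTranspose * u.bar * scalarMat Q c.J.conjTranspose := by
  ext k l
  rw [c.conj_eq, mul_bar_mul_apply]
  simp only [Matrix.conjTranspose_apply, star_star]

/-- An irreducible representation has a conjugate, and the conjugation can be normalised. If
`P = S⋆ S` is as in `IsIrreducible.exists_posDef`, then `S ū S⁻¹` is unitary, and `j` has the matrix
`(S⁻¹)⋆`, so that `j⋆ j` is the transpose of `P⁻¹`. -/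
theorem IsIrreducible.exists_conjugation {u : Rep G} (hu : u.IsIrreducible) :
    ∃ (w : Rep G) (c : Conjugation u w), c.F.trace = (c.F⁻¹).trace := by
  obtain ⟨P, hP, htr, h1, h2⟩ := hu.exists_posDef
  obtain ⟨S, rfl⟩ := hP.posSemidef.exists_eq_conjTranspose_mul_self
  have hSi : ∃ Si, S * Si = 1 := by
    have h3 := Matrix.nonsing_inv_mul _ ((Matrix.isUnit_iff_isUnit_det _).1 hP.isUnit)
    rw [← Matrix.mul_assoc] at h3
    exact ⟨_, mul_eq_one_comm.1 h3⟩
  obtain ⟨Si, hSi⟩ := hSi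
  have hSi' : Si * S = 1 := mul_eq_one_comm.1 hSi
  have hinv : (S.conjTranspose * S)⁻¹ = Si * Si.conjTranspose := by
    refine Matrix.inv_eq_left_inv ?_
    rw [Matrix.mul_assoc, ← Matrix.mul_assoc Si.conjTranspose, ← Matrix.conjTranspose_mul, hSi,
      Matrix.conjTranspose_one, Matrix.one_mul, hSi']
  rw [hinv] at h2 htr
  let c : Conjugation u (u.conjRep S Si hSi h1 h2) :=
    { J := Si.conjTranspose
      Jinv := S.conjTranspose
      inv_mul := by
        have := congrArg Matrix.conjTranspose hSi'
        rwa [Matrix.conjTranspose_mul, Matrix.conjTranspose_one] at this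
      mul_inv := by
        have := congrArg Matrix.conjTranspose hSi
        rwa [Matrix.conjTranspose_mul, Matrix.conjTranspose_one] at this
      conj_eq := fun k l => u.mul_bar_mul_apply S Si k l }
  have hF : c.F = (Si * Si.conjTranspose).transpose := by
    have e : Si.conjTranspose.map star = Si.transpose := by ext i j; simp
    rw [Matrix.transpose_mul, ← e]
    rfl
  refine ⟨_, c, ?_⟩
  rw [hF, ← Matrix.transpose_nonsing_inv, Matrix.trace_transpose, Matrix.trace_transpose, ← htr, ← hinv,
    Matrix.nonsing_inv_nonsing_inv _ ((Matrix.isUnit_iff_isUnit_det _).1 hP.isUnit)]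

/-- `F` is positive and, with inverse `Fi`, intertwines `u` with its double conjugate; in terms of
`ū` this is `ū Fᵀ ū⋆ = Fᵀ` and `ū⋆ (F⁻¹)ᵀ ū = (F⁻¹)ᵀ`. Moreover it is normalised such that the
functionals `Tr (F ·)` and `Tr (F⁻¹ ·)` agree on the self-intertwiners of `u`, not only on the
identity: this determines the trace of `F` for reducible `u`, too. -/
structure IsSpherical (u : Rep G) (F Fi : Matrix u.ι u.ι ℂ) : Prop where
  posDef : F.PosDef
  mul_inv : F * Fi = 1
  conj_right : u.bar * scalarMat Q F.transpose * u.bar.conjTranspose = scalarMat Q F.transpose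
  conj_left : u.bar.conjTranspose * scalarMat Q Fi.transpose * u.bar = scalarMat Q Fi.transpose
  trace_eq : ∀ T ∈ Hom u u, (F * T).trace = (Fi * T).trace

/-- For irreducible `u` the trace condition only concerns the identity, by Schur's lemma, and the
other properties say that the conjugate of `u` is unitary. -/
theorem IsIrreducible.isSpherical_F {u : Rep G} (hu : u.IsIrreducible) :
    u.IsSpherical u.F u.F⁻¹ := by
  have hex := hu.exists_conjugation
  obtain ⟨w, c, hF, htr⟩ : ∃ (w : Rep G) (c : Conjugation u w), u.F = c.F ∧
      c.F.trace = (c.F⁻¹).trace :=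
    ⟨_, hex.choose_spec.choose, by rw [F, dif_pos hex], hex.choose_spec.choose_spec⟩
  rw [hF]
  have hcF : c.F.transpose = c.J.conjTranspose * c.J := by
    rw [Conjugation.F, Matrix.transpose_mul, Matrix.transpose_transpose]
    rfl
  have hinv : c.F⁻¹.transpose = c.Jinv * c.Jinv.conjTranspose := by
    rw [Matrix.transpose_nonsing_inv, hcF]
    refine Matrix.inv_eq_left_inv ?_
    rw [Matrix.mul_assoc, ← Matrix.mul_assoc c.Jinv.conjTranspose, ← Matrix.conjTranspose_mul,
      c.mul_inv, Matrix.conjTranspose_one, Matrix.one_mul, c.inv_mul]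
  have hPD : c.F.PosDef := by
    rw [← Matrix.PosDef.transpose_iff, hcF]
    refine Matrix.PosDef.conjTranspose_mul_self _ ?_
    exact Function.LeftInverse.injective (g := c.Jinv.mulVec) fun v => by
      rw [Matrix.mulVec_mulVec, c.inv_mul, Matrix.one_mulVec]
  have hJ : c.J.conjTranspose * c.Jinv.conjTranspose = 1 := by
    rw [← Matrix.conjTranspose_mul, c.inv_mul, Matrix.conjTranspose_one]
  have hw := c.mat_eq
  have hwH : w.mat.conjTranspose =
      scalarMat Q c.J * (u.bar.conjTranspose * scalarMat Q c.Jinv) := by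
    rw [hw, Matrix.conjTranspose_mul, Matrix.conjTranspose_mul, ← scalarMat_conjTranspose,
      ← scalarMat_conjTranspose, Matrix.conjTranspose_conjTranspose, Matrix.conjTranspose_conjTranspose]
  refine ⟨hPD, Matrix.mul_nonsing_inv _ ((Matrix.isUnit_iff_isUnit_det _).1 hPD.isUnit), ?_, ?_, ?_⟩
  · rw [hcF]
    have h1 := w.mul_conjTranspose
    rw [hwH, hw] at h1
    calc _ = scalarMat Q (c.J.conjTranspose * c.Jinv.conjTranspose) *
          (u.bar * scalarMat Q (c.J.conjTranspose * c.J) * u.bar.conjTranspose) *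
          scalarMat Q (c.Jinv * c.J) := by
          rw [hJ, c.inv_mul, scalarMat_one, Matrix.one_mul, Matrix.mul_one]
      _ = scalarMat Q c.J.conjTranspose * (scalarMat Q c.Jinv.conjTranspose * u.bar *
          scalarMat Q c.J.conjTranspose * (scalarMat Q c.J * (u.bar.conjTranspose *
          scalarMat Q c.Jinv))) * scalarMat Q c.J := by
          simp only [scalarMat_mul, Matrix.mul_assoc]
      _ = _ := by rw [h1, Matrix.mul_one, ← scalarMat_mul]
  · rw [hinv]
    have h1 := w.conjTranspose_mul
    rw [hwH, hw] at h1
    calc _ = scalarMat Q (c.Jinv * c.J) *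
          (u.bar.conjTranspose * scalarMat Q (c.Jinv * c.Jinv.conjTranspose) * u.bar) *
          scalarMat Q (c.J.conjTranspose * c.Jinv.conjTranspose) := by
          rw [hJ, c.inv_mul, scalarMat_one, Matrix.one_mul, Matrix.mul_one]
      _ = scalarMat Q c.Jinv * (scalarMat Q c.J * (u.bar.conjTranspose *
          scalarMat Q c.Jinv) * (scalarMat Q c.Jinv.conjTranspose * u.bar *
          scalarMat Q c.J.conjTranspose)) * scalarMat Q c.Jinv.conjTranspose := by
          simp only [scalarMat_mul, Matrix.mul_assoc]
      _ = _ := by rw [h1, Matrix.mul_one, ← scalarMat_mul]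
  · intro T hT
    obtain ⟨a, rfl⟩ := hu.exists_eq_smul_one hT
    rw [Matrix.mul_smul, Matrix.mul_smul, Matrix.mul_one, Matrix.mul_one, Matrix.trace_smul,
      Matrix.trace_smul, htr]

end Rep

end CompactQuantumGroup

/-! ### The trace of the operators intertwining a representation with its double conjugate -/

/-- A positive `F` with `Tr F = Tr F⁻¹` has trace at least the dimension, with equality only for
`F = 1`: the number `2 (Tr F - dim) = Tr ((F - 1) F⁻¹ (F - 1))` is nonnegative, and it vanishes only
for `F = 1`. -/
theorem Matrix.PosDef.eq_one_of_trace_le {ι : Type*} [Fintype ι] [DecidableEq ι]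
    {F Fi : Matrix ι ι ℂ} (hF : F.PosDef) (h : F * Fi = 1) (htr : F.trace = Fi.trace)
    (hle : F.trace.re ≤ Fintype.card ι) : F = 1 := by
  obtain rfl : Fi = F⁻¹ := (Matrix.inv_eq_right_inv h).symm
  have h' := mul_eq_one_comm.1 h
  have hX : (F - 1).conjTranspose = F - 1 := by
    rw [Matrix.conjTranspose_sub, hF.1.eq, Matrix.conjTranspose_one]
  have e : (F - 1).conjTranspose * F⁻¹ * (F - 1) = F - 1 - 1 + F⁻¹ := by
    rw [hX, Matrix.sub_mul, h, Matrix.one_mul, Matrix.sub_mul, Matrix.mul_sub, Matrix.mul_sub, h',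
      Matrix.mul_one, Matrix.one_mul, Matrix.mul_one]
    abel
  have hpsd := hF.inv.posSemidef.conjTranspose_mul_mul_same (F - 1)
  have hz : (F - 1).conjTranspose * F⁻¹ * (F - 1) = 0 := by
    rw [← hpsd.trace_eq_zero_iff]
    refine le_antisymm ?_ hpsd.trace_nonneg
    have e2 : ((F - 1).conjTranspose * F⁻¹ * (F - 1)).trace = 2 * (F.trace - Fintype.card ι) := by
      rw [e, Matrix.trace_add, Matrix.trace_sub, Matrix.trace_sub, ← htr, Matrix.trace_one]
      ring
    have h3 := hF.posSemidef.trace_nonneg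
    rw [e2, Complex.eq_re_of_ofReal_le h3]
    have h4 : 2 * (F.trace.re - Fintype.card ι) ≤ 0 := by linarith
    exact_mod_cast h4
  obtain ⟨B, hB⟩ := hF.inv.posSemidef.exists_eq_conjTranspose_mul_self
  have h5 : B * (F - 1) = 0 := by
    rw [← Matrix.conjTranspose_mul_self_eq_zero, ← hz, hB, Matrix.conjTranspose_mul]
    simp only [Matrix.mul_assoc]
  refine sub_eq_zero.1 ?_
  calc F - 1 = F * F⁻¹ * (F - 1) := by rw [h, Matrix.one_mul]
    _ = F * (B.conjTranspose * (B * (F - 1))) := by rw [hB]; simp only [Matrix.mul_assoc]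
    _ = 0 := by rw [h5, Matrix.mul_zero, Matrix.mul_zero]

namespace CompactQuantumGroup

variable {Q : Type u} [CStarAlgebra Q] [Nontrivial Q] {H : Type v}
  [NormedAddCommGroup H] [InnerProductSpace ℂ H] [CompleteSpace H] {G : CompactQuantumGroup Q H}

namespace Rep

theorem IsSpherical.inv_mul {u : Rep G} {F Fi : Matrix u.ι u.ι ℂ} (h : u.IsSpherical F Fi) :
    Fi * F = 1 := mul_eq_one_comm.1 h.mul_inv

theorem IsSpherical.trace_eq_trace {u : Rep G} {F Fi : Matrix u.ι u.ι ℂ} (h : u.IsSpherical F Fi) :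
    F.trace = Fi.trace := by
  simpa only [Matrix.mul_one] using h.trace_eq 1 (one_mem_Hom u)

theorem mem_Hom_iff_bar {u : Rep G} {T : Matrix u.ι u.ι ℂ} :
    T ∈ Hom u u ↔ scalarMat Q (T.map star) * u.bar = u.bar * scalarMat Q (T.map star) := by
  rw [mem_Hom, ← Matrix.ext_iff, ← Matrix.ext_iff]
  refine forall_congr' fun i => forall_congr' fun j => ?_
  rw [scalarMat_mul_apply, scalarMat_mul_apply, mul_scalarMat_apply, mul_scalarMat_apply]
  rw [← star_inj]
  simp only [star_sum, star_smul, Matrix.map_apply]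

/-- If `F` and `F₀` both intertwine `u` with its double conjugate, then `F F₀⁻¹` is a
self-intertwiner of `u`. -/
theorem IsSpherical.mul_mem_Hom {u : Rep G} {F Fi F₀ Fi₀ : Matrix u.ι u.ι ℂ}
    (h : u.IsSpherical F Fi) (h₀ : u.IsSpherical F₀ Fi₀) : F * Fi₀ ∈ Hom u u := by
  have hFi : Fi₀.IsHermitian := by
    rw [← Matrix.inv_eq_right_inv h₀.mul_inv]
    exact h₀.posDef.inv.1
  have e : (F * Fi₀).map star = F.transpose * Fi₀.transpose := by
    have e1 : F.transpose = F.map star := by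
      conv_lhs => rw [← h.posDef.1.eq]
      rfl
    have e2 : Fi₀.transpose = Fi₀.map star := by
      conv_lhs => rw [← hFi.eq]
      rfl
    rw [e1, e2]
    ext i j
    simp [Matrix.mul_apply]
  rw [mem_Hom_iff_bar, e, scalarMat_mul]
  calc _ = scalarMat Q F.transpose * (scalarMat Q Fi₀.transpose * u.bar) := by rw [Matrix.mul_assoc]
    _ = u.bar * scalarMat Q F.transpose * u.bar.conjTranspose *
        (scalarMat Q Fi₀.transpose * u.bar) := by rw [h.conj_right]
    _ = u.bar * scalarMat Q F.transpose *
        (u.bar.conjTranspose * scalarMat Q Fi₀.transpose * u.bar) := by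
      simp only [Matrix.mul_assoc]
    _ = _ := by rw [h₀.conj_left, Matrix.mul_assoc]

/-- As `F F₀⁻¹` is an intertwiner, `Tr (F F₀⁻¹ F) = Tr (F⁻¹ F F₀⁻¹) = Tr F₀`, and hence
`2 (Tr F₀ - Tr F) = Tr ((F - F₀) F₀⁻¹ (F - F₀)) ≥ 0`. -/
theorem IsSpherical.trace_re_le {u : Rep G} {F Fi F₀ Fi₀ : Matrix u.ι u.ι ℂ}
    (h : u.IsSpherical F Fi) (h₀ : u.IsSpherical F₀ Fi₀) : F.trace.re ≤ F₀.trace.re := by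
  have hFi : Fi₀.PosDef := by
    rw [← Matrix.inv_eq_right_inv h₀.mul_inv]
    exact h₀.posDef.inv
  have hX : (F - F₀).conjTranspose = F - F₀ := by
    rw [Matrix.conjTranspose_sub, h.posDef.1.eq, h₀.posDef.1.eq]
  have e : (F - F₀).conjTranspose * Fi₀ * (F - F₀) = F * Fi₀ * F - F - F + F₀ := by
    rw [hX, Matrix.sub_mul, h₀.mul_inv, Matrix.sub_mul, Matrix.mul_sub, Matrix.one_mul,
      Matrix.mul_assoc _ _ F₀, h₀.inv_mul, Matrix.mul_one]
    abel
  have h1 : (F * Fi₀ * F).trace = F₀.trace := by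
    rw [Matrix.trace_mul_comm, h.trace_eq _ (h.mul_mem_Hom h₀), ← Matrix.mul_assoc, h.inv_mul,
      Matrix.one_mul, h₀.trace_eq_trace]
  have h2 := (hFi.posSemidef.conjTranspose_mul_mul_same (F - F₀)).trace_nonneg
  rw [e, Matrix.trace_add, Matrix.trace_sub, Matrix.trace_sub, h1] at h2
  have h3 := (Complex.le_def.1 h2).1
  simp only [Complex.zero_re, Complex.add_re, Complex.sub_re] at h3
  linarith

theorem IsSpherical.trace_unique {u : Rep G} {F Fi F₀ Fi₀ : Matrix u.ι u.ι ℂ}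
    (h : u.IsSpherical F Fi) (h₀ : u.IsSpherical F₀ Fi₀) : F.trace.re = F₀.trace.re :=
  le_antisymm (h.trace_re_le h₀) (h₀.trace_re_le h)

theorem isSpherical_of_dim_eq_zero {u : Rep G} (hu : u.dim = 0) : u.IsSpherical 1 1 := by
  have : IsEmpty u.ι := Fintype.card_eq_zero_iff.1 hu
  exact ⟨Matrix.PosDef.one, Subsingleton.elim _ _, Subsingleton.elim _ _, Subsingleton.elim _ _,
    fun _ _ => rfl⟩

theorem isSpherical_trivial : (trivial G).IsSpherical 1 1 := by
  have hb : (trivial G).bar = 1 := Matrix.map_one star (star_zero Q) (star_one Q)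
  refine ⟨Matrix.PosDef.one, Matrix.one_mul _, ?_, ?_, fun _ _ => rfl⟩ <;>
  simp [hb]

theorem IsSpherical.sum {u w : Rep G} {F Fi : Matrix u.ι u.ι ℂ} {K Ki : Matrix w.ι w.ι ℂ}
    (hu : u.IsSpherical F Fi) (hw : w.IsSpherical K Ki) :
    (u.sum w).IsSpherical (Matrix.fromBlocks F 0 0 K : Matrix (u.ι ⊕ w.ι) (u.ι ⊕ w.ι) ℂ)
      (Matrix.fromBlocks Fi 0 0 Ki : Matrix (u.ι ⊕ w.ι) (u.ι ⊕ w.ι) ℂ) := by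
  have hb : (u.sum w).bar = Matrix.fromBlocks u.bar 0 0 w.bar := by
    refine (Matrix.fromBlocks_map u.mat 0 0 w.mat star).trans ?_
    rw [Matrix.map_zero _ (star_zero Q), Matrix.map_zero _ (star_zero Q)]
  have hs : ∀ (A : Matrix u.ι u.ι ℂ) (B : Matrix w.ι w.ι ℂ),
      scalarMat Q (Matrix.fromBlocks A 0 0 B).transpose =
        Matrix.fromBlocks (scalarMat Q A.transpose) 0 0 (scalarMat Q B.transpose) := by
    intro A B
    ext (i | i) (j | j) <;> simp
  have e1 : (Matrix.fromBlocks F 0 0 K * Matrix.fromBlocks Fi 0 0 Ki :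
      Matrix (u.ι ⊕ w.ι) (u.ι ⊕ w.ι) ℂ) = 1 := by
    rw [Matrix.fromBlocks_multiply]
    simp [hu.mul_inv, hw.mul_inv]
  have e2 : Matrix.fromBlocks u.bar 0 0 w.bar * Matrix.fromBlocks (scalarMat Q F.transpose) 0 0
      (scalarMat Q K.transpose) * (Matrix.fromBlocks u.bar 0 0 w.bar).conjTranspose =
      Matrix.fromBlocks (scalarMat Q F.transpose) 0 0 (scalarMat Q K.transpose) := by
    rw [Matrix.fromBlocks_conjTranspose, Matrix.fromBlocks_multiply, Matrix.fromBlocks_multiply]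
    simp only [Matrix.mul_zero, Matrix.zero_mul, add_zero, zero_add, Matrix.conjTranspose_zero,
      hu.conj_right, hw.conj_right]
  have e3 : (Matrix.fromBlocks u.bar 0 0 w.bar).conjTranspose * Matrix.fromBlocks
      (scalarMat Q Fi.transpose) 0 0 (scalarMat Q Ki.transpose) *
      Matrix.fromBlocks u.bar 0 0 w.bar =
      Matrix.fromBlocks (scalarMat Q Fi.transpose) 0 0 (scalarMat Q Ki.transpose) := by
    rw [Matrix.fromBlocks_conjTranspose, Matrix.fromBlocks_multiply, Matrix.fromBlocks_multiply]
    simp only [Matrix.mul_zero, Matrix.zero_mul, add_zero, zero_add, Matrix.conjTranspose_zero,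
      hu.conj_left, hw.conj_left]
  rw [← hs, ← hb] at e2 e3
  refine ⟨?_, e1, e2, e3, ?_⟩
  · have hpsd : (Matrix.fromBlocks F 0 0 K).PosSemidef := by
      obtain ⟨A, rfl⟩ := hu.posDef.posSemidef.exists_eq_conjTranspose_mul_self
      obtain ⟨B, rfl⟩ := hw.posDef.posSemidef.exists_eq_conjTranspose_mul_self
      have h := Matrix.posSemidef_conjTranspose_mul_self (Matrix.fromBlocks A 0 0 B)
      rw [Matrix.fromBlocks_conjTranspose, Matrix.fromBlocks_multiply] at h
      simpa using h
    exact hpsd.posDef_iff_isUnit.2 (IsUnit.of_mul_eq_one _ e1)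
  · intro T hT
    have key : ∀ T : Matrix (u.ι ⊕ w.ι) (u.ι ⊕ w.ι) ℂ,
        scalarMat Q T * Matrix.fromBlocks u.mat 0 0 w.mat =
          Matrix.fromBlocks u.mat 0 0 w.mat * scalarMat Q T →
        (Matrix.fromBlocks F 0 0 K * T).trace = (Matrix.fromBlocks Fi 0 0 Ki * T).trace := by
      intro T hT
      obtain ⟨A, B, C, D, rfl⟩ : ∃ A B C D, T = Matrix.fromBlocks A B C D :=
        ⟨_, _, _, _, (Matrix.fromBlocks_toBlocks T).symm⟩
      have e : scalarMat Q (Matrix.fromBlocks A B C D) = Matrix.fromBlocks (scalarMat Q A)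
          (scalarMat Q B) (scalarMat Q C) (scalarMat Q D) := Matrix.fromBlocks_map _ _ _ _ _
      rw [e, Matrix.fromBlocks_multiply, Matrix.fromBlocks_multiply, Matrix.fromBlocks_inj] at hT
      simp only [Matrix.mul_zero, Matrix.zero_mul, add_zero, zero_add] at hT
      have htr : ∀ (A : Matrix u.ι u.ι ℂ) B C (D : Matrix w.ι w.ι ℂ),
          (Matrix.fromBlocks A B C D).trace = A.trace + D.trace := by
        intro A B C D
        simp [Matrix.trace, Fintype.sum_sum_type]
      rw [Matrix.fromBlocks_multiply, Matrix.fromBlocks_multiply, htr, htr]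
      simp only [Matrix.zero_mul, add_zero, zero_add]
      rw [hu.trace_eq A hT.1, hw.trace_eq D hT.2.2.2]
    exact key T hT

theorem IsSpherical.congr {u w : Rep G} {F Fi : Matrix u.ι u.ι ℂ} (hu : u.IsSpherical F Fi)
    {T : Matrix w.ι u.ι ℂ} (hT : T ∈ Hom u w) (h1 : T.conjTranspose * T = 1)
    (h2 : T * T.conjTranspose = 1) :
    w.IsSpherical (T * F * T.conjTranspose) (T * Fi * T.conjTranspose) := by
  have hS := conjTranspose_mem_Hom hT
  set S := T.conjTranspose with hST
  have hw : w.mat = scalarMat Q T * u.mat * scalarMat Q S := by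
    rw [mem_Hom.1 hT, Matrix.mul_assoc, ← scalarMat_mul, h2, scalarMat_one, Matrix.mul_one]
  have hTt : ∀ X : Matrix u.ι u.ι ℂ,
      (T * X * S).transpose = T.map star * X.transpose * T.transpose := by
    intro X
    rw [Matrix.transpose_mul, Matrix.transpose_mul, ← Matrix.mul_assoc]
    rfl
  have hb : w.bar = scalarMat Q (T.map star) * u.bar * scalarMat Q T.transpose := by
    ext i j
    rw [mul_bar_mul_apply]
    refine congrArg star ?_
    rw [hw, mul_scalarMat_apply]
    simp only [scalarMat_mul_apply, Finset.smul_sum, smul_smul]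
    rw [Finset.sum_comm]
    simp only [hST, Matrix.map_apply, Matrix.conjTranspose_apply, Matrix.transpose_apply, star_star,
      mul_comm]
  have hbH : w.bar.conjTranspose =
      scalarMat Q (T.map star) * u.bar.conjTranspose * scalarMat Q T.transpose := by
    have e1 : (T.transpose).conjTranspose = T.map star := rfl
    have e2 : (T.map star).conjTranspose = T.transpose := by ext i j; simp
    rw [hb, Matrix.conjTranspose_mul, Matrix.conjTranspose_mul, ← scalarMat_conjTranspose,
      ← scalarMat_conjTranspose, e1, e2, Matrix.mul_assoc]
  have hc : scalarMat Q T.transpose * scalarMat Q (T.map star) = 1 := by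
    have e1 := congrArg Matrix.transpose h1
    rw [Matrix.transpose_mul, Matrix.transpose_one] at e1
    rw [← scalarMat_mul, ← scalarMat_one]
    exact congrArg _ e1
  have hmid : ∀ A X B : Matrix u.ι u.ι Q,
      scalarMat Q (T.map star) * A * scalarMat Q T.transpose *
        (scalarMat Q (T.map star) * X * scalarMat Q T.transpose) *
        (scalarMat Q (T.map star) * B * scalarMat Q T.transpose) =
      scalarMat Q (T.map star) * (A * X * B) * scalarMat Q T.transpose := by
    intro A X B
    calc _ = scalarMat Q (T.map star) * A * (scalarMat Q T.transpose * scalarMat Q (T.map star)) * X *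
          (scalarMat Q T.transpose * scalarMat Q (T.map star)) * B * scalarMat Q T.transpose := by
          simp only [Matrix.mul_assoc]
      _ = _ := by
          rw [hc, Matrix.mul_one, Matrix.mul_one]
          simp only [Matrix.mul_assoc]
  refine ⟨?_, ?_, ?_, ?_, ?_⟩
  · refine hu.posDef.mul_mul_conjTranspose_same ?_
    refine Function.LeftInverse.injective (g := fun v => Matrix.vecMul v S) fun v => ?_
    simp only [Matrix.vecMul_vecMul, h2, Matrix.vecMul_one]
  · calc T * F * S * (T * Fi * S) = T * F * (S * T) * Fi * S := by simp only [Matrix.mul_assoc]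
      _ = T * (F * Fi) * S := by rw [h1, Matrix.mul_one, Matrix.mul_assoc T]
      _ = 1 := by rw [hu.mul_inv, Matrix.mul_one, h2]
  · rw [hTt, hbH, hb, scalarMat_mul, scalarMat_mul, hmid, hu.conj_right]
  · rw [hTt, hbH, hb, scalarMat_mul, scalarMat_mul, hmid, hu.conj_left]
  · intro X hX
    have e : ∀ Y : Matrix u.ι u.ι ℂ, (T * Y * S * X).trace = (Y * (S * X * T)).trace := by
      intro Y
      rw [Matrix.mul_assoc, Matrix.mul_assoc, Matrix.trace_mul_comm]
      simp only [Matrix.mul_assoc]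
    rw [e, e]
    exact hu.trace_eq _ (Rep.mul_mem_Hom (Rep.mul_mem_Hom hS hX) hT)

end Rep

end CompactQuantumGroup

/-! ### Multiplicativity of the quantum dimension -/

section Sums

variable {α β γ δ ε M : Type*} [Fintype α] [Fintype β] [Fintype γ] [Fintype δ] [Fintype ε]
  [AddCommMonoid M]

theorem Finset.sum_comm_pair₅ (f : α → β → γ → δ → ε → M) :
    ∑ a, ∑ b, ∑ c, ∑ d, ∑ e, f a b c d e = ∑ d, ∑ e, ∑ c, ∑ a, ∑ b, f a b c d e := by
  simp only [← Fintype.sum_prod_type']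
  exact Fintype.sum_equiv ⟨fun x => (x.2.2.2.1, x.2.2.2.2, x.2.2.1, x.1, x.2.1),
    fun x => (x.2.2.2.1, x.2.2.2.2, x.2.2.1, x.1, x.2.1), fun _ => rfl, fun _ => rfl⟩ _ _
    fun _ => rfl

theorem Finset.sum_comm_reverse₄ (f : α → β → γ → δ → M) :
    ∑ a, ∑ b, ∑ c, ∑ d, f a b c d = ∑ d, ∑ b, ∑ c, ∑ a, f a b c d := by
  simp only [← Fintype.sum_prod_type']
  exact Fintype.sum_equiv ⟨fun x => (x.2.2.2, x.2.1, x.2.2.1, x.1),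
    fun x => (x.2.2.2, x.2.1, x.2.2.1, x.1), fun _ => rfl, fun _ => rfl⟩ _ _
    fun _ => rfl

end Sums

namespace CompactQuantumGroup

variable {Q : Type u} [CStarAlgebra Q] [Nontrivial Q] {H : Type v}
  [NormedAddCommGroup H] [InnerProductSpace ℂ H] [CompleteSpace H] {G : CompactQuantumGroup Q H}

namespace Rep

theorem IsSpherical.conj_right_apply {u : Rep G} {F Fi : Matrix u.ι u.ι ℂ}
    (h : u.IsSpherical F Fi) (i j : u.ι) :
    ∑ k, ∑ l, F l k • (star (u.mat i k) * u.mat j l) = algebraMap ℂ Q (F j i) := by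
  have h1 := congrFun (congrFun h.conj_right i) j
  rw [mul_scalarMat_mul_conjTranspose_apply, Finset.sum_comm] at h1
  refine Eq.trans ?_ h1
  simp only [Matrix.transpose_apply, Matrix.map_apply, star_star]

theorem IsSpherical.conj_left_apply {u : Rep G} {F Fi : Matrix u.ι u.ι ℂ}
    (h : u.IsSpherical F Fi) (i j : u.ι) :
    ∑ k, ∑ l, Fi l k • (u.mat k i * star (u.mat l j)) = algebraMap ℂ Q (Fi j i) := by
  have h1 := congrFun (congrFun h.conj_left i) j
  rw [conjTranspose_mul_scalarMat_mul_apply, Finset.sum_comm] at h1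
  refine Eq.trans ?_ h1
  simp only [Matrix.transpose_apply, Matrix.map_apply, star_star]

open scoped Kronecker

theorem mem_Hom_tensor_iff {u w : Rep G} {T : Matrix (u.ι × w.ι) (u.ι × w.ι) ℂ} :
    T ∈ Hom (u.tensor w) (u.tensor w) ↔ ∀ i i' j j',
      ∑ k, ∑ k', T (i, i') (k, k') • (u.mat k j * w.mat k' j') =
        ∑ k, ∑ k', T (k, k') (j, j') • (u.mat i k * w.mat i' k') := by
  have h : T ∈ Hom (u.tensor w) (u.tensor w) ↔
      scalarMat Q T * (Matrix.of fun i j => u.mat i.1 j.1 * w.mat i.2 j.2) =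
        (Matrix.of fun i j => u.mat i.1 j.1 * w.mat i.2 j.2) * scalarMat Q T := Iff.rfl
  rw [h, ← Matrix.ext_iff, Prod.forall]
  simp only [Prod.forall, scalarMat_mul_apply, mul_scalarMat_apply, Fintype.sum_prod_type,
    Matrix.of_apply]

/-- The partial trace `id ⊗ Tr (F⁻¹ ·)` of an intertwiner. -/
theorem IsSpherical.partialTrace_right_mem_Hom {u w : Rep G} {K Ki : Matrix w.ι w.ι ℂ}
    (hw : w.IsSpherical K Ki) {T : Matrix (u.ι × w.ι) (u.ι × w.ι) ℂ}
    (hT : T ∈ Hom (u.tensor w) (u.tensor w)) :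
    (Matrix.of fun i j => ∑ i', ∑ j', Ki j' i' * T (i, i') (j, j')) ∈ Hom u u := by
  rw [mem_Hom_tensor_iff] at hT
  have hw2 : ∀ k' l', ∑ j', w.mat k' j' * star (w.mat l' j') = if k' = l' then 1 else 0 := by
    intro k' l'
    rw [← Matrix.one_apply, ← w.mul_conjTranspose, Matrix.mul_apply]
    rfl
  -- remove the factor `w k' j'` with the help of unitarity
  have h1 : ∀ i i' j l', ∑ k, T (i, i') (k, l') • u.mat k j =
      ∑ j', ∑ k, ∑ k', T (k, k') (j, j') • (u.mat i k * (w.mat i' k' * star (w.mat l' j'))) := by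
    intro i i' j l'
    have h2 := congrArg (fun f : w.ι → Q => ∑ j', f j' * star (w.mat l' j')) (funext (hT i i' j))
    simp only [Finset.sum_mul, smul_mul_assoc, mul_assoc] at h2
    rw [← h2, Finset.sum_comm]
    refine Finset.sum_congr rfl fun k _ => ?_
    rw [Finset.sum_comm]
    simp only [← Finset.smul_sum, ← Finset.mul_sum, hw2]
    simp
  rw [mem_Hom]
  ext i j
  rw [scalarMat_mul_apply, mul_scalarMat_apply]
  simp only [Matrix.of_apply, Finset.sum_smul, mul_smul]
  have h3 : ∑ k, ∑ i', ∑ l', Ki l' i' • T (i, i') (k, l') • u.mat k j =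
      ∑ i', ∑ l', Ki l' i' • ∑ k, T (i, i') (k, l') • u.mat k j := by
    simp only [Finset.smul_sum]
    rw [Finset.sum_comm]
    exact Finset.sum_congr rfl fun _ _ => Finset.sum_comm
  rw [h3]
  simp only [h1, Finset.smul_sum]
  have h4 : ∀ j' k k', ∑ i', ∑ l', Ki l' i' • T (k, k') (j, j') •
      (u.mat i k * (w.mat i' k' * star (w.mat l' j'))) =
      Ki j' k' • T (k, k') (j, j') • u.mat i k := by
    intro j' k k'
    have h5 := congrArg (fun x => T (k, k') (j, j') • (u.mat i k * x)) (hw.conj_left_apply k' j')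
    simp only [Finset.mul_sum, Finset.smul_sum, mul_smul_comm] at h5
    rw [← Algebra.commutes, ← Algebra.smul_def, smul_comm] at h5
    rw [← h5]
    exact Finset.sum_congr rfl fun _ _ => Finset.sum_congr rfl fun _ _ => smul_comm _ _ _
  have h6 : ∑ i', ∑ l', ∑ j', ∑ k, ∑ k', Ki l' i' • T (k, k') (j, j') •
      (u.mat i k * (w.mat i' k' * star (w.mat l' j'))) =
      ∑ k, ∑ k', ∑ j', ∑ i', ∑ l', Ki l' i' • T (k, k') (j, j') •
      (u.mat i k * (w.mat i' k' * star (w.mat l' j'))) := by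
    exact Finset.sum_comm_pair₅ _
  rw [h6]
  simp only [h4]

/-- The partial trace `Tr (F ·) ⊗ id` of an intertwiner. -/
theorem IsSpherical.partialTrace_left_mem_Hom {u w : Rep G} {F Fi : Matrix u.ι u.ι ℂ}
    (hu : u.IsSpherical F Fi) {T : Matrix (u.ι × w.ι) (u.ι × w.ι) ℂ}
    (hT : T ∈ Hom (u.tensor w) (u.tensor w)) :
    (Matrix.of fun i' j' => ∑ i, ∑ j, F j i * T (i, i') (j, j')) ∈ Hom w w := by
  rw [mem_Hom_tensor_iff] at hT
  have hu2 : ∀ k l, ∑ i, star (u.mat i l) * u.mat i k = if l = k then 1 else 0 := by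
    intro k l
    rw [← Matrix.one_apply, ← u.conjTranspose_mul, Matrix.mul_apply]
    rfl
  have h1 : ∀ i' j j' l, ∑ k', T (l, k') (j, j') • w.mat i' k' =
      ∑ i, ∑ k, ∑ k', T (i, i') (k, k') • (star (u.mat i l) * (u.mat k j * w.mat k' j')) := by
    intro i' j j' l
    have h2 := congrArg (fun f : u.ι → Q => ∑ i, star (u.mat i l) * f i)
      (funext fun i => hT i i' j j')
    simp only [Finset.mul_sum, mul_smul_comm] at h2
    rw [h2, Finset.sum_comm]
    have h3 : ∀ k, ∑ i, ∑ k', T (k, k') (j, j') • (star (u.mat i l) * (u.mat i k * w.mat i' k')) =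
        if l = k then ∑ k', T (k, k') (j, j') • w.mat i' k' else 0 := by
      intro k
      rw [Finset.sum_comm]
      simp only [← Finset.smul_sum, ← mul_assoc, ← Finset.sum_mul, hu2]
      split_ifs <;> simp
    simp [h3]
  rw [mem_Hom]
  ext i' j'
  rw [scalarMat_mul_apply, mul_scalarMat_apply]
  simp only [Matrix.of_apply, Finset.sum_smul, mul_smul]
  have h3 : ∑ k', ∑ l, ∑ j, F j l • T (l, k') (j, j') • w.mat i' k' =
      ∑ l, ∑ j, F j l • ∑ k', T (l, k') (j, j') • w.mat i' k' := by
    simp only [Finset.smul_sum]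
    rw [Finset.sum_comm]
    exact Finset.sum_congr rfl fun _ _ => Finset.sum_comm
  rw [h3]
  simp only [h1, Finset.smul_sum]
  have h4 : ∀ i k k', ∑ l, ∑ j, F j l • T (i, i') (k, k') •
      (star (u.mat i l) * (u.mat k j * w.mat k' j')) =
      F k i • T (i, i') (k, k') • w.mat k' j' := by
    intro i k k'
    have h5 := congrArg (fun x => T (i, i') (k, k') • (x * w.mat k' j')) (hu.conj_right_apply i k)
    simp only [Finset.sum_mul, Finset.smul_sum, smul_mul_assoc, mul_assoc] at h5
    rw [← Algebra.smul_def, smul_comm] at h5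
    rw [← h5]
    exact Finset.sum_congr rfl fun _ _ => Finset.sum_congr rfl fun _ _ => smul_comm _ _ _
  have h6 : ∑ l, ∑ j, ∑ i, ∑ k, ∑ k', F j l • T (i, i') (k, k') •
      (star (u.mat i l) * (u.mat k j * w.mat k' j')) =
      ∑ k', ∑ i, ∑ k, ∑ l, ∑ j, F j l • T (i, i') (k, k') •
      (star (u.mat i l) * (u.mat k j * w.mat k' j')) := by
    rw [Finset.sum_comm_pair₅, Finset.sum_comm]
    exact Finset.sum_congr rfl fun _ _ => Finset.sum_comm
  rw [h6]
  simp only [h4]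

theorem trace_kronecker_mul {ι κ : Type*} [Fintype ι] [Fintype κ] (A : Matrix ι ι ℂ)
    (B : Matrix κ κ ℂ) (T : Matrix (ι × κ) (ι × κ) ℂ) :
    ((A ⊗ₖ B) * T).trace =
      (A * Matrix.of fun i j => ∑ i', ∑ j', B j' i' * T (i, i') (j, j')).trace := by
  simp only [Matrix.trace, Matrix.diag, Matrix.mul_apply, Fintype.sum_prod_type,
    Matrix.kroneckerMap_apply, Matrix.of_apply, Finset.mul_sum]
  refine Finset.sum_congr rfl fun i _ => Finset.sum_comm.trans (Finset.sum_congr rfl fun j _ => ?_)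
  exact Finset.sum_comm.trans (Finset.sum_congr rfl fun _ _ => Finset.sum_congr rfl fun _ _ =>
    mul_assoc _ _ _)

theorem trace_kronecker_mul' {ι κ : Type*} [Fintype ι] [Fintype κ] (A : Matrix ι ι ℂ)
    (B : Matrix κ κ ℂ) (T : Matrix (ι × κ) (ι × κ) ℂ) :
    ((A ⊗ₖ B) * T).trace =
      (B * Matrix.of fun i' j' => ∑ i, ∑ j, A j i * T (i, i') (j, j')).trace := by
  simp only [Matrix.trace, Matrix.diag, Matrix.mul_apply, Fintype.sum_prod_type,
    Matrix.kroneckerMap_apply, Matrix.of_apply, Finset.mul_sum]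
  refine Finset.sum_comm.trans (Finset.sum_congr rfl fun i' _ => ?_)
  rw [Finset.sum_comm]
  refine (Finset.sum_congr rfl fun _ _ => Finset.sum_comm).trans ?_
  rw [Finset.sum_comm]
  exact Finset.sum_congr rfl fun _ _ => Finset.sum_congr rfl fun _ _ =>
    Finset.sum_congr rfl fun _ _ => by ring

/-- On `u ⊗ w`, the traces against `F ⊗ K`, `F ⊗ K⁻¹` and `F⁻¹ ⊗ K⁻¹` agree on intertwiners, as the two
partial traces of an intertwiner are intertwiners of `w` and of `u`. -/
theorem IsSpherical.tensor {u w : Rep G} {F Fi : Matrix u.ι u.ι ℂ} {K Ki : Matrix w.ι w.ι ℂ}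
    (hu : u.IsSpherical F Fi) (hw : w.IsSpherical K Ki) :
    (u.tensor w).IsSpherical (F ⊗ₖ K : Matrix (u.ι × w.ι) (u.ι × w.ι) ℂ)
      (Fi ⊗ₖ Ki : Matrix (u.ι × w.ι) (u.ι × w.ι) ℂ) := by
  refine ⟨hu.posDef.kronecker hw.posDef, ?_, ?_, ?_, ?_⟩
  · have h : (F ⊗ₖ K) * (Fi ⊗ₖ Ki) = 1 := by
      rw [← Matrix.mul_kronecker_mul, hu.mul_inv, hw.mul_inv, Matrix.one_kronecker_one]
    exact h
  · ext ⟨i, i'⟩ ⟨j, j'⟩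
    refine (mul_scalarMat_mul_conjTranspose_apply (u.tensor w).bar _ (i, i') (j, j')).trans ?_
    change ∑ m : u.ι × w.ι, ∑ k : u.ι × w.ι, (F m.1 k.1 * K m.2 k.2) •
      (star (u.mat i k.1 * w.mat i' k.2) * star (star (u.mat j m.1 * w.mat j' m.2))) =
      algebraMap ℂ Q (F j i * K j' i')
    simp only [Fintype.sum_prod_type]
    calc _ = ∑ k', ∑ m', K m' k' • (star (w.mat i' k') *
          (∑ k, ∑ m, F m k • (star (u.mat i k) * u.mat j m)) * w.mat j' m') := by
          simp only [Finset.mul_sum, Finset.sum_mul, Finset.smul_sum, star_star, star_mul,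
            mul_smul_comm, smul_mul_assoc, smul_smul, ← mul_assoc]
          rw [Finset.sum_comm_reverse₄]
          simp only [mul_comm (K _ _)]
      _ = _ := by
          simp only [hu.conj_right_apply, ← Algebra.commutes, ← Algebra.smul_def, smul_mul_assoc]
          simp only [smul_comm _ (F j i), ← Finset.smul_sum, hw.conj_right_apply]
          rw [Algebra.smul_def, ← map_mul]
  · ext ⟨i, i'⟩ ⟨j, j'⟩
    refine (conjTranspose_mul_scalarMat_mul_apply (u.tensor w).bar _ (i, i') (j, j')).trans ?_
    change ∑ m : u.ι × w.ι, ∑ k : u.ι × w.ι, (Fi m.1 k.1 * Ki m.2 k.2) •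
      (star (star (u.mat k.1 i * w.mat k.2 i')) * star (u.mat m.1 j * w.mat m.2 j')) =
      algebraMap ℂ Q (Fi j i * Ki j' i')
    simp only [Fintype.sum_prod_type]
    calc _ = ∑ k, ∑ m, Fi m k • (u.mat k i *
          (∑ k', ∑ m', Ki m' k' • (w.mat k' i' * star (w.mat m' j'))) * star (u.mat m j)) := by
          simp only [Finset.mul_sum, Finset.sum_mul, Finset.smul_sum, star_star, star_mul,
            mul_smul_comm, smul_mul_assoc, smul_smul, ← mul_assoc]
          refine (Finset.sum_congr rfl fun _ _ => Finset.sum_comm).trans (Finset.sum_comm.trans ?_)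
          exact Finset.sum_congr rfl fun _ _ => Finset.sum_congr rfl fun _ _ => Finset.sum_comm
      _ = _ := by
          simp only [hw.conj_left_apply, ← Algebra.commutes, ← Algebra.smul_def, smul_mul_assoc]
          simp only [smul_comm _ (Ki j' i'), ← Finset.smul_sum, hu.conj_left_apply]
          rw [Algebra.smul_def, ← map_mul, mul_comm]
  · intro T hT
    have key : ∀ T : Matrix (u.ι × w.ι) (u.ι × w.ι) ℂ, T ∈ Hom (u.tensor w) (u.tensor w) →
        ((F ⊗ₖ K) * T).trace = ((Fi ⊗ₖ Ki) * T).trace := by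
      intro T hT
      rw [trace_kronecker_mul', hw.trace_eq _ (hu.partialTrace_left_mem_Hom hT),
        ← trace_kronecker_mul', trace_kronecker_mul,
        hu.trace_eq _ (hw.partialTrace_right_mem_Hom hT), ← trace_kronecker_mul]
    exact key T hT

/-- Every representation has a spherical `F`, inherited from the irreducible components; its trace is
the quantum dimension. -/
theorem exists_isSpherical (u : Rep G) :
    ∃ F Fi, u.IsSpherical F Fi ∧ F.trace.re = G.qdim u := by
  have hq : ∀ u, G.qdim u = additiveExt (fun x : Irr G => x.rep.F.trace.re) u := fun _ => rfl
  induction u using Rep.induction with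
  | zero u hu =>
    refine ⟨1, 1, isSpherical_of_dim_eq_zero hu, ?_⟩
    rw [hq, additiveExt_of_dim_eq_zero _ hu, Matrix.trace_one]
    exact_mod_cast hu
  | irr u hu =>
    obtain ⟨S, hS, h1, h2⟩ := (Irr.rep_mk_equivalent u hu).exists_unitary (Irr.isIrreducible _) hu
    refine ⟨_, _, (Irr.isIrreducible _).isSpherical_F.congr hS h1 h2, ?_⟩
    rw [hq, additiveExt_of_isIrreducible _ hu, Matrix.mul_assoc, Matrix.trace_mul_comm,
      Matrix.mul_assoc, h1, Matrix.mul_one]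
  | sum u w hu hw =>
    obtain ⟨F, Fi, hF, hF'⟩ := hu
    obtain ⟨K, Ki, hK, hK'⟩ := hw
    refine ⟨_, _, hF.sum hK, ?_⟩
    rw [hq, additiveExt_sum, ← hq, ← hq, ← hF', ← hK', ← Complex.add_re]
    have h : (Matrix.fromBlocks F 0 0 K).trace = F.trace + K.trace := by
      simp [Matrix.trace, Fintype.sum_sum_type]
    rw [← h]
    rfl
  | congr u w T hT h1 h2 hu =>
    obtain ⟨F, Fi, hF, hF'⟩ := hu
    refine ⟨_, _, hF.congr hT h1 h2, ?_⟩
    rw [hq, ← additiveExt_congr _ (equivalent_of_unitary hT h1 h2), ← hq, ← hF', Matrix.mul_assoc,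
      Matrix.trace_mul_comm, Matrix.mul_assoc, h1, Matrix.mul_one]

theorem IsSpherical.trace_re {u : Rep G} {F Fi : Matrix u.ι u.ι ℂ} (h : u.IsSpherical F Fi) :
    F.trace.re = G.qdim u := by
  obtain ⟨F₀, Fi₀, h₀, e⟩ := u.exists_isSpherical
  rw [h.trace_unique h₀, e]

end Rep

theorem qdim_trivial : G.qdim (Rep.trivial G) = 1 := by
  rw [← Rep.isSpherical_trivial.trace_re, Matrix.trace_one]
  exact congrArg Complex.re (Nat.cast_eq_one.2 (Fintype.card_unit))

theorem qdim_sum (u w : Rep G) : G.qdim (u.sum w) = G.qdim u + G.qdim w := additiveExt_sum _ u w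

theorem qdim_congr {u w : Rep G} (h : u.Equivalent w) : G.qdim u = G.qdim w :=
  additiveExt_congr _ h

theorem qdim_nonneg (u : Rep G) : 0 ≤ G.qdim u := by
  obtain ⟨F, Fi, h, e⟩ := u.exists_isSpherical
  rw [← e]
  exact (Complex.le_def.1 h.posDef.posSemidef.trace_nonneg).1

theorem qdim_tensor (u w : Rep G) : G.qdim (u.tensor w) = G.qdim u * G.qdim w := by
  obtain ⟨F, Fi, h, e⟩ := u.exists_isSpherical
  obtain ⟨K, Ki, h', e'⟩ := w.exists_isSpherical
  rw [← (h.tensor h').trace_re, ← e, ← e']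
  have h1 := Matrix.trace_kronecker F K
  have h2 := (Complex.le_def.1 h.posDef.posSemidef.trace_nonneg).2
  have h3 := congrArg Complex.re h1
  rw [Complex.mul_re, ← h2, Complex.zero_im, zero_mul, sub_zero] at h3
  exact h3

/-- If the quantum dimension does not exceed the vector dimension, then the inequality
`dim u ≤ Tr F_u` is an equality for all irreducible `u`, and `F_u = 1`. -/
theorem isKac_of_qdim_le (h : ∀ u, G.qdim u ≤ G.vdim u) : G.IsKac := by
  intro u hu
  have hF := hu.isSpherical_F
  refine hF.posDef.eq_one_of_trace_le hF.mul_inv hF.trace_eq_trace ?_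
  rw [hF.trace_re]
  exact h u

theorem vdim_trivial : G.vdim (Rep.trivial G) = 1 :=
  Nat.cast_eq_one.2 Fintype.card_unit

theorem vdim_sum (u w : Rep G) : G.vdim (u.sum w) = G.vdim u + G.vdim w := by
  have h : (u.sum w).dim = u.dim + w.dim := Fintype.card_sum
  simp [vdim, h]

theorem vdim_tensor (u w : Rep G) : G.vdim (u.tensor w) = G.vdim u * G.vdim w := by
  have h : (u.tensor w).dim = u.dim * w.dim := Fintype.card_prod _ _
  simp [vdim, h]

theorem vdim_congr {u w : Rep G} (h : u.Equivalent w) : G.vdim u = G.vdim w := by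
  simp [vdim, h.dim_eq]

theorem IsKac.qdim_eq_vdim (h : G.IsKac) : G.qdim = G.vdim := by
  funext u
  rw [eq_additiveExt (d := G.vdim) (fun _ _ => vdim_congr) vdim_sum u]
  refine finsum_congr fun x => ?_
  rw [h _ x.isIrreducible, Matrix.trace_one]
  simp [vdim, Rep.dim, mult]

end CompactQuantumGroup

/-! ### Growth and the comparison of dimension functions -/

namespace CompactQuantumGroup

variable {Q : Type u} [CStarAlgebra Q] [Nontrivial Q] {H : Type v}
  [NormedAddCommGroup H] [InnerProductSpace ℂ H] [CompleteSpace H] {G : CompactQuantumGroup Q H}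

/-- A function of classes of representations that is additive, multiplicative and nonnegative. These
are the properties that vector dimension, quantum dimension and dimension functions share; invariance
under conjugation is not needed for comparing them. -/
structure IsNonnegHom (d : Rep G → ℝ) : Prop where
  congr : ∀ {u w : Rep G}, u.Equivalent w → d u = d w
  sum : ∀ u w : Rep G, d (u.sum w) = d u + d w
  tensor : ∀ u w : Rep G, d (u.tensor w) = d u * d w
  trivial : d (Rep.trivial G) = 1
  nonneg : ∀ u : Rep G, 0 ≤ d u

theorem isNonnegHom_qdim : IsNonnegHom G.qdim :=
  ⟨qdim_congr, qdim_sum, qdim_tensor, qdim_trivial, qdim_nonneg⟩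

theorem isNonnegHom_vdim : IsNonnegHom G.vdim :=
  ⟨vdim_congr, vdim_sum, vdim_tensor, vdim_trivial, fun _ => Nat.cast_nonneg _⟩

theorem one_le_vdim (x : Irr G) : 1 ≤ G.vdim x.rep := by
  rw [vdim, Nat.one_le_cast, Nat.one_le_iff_ne_zero]
  exact x.isIrreducible.1

namespace Rep

theorem isIrreducible_trivial : (trivial G).IsIrreducible := by
  refine ⟨by rw [dim]; exact Fintype.card_ne_zero (α := Unit), ?_⟩
  rintro w ⟨T, -, hT⟩
  have h : Fintype.card w.ι ≤ Fintype.card Unit := by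
    have hi : Function.Injective (Matrix.mulVecLin T) :=
      Function.LeftInverse.injective (g := T.conjTranspose.mulVec) fun v => by
        rw [Matrix.mulVecLin_apply, Matrix.mulVec_mulVec, hT, Matrix.one_mulVec]
    have h1 := LinearMap.finrank_le_finrank_of_injective hi
    rwa [Module.finrank_fintype_fun_eq_card, Module.finrank_fintype_fun_eq_card] at h1
  change Fintype.card w.ι = 0 ∨ Fintype.card w.ι = Fintype.card Unit
  rw [Fintype.card_unit] at h ⊢
  omega

theorem IsSubrep.of_equivalent {x y u : Rep G} (h : IsSubrep x u) (hyx : y.Equivalent x)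
    (hy : y.IsIrreducible) (hx : x.IsIrreducible) : IsSubrep y u := by
  obtain ⟨T, hT, hTT⟩ := h
  obtain ⟨S, hS, hSS, -⟩ := hyx.exists_unitary hy hx
  refine ⟨T * S, mul_mem_Hom hT hS, ?_⟩
  rw [Matrix.conjTranspose_mul, Matrix.mul_assoc, ← Matrix.mul_assoc _ T, hTT, Matrix.one_mul, hSS]

/-- The trivial representation is contained in `u ⊗ w` if `w` is a conjugate of `u`. -/
theorem isSubrep_trivial_tensor {u w : Rep G} (hu : u.dim ≠ 0) (c : Conjugation u w) :
    IsSubrep (trivial G) (u.tensor w) := by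
  set C := c.Jinv.conjTranspose with hC
  have hDC : c.J.conjTranspose * C = 1 := by
    rw [hC, ← Matrix.conjTranspose_mul, c.inv_mul, Matrix.conjTranspose_one]
  have h1 : w.mat * scalarMat Q C = scalarMat Q C * u.bar := by
    rw [c.mat_eq, Matrix.mul_assoc, ← scalarMat_mul, hDC, scalarMat_one, Matrix.mul_one]
  have h2 : ∀ k j, ∑ l, C l j • w.mat k l = ∑ a, C k a • star (u.mat a j) := by
    intro k j
    have h3 := congrFun (congrFun h1 k) j
    rw [mul_scalarMat_apply, scalarMat_mul_apply] at h3
    exact h3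
  have h4 : ∀ i a, ∑ j, u.mat i j * star (u.mat a j) = if i = a then 1 else 0 := by
    intro i a
    rw [← Matrix.one_apply, ← u.mul_conjTranspose, Matrix.mul_apply]
    rfl
  -- the invariant vector `∑ C k i • e_i ⊗ f_k`
  let T : Matrix (u.ι × w.ι) Unit ℂ := Matrix.of fun p _ => C p.2 p.1
  have hT : T ∈ Hom (trivial G) (u.tensor w) := by
    have e : scalarMat Q T * (1 : Matrix Unit Unit Q) =
        (Matrix.of fun i j => u.mat i.1 j.1 * w.mat i.2 j.2) * scalarMat Q T := by
      ext ⟨i, k⟩ x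
      rw [Matrix.mul_one]
      refine Eq.symm ((mul_scalarMat_apply _ _ _ _).trans ((Fintype.sum_prod_type _).trans ?_))
      have h5 : ∀ j, ∑ l, C l j • (u.mat i j * w.mat k l) =
          ∑ a, C k a • (u.mat i j * star (u.mat a j)) := by
        intro j
        simp only [← mul_smul_comm, ← Finset.mul_sum, h2]
      refine (Finset.sum_congr rfl fun j _ => h5 j).trans ?_
      rw [Finset.sum_comm]
      simp only [← Finset.smul_sum, h4]
      simp [T, Algebra.algebraMap_eq_smul_one]
    exact e
  refine isIrreducible_trivial.exists_isometry hT fun h0 => hu ?_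
  have hC0 : C = 0 := by
    ext k i
    exact congrFun (congrFun h0 (i, k)) ()
  rw [hC0, Matrix.mul_zero] at hDC
  have h6 := congrArg Matrix.trace hDC
  rw [Matrix.trace_zero, Matrix.trace_one] at h6
  exact_mod_cast h6.symm

end Rep

theorem mult_mul_le {d : Rep G → ℝ} (congr : ∀ u w : Rep G, u.Equivalent w → d u = d w)
    (sum : ∀ u w : Rep G, d (u.sum w) = d u + d w) (hd : ∀ x : Irr G, 0 ≤ d x.rep) (x : Irr G)
    (u : Rep G) : mult x u * d x.rep ≤ d u := by
  rw [eq_additiveExt congr sum u]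
  exact single_le_finsum x (finite_support_mult_mul _ u) fun y =>
    mul_nonneg (Nat.cast_nonneg _) (hd y)

theorem IsDimensionFunction.isNonnegHom {d : Rep G → ℝ} (hd : G.IsDimensionFunction d) :
    IsNonnegHom d where
  congr := hd.congr _ _
  sum := hd.sum
  tensor := hd.tensor
  trivial := by
    have hpos := hd.pos (Rep.trivial G) Rep.isIrreducible_trivial.1
    have h : ((Rep.trivial G).tensor (Rep.trivial G)).Equivalent (Rep.trivial G) := by
      refine ⟨(Matrix.of fun _ _ => 1 : Matrix Unit (Unit × Unit) ℂ), ?_,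
        (Matrix.of fun _ _ => 1 : Matrix (Unit × Unit) Unit ℂ), ?_, ?_⟩
      · have e : scalarMat Q (Matrix.of fun _ _ => 1 : Matrix Unit (Unit × Unit) ℂ) *
            (Matrix.of fun i j => (1 : Matrix Unit Unit Q) i.1 j.1 * (1 : Matrix Unit Unit Q) i.2 j.2) =
            (1 : Matrix Unit Unit Q) *
              scalarMat Q (Matrix.of fun _ _ => 1 : Matrix Unit (Unit × Unit) ℂ) := by
          ext i j
          rw [Matrix.one_mul]
          exact (scalarMat_mul_apply _ _ i j).trans (by simp)
        exact e
      · have e : (Matrix.of fun _ _ => 1 : Matrix (Unit × Unit) Unit ℂ) *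
            (Matrix.of fun _ _ => 1 : Matrix Unit (Unit × Unit) ℂ) = 1 := by
          ext i j
          obtain rfl := Subsingleton.elim i j
          simp [Matrix.mul_apply]
        exact e
      · have e : (Matrix.of fun _ _ => 1 : Matrix Unit (Unit × Unit) ℂ) *
            (Matrix.of fun _ _ => 1 : Matrix (Unit × Unit) Unit ℂ) = 1 := by
          ext i j
          simp [Matrix.mul_apply]
        exact e
    have h1 := hd.congr _ _ h
    rw [hd.tensor] at h1
    exact mul_left_cancel₀ hpos.ne' (h1.trans (mul_one _).symm)
  nonneg u := by
    rw [eq_additiveExt hd.congr hd.sum u]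
    exact finsum_nonneg fun x =>
      mul_nonneg (Nat.cast_nonneg _) (hd.pos _ x.isIrreducible.1).le

/-- A conjugate `w` of `x` has `d(x)² = d(x ⊗ w) ≥ d(1) = 1`. -/
theorem IsDimensionFunction.one_le {d : Rep G → ℝ} (hd : G.IsDimensionFunction d) (x : Irr G) :
    1 ≤ d x.rep := by
  obtain ⟨w, c, -⟩ := x.isIrreducible.exists_conjugation
  have hpos := hd.pos _ x.isIrreducible.1
  have h1 : d (x.rep.tensor w) = d x.rep * d x.rep := by rw [hd.tensor, hd.conj _ _ ⟨c⟩]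
  set y := Irr.mk (Rep.trivial G) Rep.isIrreducible_trivial
  have hy := Irr.rep_mk_equivalent (Rep.trivial G) Rep.isIrreducible_trivial
  have h2 : mult y (x.rep.tensor w) ≠ 0 :=
    isSubrep_rep_iff.1 ((Rep.isSubrep_trivial_tensor x.isIrreducible.1 c).of_equivalent hy
      y.isIrreducible Rep.isIrreducible_trivial)
  have h3 := mult_mul_le hd.congr hd.sum (fun z => (hd.pos _ z.isIrreducible.1).le) y
    (x.rep.tensor w)
  rw [hd.congr _ _ hy, hd.isNonnegHom.trivial, mul_one, h1] at h3
  have h4 : (1 : ℝ) ≤ mult y (x.rep.tensor w) := by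
    exact_mod_cast Nat.one_le_iff_ne_zero.2 h2
  nlinarith

theorem IsNonnegHom.tpow {d : Rep G → ℝ} (hd : IsNonnegHom d) (u : Rep G) (n : ℕ) :
    d (u.tpow n) = d u ^ n := by
  induction n with
  | zero => rw [pow_zero]; exact hd.trivial
  | succ n ih => rw [pow_succ, ← ih]; exact hd.tensor _ _

theorem finite_setOf_isSubrep_tpow (u : Rep G) (n : ℕ) :
    {x : Irr G | ∃ k ≤ n, Rep.IsSubrep x.rep (u.tpow k)}.Finite := by
  refine ((Set.finite_Iic n).biUnion fun k _ => finite_support_mult (u.tpow k)).subset ?_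
  rintro x ⟨k, hk, hx⟩
  exact Set.mem_biUnion (Set.mem_Iic.2 hk) (isSubrep_rep_iff.1 hx)

theorem growth_eq_sum (d : Rep G → ℝ) (u : Rep G) (n : ℕ) :
    growth d u n = ∑ x ∈ (finite_setOf_isSubrep_tpow u n).toFinset, d x.rep ^ 2 :=
  finsum_mem_eq_finite_toFinset_sum _ (finite_setOf_isSubrep_tpow u n)

theorem growth_nonneg (d : Rep G → ℝ) (u : Rep G) (n : ℕ) : 0 ≤ growth d u n := by
  rw [growth_eq_sum]
  exact Finset.sum_nonneg fun _ _ => sq_nonneg _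

/-- If `m_x` is the multiplicity of `x` in `u^{⊗ n}`, then `d(u)ⁿ = ∑ m_x d(x)`, whose square is at
most `(∑ m_x²) b(u, n)` by the Cauchy-Schwarz inequality. As `1 ≤ d'(x)`, one has
`∑ m_x² ≤ (∑ m_x d'(x))² = d'(u)²ⁿ`. -/
theorem pow_le_pow_mul_growth {d d' : Rep G → ℝ} (hd : IsNonnegHom d) (hd' : IsNonnegHom d')
    (h1 : ∀ x : Irr G, 1 ≤ d' x.rep) (u : Rep G) (n : ℕ) :
    (d u ^ n) ^ 2 ≤ (d' u ^ n) ^ 2 * growth d u n := by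
  have hs := finite_support_mult (u.tpow n)
  have e : ∀ {d : Rep G → ℝ}, IsNonnegHom d →
      d u ^ n = ∑ x ∈ hs.toFinset, (mult x (u.tpow n) : ℝ) * d x.rep := by
    intro d hd
    rw [← hd.tpow, eq_additiveExt (fun _ _ => hd.congr) hd.sum]
    refine finsum_eq_sum_of_support_subset _ fun x hx => ?_
    rw [Set.Finite.coe_toFinset]
    exact fun h0 => hx (by simp [show mult x (u.tpow n) = 0 from h0])
  rw [e hd]
  refine (Finset.sum_mul_sq_le_sq_mul_sq _ _ _).trans ?_
  refine mul_le_mul ?_ ?_ (Finset.sum_nonneg fun _ _ => sq_nonneg _) (sq_nonneg _)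
  · rw [e hd']
    refine (Finset.sum_sq_le_sq_sum_of_nonneg fun _ _ => Nat.cast_nonneg _).trans ?_
    refine pow_le_pow_left₀ (Finset.sum_nonneg fun _ _ => Nat.cast_nonneg _) ?_ 2
    exact Finset.sum_le_sum fun x _ => le_mul_of_one_le_right (Nat.cast_nonneg _) (h1 x)
  · rw [growth_eq_sum]
    refine Finset.sum_le_sum_of_subset_of_nonneg (fun x hx => ?_) fun _ _ _ => sq_nonneg _
    rw [Set.Finite.mem_toFinset] at hx ⊢
    exact ⟨n, le_rfl, isSubrep_rep_iff.2 hx⟩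

/-- If `d u > d' u > 0`, then `pow_le_pow_mul_growth` shows that `b(u, n) ≥ rⁿ` for all `n`, with
`r = (d u / d' u)² > 1`. -/
theorem le_of_growth {d d' : Rep G → ℝ} (hd : IsNonnegHom d) (hd' : IsNonnegHom d')
    (h1 : ∀ x : Irr G, 1 ≤ d' x.rep) {u : Rep G}
    (hg : ∀ r : ℝ, 1 < r → ∃ n, 0 < n ∧ growth d u n < r ^ n) : d u ≤ d' u := by
  by_contra! hlt
  rcases (hd'.nonneg u).eq_or_lt with h0 | h0
  · obtain ⟨n, hn, -⟩ := hg 2 one_lt_two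
    have h := pow_le_pow_mul_growth hd hd' h1 u n
    rw [← h0, zero_pow hn.ne', zero_pow two_ne_zero, zero_mul] at h
    have : 0 < (d u ^ n) ^ 2 := by
      rw [← h0] at hlt
      positivity
    linarith
  · have hr : 1 < (d u / d' u) ^ 2 := by
      have : 1 < d u / d' u := (one_lt_div h0).2 hlt
      exact one_lt_pow₀ this two_ne_zero
    obtain ⟨n, -, hn⟩ := hg _ hr
    have h := pow_le_pow_mul_growth hd hd' h1 u n
    have h2 : (d' u ^ n) ^ 2 * growth d u n < (d' u ^ n) ^ 2 * ((d u / d' u) ^ 2) ^ n := by gcongr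
    have h3 : (d' u ^ n) ^ 2 * ((d u / d' u) ^ 2) ^ n = (d u ^ n) ^ 2 := by
      rw [div_pow, div_pow, ← pow_mul, ← pow_mul, ← pow_mul, ← pow_mul, mul_comm 2 n]
      field_simp
    linarith

theorem SubexponentialGrowth.exists_growth_lt {d : Rep G → ℝ} (h : SubexponentialGrowth d)
    (u : Rep G) (r : ℝ) (hr : 1 < r) : ∃ n, 0 < n ∧ growth d u n < r ^ n := by
  obtain ⟨n, hn, hn0⟩ :=
    (((h u).eventually (gt_mem_nhds hr)).and (Filter.eventually_gt_atTop 0)).exists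
  refine ⟨n, hn0, ?_⟩
  have h1 := pow_lt_pow_left₀ hn (Real.rpow_nonneg (growth_nonneg d u n) _) hn0.ne'
  rwa [one_div, Real.rpow_inv_natCast_pow (growth_nonneg d u n) hn0.ne'] at h1

theorem PolynomialGrowth.exists_growth_lt {d : Rep G → ℝ} (h : PolynomialGrowth d)
    (u : Rep G) (r : ℝ) (hr : 1 < r) : ∃ n, 0 < n ∧ growth d u n < r ^ n := by
  obtain ⟨γ, -, hγ⟩ := h u
  have h1 := (isLittleO_rpow_exp_pos_mul_atTop γ (Real.log_pos hr)).comp_tendsto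
    tendsto_natCast_atTop_atTop
  have h2 := hγ.trans_isLittleO h1
  obtain ⟨n, hn, hn0⟩ := ((h2.bound (show (0 : ℝ) < 1 / 2 by norm_num)).and
    (Filter.eventually_gt_atTop 0)).exists
  refine ⟨n, hn0, ?_⟩
  have h3 : Real.exp (Real.log r * n) = r ^ n := by
    rw [mul_comm, Real.exp_nat_mul, Real.exp_log (by linarith)]
  rw [Real.norm_of_nonneg (growth_nonneg d u n), Function.comp_apply, h3,
    Real.norm_of_nonneg (by positivity)] at hn
  have : 0 < r ^ n := by positivity
  linarith

theorem isKac_of_growth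
    (hg : ∀ (u : Rep G) (r : ℝ), 1 < r → ∃ n, 0 < n ∧ growth G.qdim u n < r ^ n) : G.IsKac :=
  isKac_of_qdim_le fun u => le_of_growth isNonnegHom_qdim isNonnegHom_vdim one_le_vdim (hg u)

end CompactQuantumGroup

end

theorem proposition4p3 {Q : Type u} [CStarAlgebra Q] [Nontrivial Q] {H : Type v}
    [NormedAddCommGroup H] [InnerProductSpace ℂ H] [CompleteSpace H]
    (G : CompactQuantumGroup Q H) :
    (∀ d : G.Rep → ℝ, G.IsDimensionFunction d →
      CompactQuantumGroup.SubexponentialGrowth d →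
        ∀ d' : G.Rep → ℝ, G.IsDimensionFunction d' → ∀ w : G.Rep, d w ≤ d' w) ∧
    (∀ d d' : G.Rep → ℝ,
      G.IsDimensionFunction d → CompactQuantumGroup.SubexponentialGrowth d →
      G.IsDimensionFunction d' → CompactQuantumGroup.SubexponentialGrowth d' → d = d') ∧
    (CompactQuantumGroup.PolynomialGrowth G.qdim ↔
      CompactQuantumGroup.PolynomialGrowth G.vdim ∧ G.IsKac) ∧
    (CompactQuantumGroup.SubexponentialGrowth G.qdim ↔
      CompactQuantumGroup.SubexponentialGrowth G.vdim ∧ G.IsKac) := by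
  have hle : ∀ d : G.Rep → ℝ, G.IsDimensionFunction d →
      CompactQuantumGroup.SubexponentialGrowth d →
        ∀ d' : G.Rep → ℝ, G.IsDimensionFunction d' → ∀ w : G.Rep, d w ≤ d' w :=
    fun d hd hg d' hd' w => CompactQuantumGroup.le_of_growth hd.isNonnegHom hd'.isNonnegHom
      hd'.one_le (hg.exists_growth_lt w)
  refine ⟨hle, fun d d' hd hg hd' hg' => funext fun w =>
    le_antisymm (hle d hd hg d' hd' w) (hle d' hd' hg' d hd w), ⟨fun h => ?_, fun h => ?_⟩,
    ⟨fun h => ?_, fun h => ?_⟩⟩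
  · have hK := CompactQuantumGroup.isKac_of_growth h.exists_growth_lt
    exact ⟨hK.qdim_eq_vdim ▸ h, hK⟩
  · exact h.2.qdim_eq_vdim ▸ h.1
  · have hK := CompactQuantumGroup.isKac_of_growth h.exists_growth_lt
    exact ⟨hK.qdim_eq_vdim ▸ h, hK⟩
  · exact h.2.qdim_eq_vdim ▸ h.1
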